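/- **Definitions.** Let $e_1,\dots,e_d$ be the standard basis of $\mathbb{R}^d$. A polytope $P\subseteq\mathbb{R}^d$ is *locally anti-blocking* if for every coordinate subspace $H=\mathrm{span}\{e_j : j\in J\}$, $J\subseteq\{1,\dots,d\}$, the orthogonal projection of $P$ to $H$ equals $P\cap H$; it is *proper* if $0$ is in the interior of $P$. The *standard fan* $\Phi$ consists of the cones positively spanned by the subsets of $\{\pm e_1,\dots,\pm e_d\}$ that do not contain both $e_i$ and $-e_i$ for any $i$. A *flag* of a $k$-dimensional polytope $Q$ is a sequence $F=(F_{-1}\subsetneq F_0\subsetneq\dots\subsetneq F_k)$ of faces of $Q$ (the empty set, of dimension $-1$, and $Q$ itself included) with $\dim F_i=i$. The *sign* of $F$ is the intersection of all cones $C\in\Phi$ that meet the relative interior of $F_i$ for every $i\in\{0,\dots,k\}$. For $C\in\Phi$ let $\mathcal{F}_C(P)$ be the set of flags of the section $P\cap\mathrm{lin}\,C$ whose sign is $C$, where $\mathrm{lin}\,C$ is the linear span of $C$. **Proposition.** Let $P\subseteq\mathbb{R}^d$ be a proper locally anti-blocking polytope. 1. For every $d$-dimensional cone $D\in\Phi$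 (that is, every orthant), at least $d!$ flags of $P$ have sign $D$. 2. For every $D\in\Phi$, of any dimension, $|\mathcal{F}_D(P)|\ge(\dim D)!$. 3. For every $D\in\Phi$ and every facet $C\in\Phi$ of $D$ there is an injection $\chi_C^D:\mathcal{F}_C(P)\to\mathcal{F}_D(P)$. -/

import Mathlib

open scoped Nat NNReal

noncomputable section

/-- The affine dimension of a subset of a real vector space; the empty set has dimension `-1`. -/
def affDim {E : Type*} [AddCommGroup E] [Module ℝ E] (S : Set E) : ℤ :=
  open scoped Classical in
  if S = ∅ then -1 else (Module.finrank ℝ (vectorSpan ℝ S) : ℤ)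

/-- A polytope: a compact set that is the intersection of finitely many closed half-spaces. -/
def IsPolytope {d : ℕ} (P : Set (EuclideanSpace ℝ (Fin d))) : Prop :=
  IsCompact P ∧ ∃ H : Finset (EuclideanSpace ℝ (Fin d) × ℝ),
    P = {x | ∀ h ∈ H, inner ℝ x h.1 ≤ h.2}

/-- The standard basis vector `e_i` of `ℝ^d`. -/
def stdVec {d : ℕ} (i : Fin d) : EuclideanSpace ℝ (Fin d) :=
  EuclideanSpace.single i (1 : ℝ)

/-- The coordinate subspace `ℝ^J` spanned by the `e_j` with `j ∈ J`. -/
def coordSubspace {d : ℕ} (J : Set (Fin d)) : Submodule ℝ (EuclideanSpace ℝ (Fin d)) :=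
  Submodule.span ℝ (stdVec '' J)

/-- `P` is locally anti-blocking: the orthogonal projection of `P` to each coordinate subspace
equals the section of `P` by that subspace. -/
def IsLocallyAntiBlocking {d : ℕ} (P : Set (EuclideanSpace ℝ (Fin d))) : Prop :=
  ∀ J : Set (Fin d), (coordSubspace J).starProjection '' P = P ∩ (coordSubspace J : Set _)

/-- The standard fan: the cones positively spanned by those subsets of `{± e_i}` that do not
contain both `e_i` and `-e_i` for any `i`. -/
def stdFan (d : ℕ) : Set (PointedCone ℝ (EuclideanSpace ℝ (Fin d))) :=
  {C | ∃ A : Set (EuclideanSpace ℝ (Fin d)),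
    (∀ v ∈ A, ∃ i : Fin d, v = stdVec i ∨ v = -stdVec i) ∧
    (∀ i : Fin d, ¬ (stdVec i ∈ A ∧ -stdVec i ∈ A)) ∧
    C = PointedCone.hull ℝ A}

/-- The linear span of a cone, as a set. -/
def linSpan {d : ℕ} (C : PointedCone ℝ (EuclideanSpace ℝ (Fin d))) :
    Set (EuclideanSpace ℝ (Fin d)) :=
  (Submodule.span ℝ (C : Set (EuclideanSpace ℝ (Fin d))) : Set (EuclideanSpace ℝ (Fin d)))

/-- `C` is a facet of the cone `D`: a face of dimension `dim D - 1`. -/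
def IsFacetOf {d : ℕ} (C D : PointedCone ℝ (EuclideanSpace ℝ (Fin d))) : Prop :=
  IsExposed ℝ (D : Set (EuclideanSpace ℝ (Fin d))) (C : Set (EuclideanSpace ℝ (Fin d))) ∧
    affDim (C : Set (EuclideanSpace ℝ (Fin d))) =
      affDim (D : Set (EuclideanSpace ℝ (Fin d))) - 1

/-- A (full) flag `(F_{-1}, F_0, …, F_k)` of a polytope `P` of dimension `k`: a strictly increasing
sequence of faces of `P`, one in each dimension. Faces are exposed faces, including `∅` and `P`. -/
@[ext]
structure Flags {d : ℕ} (P : Set (EuclideanSpace ℝ (Fin d))) where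
  face : Set.Icc (-1 : ℤ) (affDim P) → Set (EuclideanSpace ℝ (Fin d))
  isFace : ∀ i, IsExposed ℝ P (face i)
  dim_face : ∀ i, affDim (face i) = (i : ℤ)
  strictMono : StrictMono face

/-- The sign of a flag: the intersection of all cones of the standard fan that meet the relative
interiors of all the nonempty faces of the flag. -/
def Flags.sign {d : ℕ} {P : Set (EuclideanSpace ℝ (Fin d))} (F : Flags P) :
    PointedCone ℝ (EuclideanSpace ℝ (Fin d)) :=
  sInf {C | C ∈ stdFan d ∧ ∀ i : Set.Icc (-1 : ℤ) (affDim P), 0 ≤ (i : ℤ) →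
    (intrinsicInterior ℝ (F.face i) ∩ (C : Set (EuclideanSpace ℝ (Fin d)))).Nonempty}

/-- The set of flags of the section `P ∩ lin C` whose sign is exactly `C`. -/
def signedFlags {d : ℕ} (C : PointedCone ℝ (EuclideanSpace ℝ (Fin d)))
    (P : Set (EuclideanSpace ℝ (Fin d))) : Set (Flags (P ∩ linSpan C)) :=
  {F | F.sign = C}

end

/-!
# Counting flags of locally anti-blocking polytopes by sign

Let `Q` be the section of `P` by the span of a cone `D` of dimension `k` of the standard fan, and
let `σ` be the sign vector of `D`. In the relative interior of every nonempty face `F` of `Q`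
there is a point `c F` that lies in all coordinate hyperplanes which have points of `F` on both
sides: the anti-blocking property allows to replace such a coordinate by zero
(`IsCoordSection.exists_isRep`). The cones of the fan that meet the relative interior of `F` are
the cones that contain `c F` (`IsRep.orthantCone_meets_iff`). Hence a flag has sign `D` exactly if
the signs of the coordinates of its representative points are compatible and combine to `σ`
(`Flags.HasSign`).

The lower bound `k!` comes from a signed count. The weight of a flag is the determinant of the
matrix of signs of the points `c F_0, …, c F_{k-1}`, multiplied by the sign of the determinant of
the matrix of the points themselves. Along a flag, a coordinate has nonzero sign on an interval of
faces, so the columns of the sign matrix are intervals up to sign, the determinant is `0` or `±1`,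
and the weight is at most `1` (`Flags.HasSign.abs_weight_le_one`). It remains to see that the
weights of all flags of sign `D` add up to `k!` (`Flags.sum_weight`), by induction on `k`.

* A normal vector of the facet `F_{k-1}` has positive inner product with the vertex `F_0`, so they
  have a common nonzero coordinate. In that coordinate no proper face of the flag has sign zero,
  since the normal vector vanishes in the coordinates that take both signs on the facet
  (`Flags.exists_common_coord`). The corresponding column of the sign matrix is constant, and
  Cramer's rule writes the weight as a sum over the levels `i` of the determinants with row `i`
  replaced by `σ` (`Flags.HasSign.weight_eq_sum`).
* For fixed `i`, a flag and the flag obtained by exchanging its face `F_i` have the same replaced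
  matrix, but opposite orientations (`Flags.AdjAt.sign_det`). So their contributions cancel,
  unless the exchange leads to a flag of a different sign.
* In the latter case `F_i` is the only face of the flag with nonzero sign in some coordinate `l`
  (`Flags.AdjAt.exists_onlyAt`). Such flags correspond to the flags of the section `Q ∩ {x_l = 0}`
  whose sign is the facet of `D` in `{x_l = 0}` (`Flags.IsExtension`), and expanding both
  determinants along the column of `l` identifies the contribution with the weight of the flag of
  the section (`Flags.IsExtension.weight_eq`). By induction each of the `k` coordinates
  contributes `(k-1)!`.

The same correspondence is the injection for a facet of `D`: every flag of the section extends to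
a flag of `Q` by one new face on the prescribed side of the hyperplane (`Flags.exists_extension`),
and it is recovered from the extension (`Flags.IsExtension.section_unique`).

Faces are handled through the cone over `Q`, where the face of a point `p` is described by the
common kernel `faceSpan` of the inequalities that are tight at `p`.
-/

/-! ### Faces of polyhedral cones -/

section Cone

variable {V ι : Type*} [AddCommGroup V] [Module ℝ V]

/-- The polyhedral cone of all vectors on which the functionals `ψ i`, `i ∈ H`, are nonnegative. -/
def polyCone (ψ : ι → V →ₗ[ℝ] ℝ) (H : Finset ι) : Set V :=
  {v | ∀ i ∈ H, 0 ≤ ψ i v}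

/-- For a point `p` of the cone `polyCone ψ H`, the linear span of the smallest face containing `p`:
the common kernel of the functionals that vanish at `p`. -/
def faceSpan (ψ : ι → V →ₗ[ℝ] ℝ) (H : Finset ι) (p : V) : Submodule ℝ V where
  carrier := {v | ∀ i ∈ H, ψ i p = 0 → ψ i v = 0}
  add_mem' := by
    intro a b ha hb i hi h
    simp [ha i hi h, hb i hi h]
  zero_mem' := by
    intro i _ _
    simp
  smul_mem' := by
    intro r a ha i hi h
    simp [ha i hi h]

variable {ψ : ι → V →ₗ[ℝ] ℝ} {H : Finset ι}

theorem mem_polyCone {v : V} : v ∈ polyCone ψ H ↔ ∀ i ∈ H, 0 ≤ ψ i v := Iff.rfl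

theorem mem_faceSpan {p v : V} : v ∈ faceSpan ψ H p ↔ ∀ i ∈ H, ψ i p = 0 → ψ i v = 0 := Iff.rfl

theorem self_mem_faceSpan (p : V) : p ∈ faceSpan ψ H p := fun _ _ h => h

theorem zero_mem_polyCone : (0 : V) ∈ polyCone ψ H := fun i _ => by simp

theorem add_mem_polyCone {p q : V} (hp : p ∈ polyCone ψ H) (hq : q ∈ polyCone ψ H) :
    p + q ∈ polyCone ψ H := fun i hi => by
  rw [map_add]; exact add_nonneg (hp i hi) (hq i hi)

theorem smul_mem_polyCone {p : V} (hp : p ∈ polyCone ψ H) {r : ℝ} (hr : 0 ≤ r) :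
    r • p ∈ polyCone ψ H := fun i hi => by
  rw [map_smul, smul_eq_mul]; exact mul_nonneg hr (hp i hi)

theorem faceSpan_le_iff {p q : V} : faceSpan ψ H p ≤ faceSpan ψ H q ↔ p ∈ faceSpan ψ H q :=
  ⟨fun h => h (self_mem_faceSpan p), fun h _ hv i hi hq => hv i hi (h i hi hq)⟩

theorem faceSpan_smul {p : V} {r : ℝ} (hr : r ≠ 0) : faceSpan ψ H (r • p) = faceSpan ψ H p := by
  apply le_antisymm
  · rw [faceSpan_le_iff]; exact Submodule.smul_mem _ _ (self_mem_faceSpan p)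
  · rw [faceSpan_le_iff]; intro i hi h
    rw [map_smul, smul_eq_mul] at h
    exact (mul_eq_zero.mp h).resolve_left hr

theorem exists_pos_of_notMem_faceSpan {p q : V} (hq : q ∈ polyCone ψ H)
    (h : q ∉ faceSpan ψ H p) : ∃ i ∈ H, ψ i p = 0 ∧ 0 < ψ i q := by
  simp only [mem_faceSpan, not_forall] at h
  obtain ⟨i, hi, h1, h2⟩ := h
  exact ⟨i, hi, h1, lt_of_le_of_ne (hq i hi) (Ne.symm h2)⟩

/-- A point of the cone can be moved a little in all directions of the span of its face. -/
theorem exists_pos_add_smul_mem {p v : V} (hp : p ∈ polyCone ψ H) (hv : v ∈ faceSpan ψ H p) :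
    ∃ ε : ℝ, 0 < ε ∧ p + ε • v ∈ polyCone ψ H := by
  have key : ∀ i ∈ H, ∃ ε : ℝ, 0 < ε ∧ ∀ δ, 0 < δ → δ ≤ ε → 0 ≤ ψ i p + δ * ψ i v := by
    intro i hi
    rcases (hp i hi).eq_or_lt with h | h
    · refine ⟨1, one_pos, fun δ _ _ => ?_⟩
      rw [← h, hv i hi h.symm]; simp
    · refine ⟨ψ i p / (|ψ i v| + 1), by positivity, fun δ hδ hle => ?_⟩
      rw [le_div_iff₀ (by positivity)] at hle
      have := neg_abs_le (ψ i v)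
      nlinarith
  choose! ε hε hδ using key
  obtain ⟨η, hη, hle⟩ : ∃ η : ℝ, 0 < η ∧ ∀ i ∈ H, η ≤ ε i := by
    rcases H.eq_empty_or_nonempty with rfl | hne
    · exact ⟨1, one_pos, by simp⟩
    · obtain ⟨j, hj, hm⟩ := H.exists_min_image ε hne
      exact ⟨ε j, hε j hj, hm⟩
  refine ⟨η, hη, fun i hi => ?_⟩
  rw [map_add, map_smul, smul_eq_mul]
  exact hδ i hi η hη (hle i hi)

/-- The smallest face containing `p + q` contains `p`. -/
theorem faceSpan_le_faceSpan_add {p q : V} (hp : p ∈ polyCone ψ H) (hq : q ∈ polyCone ψ H) :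
    faceSpan ψ H p ≤ faceSpan ψ H (p + q) := by
  rw [faceSpan_le_iff]
  intro i hi h
  rw [map_add] at h
  have := hp i hi
  have := hq i hi
  linarith

/-- Rotating the direction `w` away from `u` around the face of `a` as long as possible without
leaving the cone produces a point of a proper face of the face of `u`. -/
theorem exists_wedge {a u w : V} (ha : a ∈ polyCone ψ H) (hu : u ∈ polyCone ψ H)
    (hua : u ∉ faceSpan ψ H a) (hw : ∀ i ∈ H, ψ i u = 0 → 0 ≤ ψ i w) :
    ∃ t N : ℝ, w - t • u + N • a ∈ polyCone ψ H ∧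
      (∀ i ∈ H, ψ i (w - t • u + N • a) = 0 → ψ i a = 0) ∧
      u ∉ faceSpan ψ H (w - t • u + N • a) := by
  classical
  obtain ⟨i₀, hi₀, h₀a, h₀u⟩ := exists_pos_of_notMem_faceSpan hu hua
  obtain ⟨j, hj, hmin⟩ := (H.filter fun i => ψ i a = 0 ∧ 0 < ψ i u).exists_min_image
    (fun i => ψ i w / ψ i u) ⟨i₀, by simp [hi₀, h₀a, h₀u]⟩
  simp only [Finset.mem_filter] at hj hmin
  set t := ψ j w / ψ j u with ht
  have hnon : ∀ i ∈ H, ψ i a = 0 → 0 ≤ ψ i w - t * ψ i u := by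
    intro i hi hia
    rcases (hu i hi).eq_or_lt with h | h
    · rw [← h]; simpa using hw i hi h.symm
    · have := hmin i ⟨hi, hia, h⟩
      rw [le_div_iff₀ h] at this
      linarith
  obtain ⟨N, hN⟩ : ∃ N : ℝ, ∀ i ∈ H, 0 < ψ i a → 0 < ψ i w - t * ψ i u + N * ψ i a := by
    obtain ⟨N, hN⟩ := (H.image fun i => (|ψ i w - t * ψ i u| + 1) / ψ i a).exists_le
    refine ⟨N, fun i hi h => ?_⟩
    have := hN _ (Finset.mem_image_of_mem _ hi)
    rw [div_le_iff₀ h] at this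
    have := neg_abs_le (ψ i w - t * ψ i u)
    linarith
  have hval : ∀ i, ψ i (w - t • u + N • a) = ψ i w - t * ψ i u + N * ψ i a := by
    intro i; simp
  refine ⟨t, N, fun i hi => ?_, fun i hi h => ?_, fun h => ?_⟩
  · rw [hval]
    rcases (ha i hi).eq_or_lt with h | h
    · rw [← h]; simpa using hnon i hi h.symm
    · exact (hN i hi h).le
  · by_contra hne
    have := hN i hi (lt_of_le_of_ne (ha i hi) (Ne.symm hne))
    rw [hval] at h
    linarith
  · have := h j hj.1 (by rw [hval, hj.2.1, ht, div_mul_cancel₀ _ hj.2.2.ne']; simp)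
    exact hj.2.2.ne' this

variable [FiniteDimensional ℝ V]

theorem faceSpan_eq_of_le_of_finrank {p q : V} (h : p ∈ faceSpan ψ H q)
    (hr : Module.finrank ℝ (faceSpan ψ H q) ≤ Module.finrank ℝ (faceSpan ψ H p)) :
    faceSpan ψ H p = faceSpan ψ H q :=
  Submodule.eq_of_le_of_finrank_le (faceSpan_le_iff.mpr h) hr

/-- Existence part of the diamond property: besides `c` there is a second face between `a` and
`b`. -/
theorem exists_diamond {a b c : V} {n : ℕ} (ha : a ∈ polyCone ψ H) (hb : b ∈ polyCone ψ H)
    (hc : c ∈ polyCone ψ H) (hac : a ∈ faceSpan ψ H c) (hcb : c ∈ faceSpan ψ H b)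
    (hra : Module.finrank ℝ (faceSpan ψ H a) = n)
    (hrc : Module.finrank ℝ (faceSpan ψ H c) = n + 1)
    (hrb : Module.finrank ℝ (faceSpan ψ H b) = n + 2) :
    ∃ c' ∈ polyCone ψ H, a ∈ faceSpan ψ H c' ∧ c' ∈ faceSpan ψ H b ∧
      Module.finrank ℝ (faceSpan ψ H c') = n + 1 ∧ c' ∉ faceSpan ψ H c := by
  have hca : c ∉ faceSpan ψ H a := fun h => by
    have := Submodule.finrank_mono (faceSpan_le_iff.mpr h); omega
  have hbc : b ∉ faceSpan ψ H c := fun h => by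
    have := Submodule.finrank_mono (faceSpan_le_iff.mpr h); omega
  obtain ⟨t, N, h1, h2, h3⟩ := exists_wedge ha hc hca (w := b) (fun i hi _ => hb i hi)
  set c' := b - t • c + N • a with hc'
  have hab : a ∈ faceSpan ψ H b := faceSpan_le_iff.mpr hcb hac
  have hc'b : c' ∈ faceSpan ψ H b :=
    add_mem (sub_mem (self_mem_faceSpan b) (Submodule.smul_mem _ _ hcb))
      (Submodule.smul_mem _ _ hab)
  have hac' : a ∈ faceSpan ψ H c' := h2
  have hnc : c' ∉ faceSpan ψ H c := fun h => hbc <| by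
    have : b = c' + t • c - N • a := by rw [hc']; abel
    rw [this]
    exact sub_mem (add_mem h (Submodule.smul_mem _ _ (self_mem_faceSpan c)))
      (Submodule.smul_mem _ _ hac)
  refine ⟨c', h1, hac', hc'b, ?_, hnc⟩
  have lt1 : faceSpan ψ H a < faceSpan ψ H c' :=
    lt_of_le_of_ne (faceSpan_le_iff.mpr hac') fun h => hnc <| by
      have : c' ∈ faceSpan ψ H a := h ▸ self_mem_faceSpan c'
      exact faceSpan_le_iff.mpr hac this
  have lt2 : faceSpan ψ H c' < faceSpan ψ H b :=
    lt_of_le_of_ne (faceSpan_le_iff.mpr hc'b) fun h => h3 (h ▸ hcb)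
  have := Submodule.finrank_lt_finrank_of_lt lt1
  have := Submodule.finrank_lt_finrank_of_lt lt2
  omega

/-- A face is spanned by a face of one dimension less and one of its points off that face. -/
theorem exists_eq_add_smul {p q : V} {n : ℕ} {x : V} (hqp : q ∉ faceSpan ψ H p)
    (hpq : p ∈ faceSpan ψ H q)
    (hrp : Module.finrank ℝ (faceSpan ψ H p) = n)
    (hrq : Module.finrank ℝ (faceSpan ψ H q) = n + 1) (hx : x ∈ faceSpan ψ H q) :
    ∃ v ∈ faceSpan ψ H p, ∃ β : ℝ, x = v + β • q := by
  have hle : faceSpan ψ H p ⊔ Submodule.span ℝ {q} ≤ faceSpan ψ H q :=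
    sup_le (faceSpan_le_iff.mpr hpq) (by
      rw [Submodule.span_singleton_le_iff_mem]; exact self_mem_faceSpan q)
  have hlt : faceSpan ψ H p < faceSpan ψ H p ⊔ Submodule.span ℝ {q} := by
    refine lt_of_le_of_ne le_sup_left fun h => hqp ?_
    rw [h]
    exact Submodule.mem_sup_right (Submodule.mem_span_singleton_self q)
  have := Submodule.finrank_lt_finrank_of_lt hlt
  have heq := Submodule.eq_of_le_of_finrank_le hle (by omega)
  rw [← heq, Submodule.mem_sup] at hx
  obtain ⟨v, hv, w, hw, rfl⟩ := hx
  obtain ⟨β, rfl⟩ := Submodule.mem_span_singleton.mp hw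
  exact ⟨v, hv, β, rfl⟩

/-- Coordinates in the two-dimensional quotient of the face of `b` by the face of `a`, with respect
to two different faces `c₁`, `c₂` in between: points of the cone have nonnegative coordinates, and
only points of the face of `c₁` (of `c₂`) have second (first) coordinate zero. -/
theorem exists_diamond_coords {a b c₁ c₂ x : V} {n : ℕ}
    (hc₁ : c₁ ∈ polyCone ψ H) (hc₂ : c₂ ∈ polyCone ψ H) (hx : x ∈ polyCone ψ H)
    (hac₁ : a ∈ faceSpan ψ H c₁) (hac₂ : a ∈ faceSpan ψ H c₂)
    (hcb₁ : c₁ ∈ faceSpan ψ H b) (hcb₂ : c₂ ∈ faceSpan ψ H b)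
    (hra : Module.finrank ℝ (faceSpan ψ H a) = n)
    (hrc₁ : Module.finrank ℝ (faceSpan ψ H c₁) = n + 1)
    (hrc₂ : Module.finrank ℝ (faceSpan ψ H c₂) = n + 1)
    (hrb : Module.finrank ℝ (faceSpan ψ H b) = n + 2)
    (hne : faceSpan ψ H c₁ ≠ faceSpan ψ H c₂) (hxb : x ∈ faceSpan ψ H b) :
    ∃ v ∈ faceSpan ψ H a, ∃ γ₁ γ₂ : ℝ, x = v + γ₁ • c₁ + γ₂ • c₂ ∧ 0 ≤ γ₁ ∧ 0 ≤ γ₂ ∧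
      (x ∉ faceSpan ψ H c₁ → 0 < γ₂) ∧ (x ∉ faceSpan ψ H c₂ → 0 < γ₁) := by
  have h21 : c₂ ∉ faceSpan ψ H c₁ := fun h =>
    hne (faceSpan_eq_of_le_of_finrank h (by omega)).symm
  have h12 : c₁ ∉ faceSpan ψ H c₂ := fun h => hne (faceSpan_eq_of_le_of_finrank h (by omega))
  have hca : c₁ ∉ faceSpan ψ H a := fun h => by
    have := Submodule.finrank_mono (faceSpan_le_iff.mpr h); omega
  -- The face of `b` is spanned by the face of `c₁` and `c₂`.
  have hle : faceSpan ψ H c₁ ⊔ Submodule.span ℝ {c₂} ≤ faceSpan ψ H b :=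
    sup_le (faceSpan_le_iff.mpr hcb₁) (by
      rw [Submodule.span_singleton_le_iff_mem]; exact hcb₂)
  have hlt : faceSpan ψ H c₁ < faceSpan ψ H c₁ ⊔ Submodule.span ℝ {c₂} := by
    refine lt_of_le_of_ne le_sup_left fun h => h21 ?_
    rw [h]
    exact Submodule.mem_sup_right (Submodule.mem_span_singleton_self c₂)
  have := Submodule.finrank_lt_finrank_of_lt hlt
  have heq := Submodule.eq_of_le_of_finrank_le hle (by omega)
  have hx' := hxb
  rw [← heq, Submodule.mem_sup] at hx'
  obtain ⟨y, hy, w, hw, hyx⟩ := hx'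
  obtain ⟨γ₂, rfl⟩ := Submodule.mem_span_singleton.mp hw
  obtain ⟨v, hv, γ₁, rfl⟩ := exists_eq_add_smul hca hac₁ hra hrc₁ hy
  obtain ⟨i, hi, hi1, hi2⟩ := exists_pos_of_notMem_faceSpan hc₂ h21
  obtain ⟨j, hj, hj1, hj2⟩ := exists_pos_of_notMem_faceSpan hc₁ h12
  have vi : ψ i x = γ₂ * ψ i c₂ := by
    rw [← hyx]; simp [hi1, hv i hi (hac₁ i hi hi1)]
  have vj : ψ j x = γ₁ * ψ j c₁ := by
    rw [← hyx]; simp [hj1, hv j hj (hac₂ j hj hj1)]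
  have g2 : 0 ≤ γ₂ := by
    have := hx i hi; rw [vi] at this; exact nonneg_of_mul_nonneg_left this hi2
  have g1 : 0 ≤ γ₁ := by
    have := hx j hj; rw [vj] at this; exact nonneg_of_mul_nonneg_left this hj2
  refine ⟨v, hv, γ₁, γ₂, hyx.symm, g1, g2, fun h => lt_of_le_of_ne g2 ?_,
    fun h => lt_of_le_of_ne g1 ?_⟩
  · rintro rfl
    apply h
    rw [← hyx, zero_smul, add_zero]
    exact hy
  · rintro rfl
    apply h
    rw [← hyx, zero_smul, add_zero]
    exact add_mem (faceSpan_le_iff.mpr hac₂ hv) (Submodule.smul_mem _ _ (self_mem_faceSpan c₂))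

/-- Uniqueness part of the diamond property: of three faces between `a` and `b`, two coincide. -/
theorem diamond_unique {a b c₁ c₂ c₃ : V} {n : ℕ}
    (hc₁ : c₁ ∈ polyCone ψ H) (hc₂ : c₂ ∈ polyCone ψ H) (hc₃ : c₃ ∈ polyCone ψ H)
    (hac₁ : a ∈ faceSpan ψ H c₁) (hac₂ : a ∈ faceSpan ψ H c₂) (hac₃ : a ∈ faceSpan ψ H c₃)
    (hcb₁ : c₁ ∈ faceSpan ψ H b) (hcb₂ : c₂ ∈ faceSpan ψ H b) (hcb₃ : c₃ ∈ faceSpan ψ H b)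
    (hra : Module.finrank ℝ (faceSpan ψ H a) = n)
    (hrc₁ : Module.finrank ℝ (faceSpan ψ H c₁) = n + 1)
    (hrc₂ : Module.finrank ℝ (faceSpan ψ H c₂) = n + 1)
    (hrc₃ : Module.finrank ℝ (faceSpan ψ H c₃) = n + 1)
    (hrb : Module.finrank ℝ (faceSpan ψ H b) = n + 2)
    (h12 : faceSpan ψ H c₁ ≠ faceSpan ψ H c₂) (h13 : faceSpan ψ H c₁ ≠ faceSpan ψ H c₃) :
    faceSpan ψ H c₂ = faceSpan ψ H c₃ := by
  by_contra h23
  obtain ⟨v, hv, γ₁, γ₂, hx, g1, g2, p2, p1⟩ := exists_diamond_coords hc₁ hc₂ hc₃ hac₁ hac₂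
    hcb₁ hcb₂ hra hrc₁ hrc₂ hrb h12 hcb₃
  have p1 := p1 fun h => h23 (faceSpan_eq_of_le_of_finrank h (by omega)).symm
  apply h13
  refine faceSpan_eq_of_le_of_finrank (fun i hi h => ?_) (by omega)
  have hva : ψ i v = 0 := hv i hi (hac₃ i hi h)
  have : γ₁ * ψ i c₁ + γ₂ * ψ i c₂ = 0 := by
    rw [hx] at h; simpa [hva] using h
  have h1 := hc₁ i hi
  have h2 := mul_nonneg g2 (hc₂ i hi)
  nlinarith

/-- The two faces of a diamond lie on opposite sides of the hyperplane through the faces of `a` and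
`b`. -/
theorem diamond_opposite {a b c₁ c₂ : V} {n : ℕ} (hb : b ∈ polyCone ψ H)
    (hc₁ : c₁ ∈ polyCone ψ H) (hc₂ : c₂ ∈ polyCone ψ H)
    (hac₁ : a ∈ faceSpan ψ H c₁) (hac₂ : a ∈ faceSpan ψ H c₂)
    (hcb₁ : c₁ ∈ faceSpan ψ H b) (hcb₂ : c₂ ∈ faceSpan ψ H b)
    (hra : Module.finrank ℝ (faceSpan ψ H a) = n)
    (hrc₁ : Module.finrank ℝ (faceSpan ψ H c₁) = n + 1)
    (hrc₂ : Module.finrank ℝ (faceSpan ψ H c₂) = n + 1)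
    (hrb : Module.finrank ℝ (faceSpan ψ H b) = n + 2)
    (h12 : faceSpan ψ H c₁ ≠ faceSpan ψ H c₂) :
    ∃ α : ℝ, 0 < α ∧ c₂ + α • c₁ ∈ faceSpan ψ H a ⊔ Submodule.span ℝ {b} := by
  obtain ⟨v, hv, γ₁, γ₂, hx, -, -, p2, p1⟩ := exists_diamond_coords hc₁ hc₂ hb hac₁ hac₂
    hcb₁ hcb₂ hra hrc₁ hrc₂ hrb h12 (self_mem_faceSpan b)
  have p1 := p1 fun h => by
    have := Submodule.finrank_mono (faceSpan_le_iff.mpr h); omega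
  have p2 := p2 fun h => by
    have := Submodule.finrank_mono (faceSpan_le_iff.mpr h); omega
  refine ⟨γ₁ / γ₂, by positivity, ?_⟩
  rw [Submodule.mem_sup]
  refine ⟨-(γ₂⁻¹ • v), neg_mem (Submodule.smul_mem _ _ hv), γ₂⁻¹ • b,
    Submodule.smul_mem _ _ (Submodule.mem_span_singleton_self b), ?_⟩
  rw [hx, smul_add, smul_add, smul_smul, smul_smul, inv_mul_cancel₀ p2.ne', one_smul,
    div_eq_inv_mul]
  abel

end Cone

/-! ### Faces of polytopes via the homogenization cone -/

section Faces

variable {d : ℕ}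

/-- The homogenization of the constraint `⟪x, h.1⟫ ≤ h.2`: its slack as a linear functional on
`ℝ^d × ℝ`, evaluated at the homogeneous point `p`. -/
noncomputable def slack (h : EuclideanSpace ℝ (Fin d) × ℝ) :
    EuclideanSpace ℝ (Fin d) × ℝ →ₗ[ℝ] ℝ :=
  h.2 • LinearMap.snd ℝ _ _ - (innerₗ (EuclideanSpace ℝ (Fin d)) h.1) ∘ₗ LinearMap.fst ℝ _ _

theorem slack_apply (h p : EuclideanSpace ℝ (Fin d) × ℝ) :
    slack h p = h.2 * p.2 - inner ℝ p.1 h.1 := by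
  simp [slack, real_inner_comm]

/-- `Q` is a compact set containing the origin, cut out by the inequalities in `H`. The trivial
inequality `0 ≤ 1` is required to be among them: its homogenization bounds the last coordinate of
the homogenization cone from below. -/
structure IsHRep (Q : Set (EuclideanSpace ℝ (Fin d)))
    (H : Finset (EuclideanSpace ℝ (Fin d) × ℝ)) : Prop where
  compact : IsCompact Q
  zero_mem : (0 : EuclideanSpace ℝ (Fin d)) ∈ Q
  triv_mem : ((0 : EuclideanSpace ℝ (Fin d)), (1 : ℝ)) ∈ H
  eq : Q = {x | ∀ h ∈ H, inner ℝ x h.1 ≤ h.2}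

theorem IsPolytope.exists_isHRep {Q : Set (EuclideanSpace ℝ (Fin d))} (hQ : IsPolytope Q)
    (h0 : (0 : EuclideanSpace ℝ (Fin d)) ∈ Q) : ∃ H, IsHRep Q H := by
  classical
  obtain ⟨hc, H, hH⟩ := hQ
  refine ⟨insert (0, 1) H, hc, h0, Finset.mem_insert_self _ _, ?_⟩
  rw [hH]
  ext x
  simp

/-- The face of the polytope cut out by `H` that corresponds to the face of the homogenization cone
spanned by the homogeneous point `p`. The empty face belongs to `p = 0`. -/
def faceOf (H : Finset (EuclideanSpace ℝ (Fin d) × ℝ)) (p : EuclideanSpace ℝ (Fin d) × ℝ) :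
    Set (EuclideanSpace ℝ (Fin d)) :=
  {y | (y, (1 : ℝ)) ∈ polyCone slack H ∧ (y, (1 : ℝ)) ∈ faceSpan slack H p}

variable {Q : Set (EuclideanSpace ℝ (Fin d))} {H : Finset (EuclideanSpace ℝ (Fin d) × ℝ)}

theorem mem_faceOf {p : EuclideanSpace ℝ (Fin d) × ℝ} {y : EuclideanSpace ℝ (Fin d)} :
    y ∈ faceOf H p ↔ (y, (1 : ℝ)) ∈ polyCone slack H ∧ (y, (1 : ℝ)) ∈ faceSpan slack H p := Iff.rfl

namespace IsHRep

theorem mem_iff (hQ : IsHRep Q H) {x : EuclideanSpace ℝ (Fin d)} :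
    x ∈ Q ↔ (x, (1 : ℝ)) ∈ polyCone slack H := by
  rw [hQ.eq, mem_polyCone]
  simp [slack_apply]

theorem snd_nonneg (hQ : IsHRep Q H) {p : EuclideanSpace ℝ (Fin d) × ℝ}
    (hp : p ∈ polyCone slack H) : 0 ≤ p.2 := by
  simpa [slack_apply] using hp _ hQ.triv_mem

theorem eq_zero_of_snd (hQ : IsHRep Q H) {p : EuclideanSpace ℝ (Fin d) × ℝ}
    (hp : p ∈ polyCone slack H) (h2 : p.2 = 0) : p = 0 := by
  obtain ⟨R, hR⟩ := hQ.compact.isBounded.exists_norm_le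
  have h0 := hQ.mem_iff.mp hQ.zero_mem
  by_contra hne
  have h1 : p.1 ≠ 0 := fun h => hne (Prod.ext h h2)
  have hR0 : 0 ≤ R := (norm_nonneg _).trans (hR _ hQ.zero_mem)
  have hn : 0 < ‖p.1‖ := norm_pos_iff.mpr h1
  have key : ((R + 1) / ‖p.1‖) • p.1 ∈ Q := by
    rw [hQ.mem_iff]
    have := add_mem_polyCone h0 (smul_mem_polyCone hp (r := (R + 1) / ‖p.1‖) (by positivity))
    convert this using 1
    ext <;> simp [h2]
  have := hR _ key
  rw [norm_smul, Real.norm_of_nonneg (by positivity), div_mul_cancel₀ _ hn.ne'] at this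
  linarith

theorem exists_eq_smul (hQ : IsHRep Q H) {p : EuclideanSpace ℝ (Fin d) × ℝ}
    (hp : p ∈ polyCone slack H) (hne : p ≠ 0) :
    ∃ x ∈ Q, p = p.2 • (x, (1 : ℝ)) ∧ 0 < p.2 := by
  have h2 : 0 < p.2 := lt_of_le_of_ne (hQ.snd_nonneg hp) fun h => hne (hQ.eq_zero_of_snd hp h.symm)
  have hp' : p = p.2 • (p.2⁻¹ • p.1, (1 : ℝ)) := by
    ext <;> simp [h2.ne']
  refine ⟨p.2⁻¹ • p.1, ?_, hp', h2⟩
  rw [hQ.mem_iff]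
  have := smul_mem_polyCone hp (r := p.2⁻¹) (by positivity)
  convert this using 1
  ext <;> simp [h2.ne']

theorem faceSpan_zero (hQ : IsHRep Q H) : faceSpan slack H 0 = ⊥ := by
  rw [eq_bot_iff]
  intro v hv
  have hv' : ∀ h ∈ H, slack h v = 0 := fun h hh => hv h hh (by simp)
  have hK : v ∈ polyCone slack H := fun h hh => (hv' h hh).ge
  have : v.2 = 0 := by simpa [slack_apply] using hv' _ hQ.triv_mem
  exact hQ.eq_zero_of_snd hK this

theorem faceOf_zero (hQ : IsHRep Q H) : faceOf H 0 = ∅ := by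
  ext y
  simp only [mem_faceOf, hQ.faceSpan_zero, Submodule.mem_bot, Set.mem_empty_iff_false, iff_false,
    not_and]
  intro _ h
  simpa using congrArg Prod.snd h

theorem faceOf_subset (hQ : IsHRep Q H) (p : EuclideanSpace ℝ (Fin d) × ℝ) : faceOf H p ⊆ Q :=
  fun _ hy => hQ.mem_iff.mpr hy.1

theorem self_mem_faceOf (hQ : IsHRep Q H) {x : EuclideanSpace ℝ (Fin d)} (hx : x ∈ Q) :
    x ∈ faceOf H (x, 1) := ⟨hQ.mem_iff.mp hx, self_mem_faceSpan _⟩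

/-- Every nonzero homogeneous point describes the same face as some point of the polytope. -/
theorem exists_point (hQ : IsHRep Q H) {p : EuclideanSpace ℝ (Fin d) × ℝ}
    (hp : p ∈ polyCone slack H) (hne : p ≠ 0) :
    ∃ x ∈ faceOf H p, faceSpan slack H p = faceSpan slack H (x, 1) := by
  obtain ⟨x, hx, hpx, h2⟩ := hQ.exists_eq_smul hp hne
  have h : faceSpan slack H p = faceSpan slack H (x, 1) := by
    rw [hpx]; exact faceSpan_smul h2.ne'
  exact ⟨x, ⟨hQ.mem_iff.mp hx, h ▸ self_mem_faceSpan _⟩, h⟩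

theorem faceOf_subset_iff (hQ : IsHRep Q H) {p q : EuclideanSpace ℝ (Fin d) × ℝ}
    (hp : p ∈ polyCone slack H) :
    faceOf H p ⊆ faceOf H q ↔ p ∈ faceSpan slack H q := by
  constructor
  · intro h
    by_cases hne : p = 0
    · rw [hne]; exact Submodule.zero_mem _
    · obtain ⟨x, hx, hpx⟩ := hQ.exists_point hp hne
      rw [← faceSpan_le_iff, hpx, faceSpan_le_iff]
      exact (h hx).2
  · exact fun h y hy => ⟨hy.1, faceSpan_le_iff.mpr h hy.2⟩

theorem faceOf_eq_iff (hQ : IsHRep Q H) {p q : EuclideanSpace ℝ (Fin d) × ℝ}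
    (hp : p ∈ polyCone slack H) (hq : q ∈ polyCone slack H) :
    faceOf H p = faceOf H q ↔ faceSpan slack H p = faceSpan slack H q := by
  rw [Set.Subset.antisymm_iff, hQ.faceOf_subset_iff hp, hQ.faceOf_subset_iff hq, le_antisymm_iff,
    faceSpan_le_iff, faceSpan_le_iff]

theorem faceOf_nonempty_iff (hQ : IsHRep Q H) {p : EuclideanSpace ℝ (Fin d) × ℝ}
    (hp : p ∈ polyCone slack H) : (faceOf H p).Nonempty ↔ p ≠ 0 := by
  constructor
  · rintro h rfl
    rw [hQ.faceOf_zero] at h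
    exact Set.not_nonempty_empty h
  · intro h
    obtain ⟨x, hx, -⟩ := hQ.exists_point hp h
    exact ⟨x, hx⟩

theorem isExposed_faceOf (hQ : IsHRep Q H) {p : EuclideanSpace ℝ (Fin d) × ℝ}
    (hp : p ∈ polyCone slack H) : IsExposed ℝ Q (faceOf H p) := by
  classical
  intro hne
  obtain ⟨x, hx, hpx⟩ := hQ.exists_point hp ((hQ.faceOf_nonempty_iff hp).mp hne)
  -- The sum of the normals of the constraints active at `p` exposes the face.
  set A := H.filter fun h => slack h p = 0 with hA
  have hval : ∀ y, innerSL ℝ (∑ h ∈ A, h.1) y = ∑ h ∈ A, h.2 - ∑ h ∈ A, slack h (y, 1) := by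
    intro y
    simp [slack_apply, real_inner_comm]
  have hAx : ∀ y, y ∈ faceOf H p → ∑ h ∈ A, slack h (y, 1) = 0 := by
    intro y hy
    refine Finset.sum_eq_zero fun h hh => ?_
    rw [hA, Finset.mem_filter] at hh
    exact hy.2 h hh.1 hh.2
  have hAn : ∀ y ∈ Q, ∀ h ∈ A, 0 ≤ slack h (y, 1) := by
    intro y hy h hh
    exact hQ.mem_iff.mp hy h (Finset.mem_filter.mp hh).1
  refine ⟨innerSL ℝ (∑ h ∈ A, h.1), Set.Subset.antisymm ?_ ?_⟩
  · intro y hy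
    refine ⟨hQ.faceOf_subset p hy, fun z hz => ?_⟩
    rw [hval, hval, hAx y hy]
    have := Finset.sum_nonneg (hAn z hz)
    linarith
  · rintro y ⟨hy, hmax⟩
    have := hmax x (hQ.faceOf_subset p hx)
    rw [hval, hval, hAx x hx] at this
    have h0 := (Finset.sum_eq_zero_iff_of_nonneg (hAn y hy)).mp
      (le_antisymm (by linarith) (Finset.sum_nonneg (hAn y hy)))
    exact ⟨hQ.mem_iff.mp hy, fun h hh hp0 => h0 h (Finset.mem_filter.mpr ⟨hh, hp0⟩)⟩

theorem exists_faceOf (hQ : IsHRep Q H) {F : Set (EuclideanSpace ℝ (Fin d))}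
    (hF : IsExposed ℝ Q F) : ∃ p ∈ polyCone slack H, F = faceOf H p := by
  rcases F.eq_empty_or_nonempty with rfl | hne
  · exact ⟨0, zero_mem_polyCone, hQ.faceOf_zero.symm⟩
  obtain ⟨l, hl⟩ := hF hne
  -- A point of `F` whose face span is as large as possible lies in the relative interior.
  obtain ⟨x, hxF, hmin⟩ := (measure fun x : EuclideanSpace ℝ (Fin d) =>
    Module.finrank ℝ (EuclideanSpace ℝ (Fin d) × ℝ) -
      Module.finrank ℝ (faceSpan slack H (x, 1))).wf.has_min F hne
  have hxQ : x ∈ Q := hF.subset hxF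
  have hxK := hQ.mem_iff.mp hxQ
  refine ⟨(x, 1), hxK, Set.Subset.antisymm ?_ ?_⟩
  · intro y hyF
    have hyQ : y ∈ Q := hF.subset hyF
    have hyK := hQ.mem_iff.mp hyQ
    have hsum : ((x, (1 : ℝ)) : EuclideanSpace ℝ (Fin d) × ℝ) + (y, 1) =
        (2 : ℝ) • (((2 : ℝ)⁻¹ • (x + y), (1 : ℝ)) : EuclideanSpace ℝ (Fin d) × ℝ) := by
      ext <;> simp [one_add_one_eq_two]
    have hspan : faceSpan slack H ((2 : ℝ)⁻¹ • (x + y), 1) =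
        faceSpan slack H ((x, 1) + (y, 1)) := by
      rw [hsum, faceSpan_smul two_ne_zero]
    have hmQ : (2 : ℝ)⁻¹ • (x + y) ∈ Q := by
      rw [hQ.mem_iff]
      have := smul_mem_polyCone (add_mem_polyCone hxK hyK) (r := (2 : ℝ)⁻¹) (by norm_num)
      rwa [hsum, smul_smul, inv_mul_cancel₀ two_ne_zero, one_smul] at this
    have hmF : (2 : ℝ)⁻¹ • (x + y) ∈ F := by
      rw [hl] at hxF hyF ⊢
      refine ⟨hmQ, fun z hz => ?_⟩
      have h1 := hxF.2 z hz
      have h2 := hyF.2 z hz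
      simp only [map_smul, map_add, smul_eq_mul]
      linarith
    have hle := faceSpan_le_faceSpan_add hxK hyK
    have hle' : faceSpan slack H (y, 1) ≤ faceSpan slack H ((x, 1) + (y, 1)) := by
      rw [add_comm]; exact faceSpan_le_faceSpan_add hyK hxK
    have hno := hmin _ hmF
    change ¬ (Module.finrank ℝ _ - _ < Module.finrank ℝ _ - _) at hno
    rw [hspan] at hno
    have hb := Submodule.finrank_le (faceSpan slack H (((x, 1) + (y, 1)) :
      EuclideanSpace ℝ (Fin d) × ℝ))
    have heq := Submodule.eq_of_le_of_finrank_le hle (by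
      have := Submodule.finrank_mono hle
      omega)
    exact ⟨hyK, heq ▸ hle' (self_mem_faceSpan _)⟩
  · intro y hy
    -- The segment from `y` to `x` can be prolonged beyond `x`.
    obtain ⟨ε, hε, hmem⟩ := exists_pos_add_smul_mem hxK
      (sub_mem (self_mem_faceSpan _) hy.2)
    have hzQ : x + ε • (x - y) ∈ Q := by
      rw [hQ.mem_iff]
      convert hmem using 1
      ext <;> simp
    have hyQ := hQ.faceOf_subset _ hy
    rw [hl] at hxF ⊢
    refine ⟨hyQ, fun z hz => (hxF.2 z hz).trans ?_⟩
    have := hxF.2 _ hzQ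
    simp only [map_add, map_smul, map_sub, smul_eq_mul] at this
    nlinarith

theorem vectorSpan_faceOf (hQ : IsHRep Q H) {x : EuclideanSpace ℝ (Fin d)} (hx : x ∈ Q) :
    vectorSpan ℝ (faceOf H (x, 1)) =
      (faceSpan slack H (x, 1)).comap (LinearMap.inl ℝ (EuclideanSpace ℝ (Fin d)) ℝ) := by
  apply le_antisymm
  · rw [vectorSpan_def, Submodule.span_le]
    rintro _ ⟨y, hy, z, hz, rfl⟩
    have := sub_mem hy.2 hz.2
    simpa using this
  · intro v hv
    simp only [Submodule.mem_comap, LinearMap.inl_apply] at hv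
    obtain ⟨ε, hε, hmem⟩ := exists_pos_add_smul_mem (hQ.mem_iff.mp hx) hv
    have h1 : x + ε • v ∈ faceOf H (x, 1) := by
      have h2 := add_mem (self_mem_faceSpan (ψ := slack) (H := H) (x, (1 : ℝ)))
        (Submodule.smul_mem _ ε hv)
      have e : ((x, (1 : ℝ)) : EuclideanSpace ℝ (Fin d) × ℝ) + ε • (v, (0 : ℝ)) =
        (x + ε • v, 1) := by ext <;> simp
      rw [e] at h2 hmem
      exact ⟨hmem, h2⟩
    have h3 := vsub_mem_vectorSpan ℝ h1 (hQ.self_mem_faceOf hx)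
    simp only [vsub_eq_sub, add_sub_cancel_left] at h3
    have := Submodule.smul_mem _ ε⁻¹ h3
    rwa [smul_smul, inv_mul_cancel₀ hε.ne', one_smul] at this

/-- The dimension of a face is one less than the dimension of the corresponding cone. -/
theorem affDim_faceOf (hQ : IsHRep Q H) {p : EuclideanSpace ℝ (Fin d) × ℝ}
    (hp : p ∈ polyCone slack H) :
    affDim (faceOf H p) = (Module.finrank ℝ (faceSpan slack H p) : ℤ) - 1 := by
  by_cases hne : p = 0
  · rw [hne, hQ.faceOf_zero, hQ.faceSpan_zero]
    simp [affDim]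
  obtain ⟨x, hx, hpx⟩ := hQ.exists_point hp hne
  have hxQ := hQ.faceOf_subset _ hx
  have hface := (hQ.faceOf_eq_iff hp (hQ.mem_iff.mp hxQ)).mpr hpx
  have hnon : faceOf H p ≠ ∅ := Set.Nonempty.ne_empty ⟨x, hx⟩
  rw [affDim, if_neg hnon, hpx, hface, hQ.vectorSpan_faceOf hxQ]
  set Z := faceSpan slack H (x, (1 : ℝ)) with hZ
  set W := Z.comap (LinearMap.inl ℝ (EuclideanSpace ℝ (Fin d)) ℝ) with hW
  have hsup : W.map (LinearMap.inl ℝ _ ℝ) ⊔ Submodule.span ℝ {(x, (1 : ℝ))} = Z := by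
    apply le_antisymm
    · refine sup_le (Submodule.map_comap_le _ _) ?_
      rw [Submodule.span_singleton_le_iff_mem]
      exact self_mem_faceSpan _
    · intro v hv
      have e : v = (v.1 - v.2 • x, 0) + v.2 • (x, (1 : ℝ)) := by ext <;> simp
      rw [e]
      refine Submodule.add_mem_sup ?_ (Submodule.smul_mem _ _ (Submodule.mem_span_singleton_self _))
      refine ⟨v.1 - v.2 • x, ?_, rfl⟩
      change LinearMap.inl ℝ _ ℝ (v.1 - v.2 • x) ∈ Z
      have : LinearMap.inl ℝ _ ℝ (v.1 - v.2 • x) = v - v.2 • (x, (1 : ℝ)) := by ext <;> simp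
      rw [this]
      exact sub_mem hv (Submodule.smul_mem _ _ (self_mem_faceSpan _))
  have hinf : W.map (LinearMap.inl ℝ _ ℝ) ⊓ Submodule.span ℝ {(x, (1 : ℝ))} = ⊥ := by
    rw [eq_bot_iff]
    rintro v ⟨⟨w, -, rfl⟩, hv⟩
    obtain ⟨r, hr⟩ := Submodule.mem_span_singleton.mp hv
    have : r = 0 := by simpa using congrArg Prod.snd hr
    rw [← hr, this, zero_smul]
    exact Submodule.zero_mem _
  have hdim := Submodule.finrank_sup_add_finrank_inf_eq (W.map (LinearMap.inl ℝ _ ℝ))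
    (Submodule.span ℝ {(x, (1 : ℝ))})
  rw [hsup, hinf, finrank_bot, finrank_span_singleton (by simp),
    ← (Submodule.equivMapOfInjective _ LinearMap.inl_injective W).finrank_eq] at hdim
  omega

/-- A point of a face is in its relative interior iff no further constraint is active there. -/
theorem mem_intrinsicInterior_iff (hQ : IsHRep Q H) {p : EuclideanSpace ℝ (Fin d) × ℝ}
    (hp : p ∈ polyCone slack H) {x : EuclideanSpace ℝ (Fin d)} :
    x ∈ intrinsicInterior ℝ (faceOf H p) ↔
      x ∈ Q ∧ faceSpan slack H (x, 1) = faceSpan slack H p := by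
  constructor
  · intro hx
    have hxF := intrinsicInterior_subset hx
    refine ⟨hQ.faceOf_subset p hxF, le_antisymm (faceSpan_le_iff.mpr hxF.2) ?_⟩
    obtain ⟨y, hy, hpy⟩ := hQ.exists_point hp ((hQ.faceOf_nonempty_iff hp).mp ⟨x, hxF⟩)
    rw [hpy, faceSpan_le_iff]
    obtain ⟨x', hx', rfl⟩ := mem_intrinsicInterior.mp hx
    have hyA : y ∈ affineSpan ℝ (faceOf H p) := subset_affineSpan ℝ _ hy
    let γ : ℝ → affineSpan ℝ (faceOf H p) := fun t =>
      ⟨AffineMap.lineMap (x' : EuclideanSpace ℝ (Fin d)) y t, AffineMap.lineMap_mem t x'.2 hyA⟩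
    have hγ : Continuous γ := AffineMap.lineMap_continuous.subtype_mk _
    have h0 : γ 0 = x' := by ext1; simp [γ]
    have hnhds : γ ⁻¹' ((↑) ⁻¹' faceOf H p) ∈ nhds (0 : ℝ) :=
      hγ.continuousAt.preimage_mem_nhds (by rw [h0]; exact mem_interior_iff_mem_nhds.mp hx')
    obtain ⟨ε, hε, hball⟩ := Metric.mem_nhds_iff.mp hnhds
    have hz := hball (show -(ε / 2) ∈ Metric.ball (0 : ℝ) ε by
      rw [Metric.mem_ball, dist_zero_right, norm_neg, Real.norm_of_nonneg (by positivity)]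
      linarith)
    have hzK : AffineMap.lineMap (x' : EuclideanSpace ℝ (Fin d)) y (-(ε / 2)) ∈ faceOf H p := hz
    intro h hh h0
    have h1 := hzK.1 h hh
    have h2 := hy.1 h hh
    have e : ((AffineMap.lineMap (x' : EuclideanSpace ℝ (Fin d)) y (-(ε / 2)), (1 : ℝ)) :
        EuclideanSpace ℝ (Fin d) × ℝ) = (1 + ε / 2) • ((x' : EuclideanSpace ℝ (Fin d)), (1 : ℝ))
          - (ε / 2) • (y, (1 : ℝ)) := by
      refine Prod.ext ?_ ?_
      · simp only [AffineMap.lineMap_apply_module, Prod.smul_mk, Prod.mk_sub_mk]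
        module
      · simp
    rw [e, map_sub, map_smul, map_smul, h0, smul_zero, zero_sub, smul_eq_mul] at h1
    nlinarith
  · rintro ⟨hxQ, hxp⟩
    have hface := (hQ.faceOf_eq_iff hp (hQ.mem_iff.mp hxQ)).mpr hxp.symm
    have hxF : x ∈ faceOf H p := hface ▸ hQ.self_mem_faceOf hxQ
    have hxA : x ∈ affineSpan ℝ (faceOf H p) := subset_affineSpan ℝ _ hxF
    refine mem_intrinsicInterior.mpr ⟨⟨x, hxA⟩, ?_, rfl⟩
    rw [mem_interior_iff_mem_nhds]
    have hcont : ∀ h : EuclideanSpace ℝ (Fin d) × ℝ, Continuous fun y : EuclideanSpace ℝ (Fin d) =>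
        slack h (y, 1) := fun h => (slack h).continuous_of_finiteDimensional.comp (by fun_prop)
    have hev : ∀ᶠ y in nhds x, ∀ h ∈ H, slack h (x, 1) ≠ 0 → 0 < slack h (y, 1) := by
      rw [Filter.eventually_all_finset]
      intro h hh
      by_cases h0 : slack h (x, 1) = 0
      · exact Filter.Eventually.of_forall fun _ hn => absurd h0 hn
      · have : 0 < slack h (x, 1) := lt_of_le_of_ne (hQ.mem_iff.mp hxQ h hh) (Ne.symm h0)
        filter_upwards [(hcont h).continuousAt.eventually (lt_mem_nhds this)] with y hy _ using hy
    have hsub := (continuous_subtype_val (p := fun y => y ∈ affineSpan ℝ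
      (faceOf H p))).continuousAt (x := ⟨x, hxA⟩) |>.eventually hev
    filter_upwards [hsub] with y hy
    have hv : (y : EuclideanSpace ℝ (Fin d)) - x ∈ vectorSpan ℝ (faceOf H p) := by
      rw [← direction_affineSpan]
      exact AffineSubspace.vsub_mem_direction y.2 hxA
    replace hv := (congrArg (vectorSpan ℝ) hface).le.trans (hQ.vectorSpan_faceOf hxQ).le hv
    have hyZ : ((y : EuclideanSpace ℝ (Fin d)), (1 : ℝ)) ∈ faceSpan slack H (x, 1) := by
      have := add_mem (self_mem_faceSpan (ψ := slack) (H := H) (x, (1 : ℝ))) hv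
      convert this using 1
      ext <;> simp
    refine ⟨fun h hh => ?_, hxp ▸ hyZ⟩
    by_cases h0 : slack h (x, 1) = 0
    · exact (hyZ h hh h0).ge
    · exact (hy h hh h0).le

end IsHRep

end Faces

/-! ### Locally anti-blocking sections and representative points of their faces -/

section Sections

variable {d : ℕ}

theorem inner_stdVec (x : EuclideanSpace ℝ (Fin d)) (l : Fin d) : inner ℝ (stdVec l) x = x l := by
  simp [stdVec, EuclideanSpace.inner_single_left]

theorem inner_stdVec_right (x : EuclideanSpace ℝ (Fin d)) (l : Fin d) :
    inner ℝ x (stdVec l) = x l := by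
  rw [real_inner_comm, inner_stdVec]

theorem stdVec_apply (l j : Fin d) :
    (stdVec l : EuclideanSpace ℝ (Fin d)) j = if j = l then 1 else 0 := by
  simp [stdVec]

/-- `Q` is a polytope in the coordinate subspace `ℝ^J` that has the origin in its interior relative
to `ℝ^J` and is closed under replacing a coordinate by zero. These are the properties of the
section of a proper locally anti-blocking polytope by `ℝ^J` on which the counting of flags rests. -/
structure IsCoordSection (J : Set (Fin d)) (Q : Set (EuclideanSpace ℝ (Fin d))) : Prop where
  isPolytope : IsPolytope Q
  proj_mem : ∀ x ∈ Q, ∀ l, x - x l • stdVec l ∈ Q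
  apply_eq_zero : ∀ x ∈ Q, ∀ l ∉ J, x l = 0
  exists_ball : ∃ ε : ℝ, 0 < ε ∧
    ∀ x : EuclideanSpace ℝ (Fin d), (∀ l ∉ J, x l = 0) → ‖x‖ ≤ ε → x ∈ Q

/-- The coordinate `l` takes both signs on the set `F`. -/
def Crosses (F : Set (EuclideanSpace ℝ (Fin d))) (l : Fin d) : Prop :=
  (∃ y ∈ F, 0 < y l) ∧ ∃ y ∈ F, y l < 0

theorem Crosses.mono {F G : Set (EuclideanSpace ℝ (Fin d))} {l : Fin d} (h : Crosses F l)
    (hFG : F ⊆ G) : Crosses G l := by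
  obtain ⟨⟨y, hy, h1⟩, z, hz, h2⟩ := h
  exact ⟨⟨y, hFG hy, h1⟩, z, hFG hz, h2⟩

/-- A choice of a point `c F` in the relative interior of each nonempty face `F` of `Q` that lies in
as many coordinate hyperplanes as possible. The cones of the standard fan that meet the relative
interior of `F` are those that contain `c F`. -/
structure IsRep (Q : Set (EuclideanSpace ℝ (Fin d)))
    (c : Set (EuclideanSpace ℝ (Fin d)) → EuclideanSpace ℝ (Fin d)) : Prop where
  mem_interior : ∀ F, IsExposed ℝ Q F → F.Nonempty → c F ∈ intrinsicInterior ℝ F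
  apply_eq_zero : ∀ F, IsExposed ℝ Q F → F.Nonempty → ∀ l, Crosses F l → c F l = 0

variable {Q : Set (EuclideanSpace ℝ (Fin d))} {J : Set (Fin d)}
  {c : Set (EuclideanSpace ℝ (Fin d)) → EuclideanSpace ℝ (Fin d)}
  {H : Finset (EuclideanSpace ℝ (Fin d) × ℝ)}

namespace IsCoordSection

theorem zero_mem (hQ : IsCoordSection J Q) : (0 : EuclideanSpace ℝ (Fin d)) ∈ Q := by
  obtain ⟨ε, hε, h⟩ := hQ.exists_ball
  exact h 0 (by simp) (by simpa using hε.le)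

theorem exists_isHRep (hQ : IsCoordSection J Q) : ∃ H, IsHRep Q H :=
  hQ.isPolytope.exists_isHRep hQ.zero_mem

end IsCoordSection

/-- Segments ending in the relative interior of a face can be prolonged. -/
theorem IsHRep.exists_prolong (hH : IsHRep Q H) {F : Set (EuclideanSpace ℝ (Fin d))}
    (hF : IsExposed ℝ Q F) {x y : EuclideanSpace ℝ (Fin d)} (hx : x ∈ intrinsicInterior ℝ F)
    (hy : y ∈ F) : ∃ ε : ℝ, 0 < ε ∧ x + ε • (x - y) ∈ F := by
  obtain ⟨p, hp, rfl⟩ := hH.exists_faceOf hF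
  obtain ⟨hxQ, hxp⟩ := (hH.mem_intrinsicInterior_iff hp).mp hx
  have hdir := sub_mem (self_mem_faceSpan (ψ := slack) (H := H) (x, (1 : ℝ))) (hxp ▸ hy.2)
  obtain ⟨ε, hε, hmem⟩ := exists_pos_add_smul_mem (hH.mem_iff.mp hxQ) hdir
  have e : ((x, (1 : ℝ)) : EuclideanSpace ℝ (Fin d) × ℝ) + ε • ((x, 1) - (y, 1)) =
      (x + ε • (x - y), 1) := by ext <;> simp
  refine ⟨ε, hε, e ▸ hmem, ?_⟩
  rw [← hxp, ← e]
  exact add_mem (self_mem_faceSpan _) (Submodule.smul_mem _ _ hdir)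

theorem IsHRep.crosses_of_apply_eq_zero (hH : IsHRep Q H) {F : Set (EuclideanSpace ℝ (Fin d))}
    (hF : IsExposed ℝ Q F) {x y : EuclideanSpace ℝ (Fin d)} {l : Fin d}
    (hx : x ∈ intrinsicInterior ℝ F) (hxl : x l = 0) (hy : y ∈ F) (hyl : y l ≠ 0) :
    Crosses F l := by
  obtain ⟨ε, hε, hz⟩ := hH.exists_prolong hF hx hy
  have e : (x + ε • (x - y)) l = -(ε * y l) := by simp [hxl]
  rcases hyl.lt_or_gt with h | h
  · exact ⟨⟨_, hz, by rw [e]; nlinarith⟩, y, hy, h⟩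
  · exact ⟨⟨y, hy, h⟩, _, hz, by rw [e]; nlinarith⟩

/-- On a point of the relative interior, a coordinate that is nonnegative and not constantly zero is
positive. The sign is carried by the factor `r`. -/
theorem IsHRep.pos_of_nonneg (hH : IsHRep Q H) {F : Set (EuclideanSpace ℝ (Fin d))}
    (hF : IsExposed ℝ Q F) {x y : EuclideanSpace ℝ (Fin d)} {l : Fin d} {r : ℝ}
    (hx : x ∈ intrinsicInterior ℝ F) (hnon : ∀ y ∈ F, 0 ≤ r * y l) (hy : y ∈ F)
    (hyl : 0 < r * y l) : 0 < r * x l := by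
  obtain ⟨ε, hε, hz⟩ := hH.exists_prolong hF hx hy
  have h1 := hnon _ hz
  have e : r * (x + ε • (x - y)) l = (1 + ε) * (r * x l) - ε * (r * y l) := by simp; ring
  rw [e] at h1
  by_contra hle
  have := mul_pos hε hyl
  nlinarith

theorem slack_proj (h : EuclideanSpace ℝ (Fin d) × ℝ) (y : EuclideanSpace ℝ (Fin d)) (l : Fin d) :
    slack h (y - y l • stdVec l, 1) = slack h (y, 1) + y l * h.1 l := by
  simp only [slack_apply, inner_sub_left, real_inner_smul_left, inner_stdVec]
  ring

/-- If a coordinate takes both signs on a face, then the normals of the face vanish in that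
coordinate. -/
theorem IsCoordSection.normal_eq_zero (hQ : IsCoordSection J Q) (hH : IsHRep Q H)
    {F : Set (EuclideanSpace ℝ (Fin d))} (hFQ : F ⊆ Q) {l : Fin d} (hl : Crosses F l)
    {h : EuclideanSpace ℝ (Fin d) × ℝ} (hh : h ∈ H) (hact : ∀ y ∈ F, slack h (y, 1) = 0) :
    h.1 l = 0 := by
  have key : ∀ y ∈ F, 0 ≤ y l * h.1 l := by
    intro y hy
    have := hH.mem_iff.mp (hQ.proj_mem y (hFQ hy) l) h hh
    rwa [slack_proj, hact y hy, zero_add] at this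
  obtain ⟨⟨y, hy, hy0⟩, z, hz, hz0⟩ := hl
  have h1 := key y hy
  have h2 := key z hz
  apply le_antisymm
  · by_contra hc
    push Not at hc
    nlinarith
  · by_contra hc
    push Not at hc
    nlinarith

theorem IsCoordSection.stdVec_mem_faceSpan (hQ : IsCoordSection J Q) (hH : IsHRep Q H)
    {p : EuclideanSpace ℝ (Fin d) × ℝ} {l : Fin d} (hl : Crosses (faceOf H p) l) :
    (stdVec l, (0 : ℝ)) ∈ faceSpan slack H p := by
  intro h hh h0
  have := hQ.normal_eq_zero hH (hH.faceOf_subset p) hl hh fun y hy => hy.2 h hh h0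
  simp [slack_apply, inner_stdVec, this]

/-- Zeroing a coordinate that takes both signs on a face preserves its relative interior. -/
theorem IsCoordSection.proj_mem_interior (hQ : IsCoordSection J Q)
    {F : Set (EuclideanSpace ℝ (Fin d))} (hF : IsExposed ℝ Q F) {l : Fin d} (hl : Crosses F l)
    {x : EuclideanSpace ℝ (Fin d)} (hx : x ∈ intrinsicInterior ℝ F) :
    x - x l • stdVec l ∈ intrinsicInterior ℝ F := by
  obtain ⟨H, hH⟩ := hQ.exists_isHRep
  obtain ⟨p, hp, rfl⟩ := hH.exists_faceOf hF
  -- The hyperplane `x l = 0` meets the relative interior in the point `z` between `x` and a point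
  -- of the face on the other side.
  have hxF := intrinsicInterior_subset hx
  obtain ⟨hxQ, hxp⟩ := (hH.mem_intrinsicInterior_iff hp).mp hx
  have hmem : x - x l • stdVec l ∈ faceOf H p := by
    refine ⟨hH.mem_iff.mp (hQ.proj_mem x hxQ l), ?_⟩
    have h1 := sub_mem hxF.2 (Submodule.smul_mem _ (x l) (hQ.stdVec_mem_faceSpan hH hl))
    convert h1 using 1
    ext <;> simp
  obtain ⟨z, hz, hzl⟩ : ∃ z ∈ intrinsicInterior ℝ (faceOf H p), z l = 0 := by
    by_cases hxl : x l = 0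
    · exact ⟨x, hx, hxl⟩
    obtain ⟨y, hy, hyl⟩ : ∃ y ∈ faceOf H p, x l * y l < 0 := by
      obtain ⟨⟨y, hy, h1⟩, z, hz, h2⟩ := hl
      rcases Ne.lt_or_gt hxl with h | h
      · exact ⟨y, hy, by nlinarith⟩
      · exact ⟨z, hz, by nlinarith⟩
    have hyQ := hH.faceOf_subset p hy
    have hpos : 0 < y l ^ 2 - x l * y l := by nlinarith [sq_nonneg (y l)]
    set a := y l ^ 2 / (y l ^ 2 - x l * y l) with ha
    set b := -(x l * y l) / (y l ^ 2 - x l * y l) with hb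
    have hyl0 : y l ≠ 0 := by rintro h; simp [h] at hyl
    have ha0 : 0 < a := by positivity
    have hb0 : 0 ≤ b := div_nonneg (by linarith) hpos.le
    have hab : a + b = 1 := by rw [ha, hb, ← add_div, div_eq_one_iff_eq hpos.ne']; ring
    have e : (((a • x + b • y), (1 : ℝ)) : EuclideanSpace ℝ (Fin d) × ℝ) =
        a • (x, (1 : ℝ)) + b • (y, (1 : ℝ)) := by
      ext <;> simp [hab]
    have haK := smul_mem_polyCone (hH.mem_iff.mp hxQ) ha0.le
    have hbK := smul_mem_polyCone (hH.mem_iff.mp hyQ) hb0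
    refine ⟨a • x + b • y, (hH.mem_intrinsicInterior_iff hp).mpr ⟨?_, ?_⟩, ?_⟩
    · rw [hH.mem_iff, e]; exact add_mem_polyCone haK hbK
    · rw [e]
      apply le_antisymm
      · rw [faceSpan_le_iff]
        exact add_mem (Submodule.smul_mem _ _ hxF.2) (Submodule.smul_mem _ _ hy.2)
      · rw [← hxp, ← faceSpan_smul (p := (x, (1 : ℝ))) ha0.ne']
        exact faceSpan_le_faceSpan_add haK hbK
    · simp only [PiLp.add_apply, PiLp.smul_apply, smul_eq_mul, ha, hb]
      field_simp
      ring
  obtain ⟨hzQ, hzp⟩ := (hH.mem_intrinsicInterior_iff hp).mp hz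
  refine (hH.mem_intrinsicInterior_iff hp).mpr ⟨hH.faceOf_subset p hmem, ?_⟩
  refine le_antisymm (faceSpan_le_iff.mpr hmem.2) ?_
  rw [← hzp, faceSpan_le_iff]
  -- The projection of the segment prolonged from `z` through `x` runs beyond the projection of `x`.
  obtain ⟨ε, hε, hw⟩ := hH.exists_prolong hF hx (intrinsicInterior_subset hz)
  have hw' := hH.mem_iff.mp (hQ.proj_mem _ (hH.faceOf_subset p hw) l)
  have e : ((x + ε • (x - z) - (x + ε • (x - z)) l • stdVec l, (1 : ℝ)) :
      EuclideanSpace ℝ (Fin d) × ℝ) =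
      (1 + ε) • (x - x l • stdVec l, (1 : ℝ)) - ε • (z, (1 : ℝ)) := by
    refine Prod.ext ?_ ?_
    · simp only [PiLp.add_apply, PiLp.smul_apply, PiLp.sub_apply, hzl, smul_eq_mul, Prod.smul_mk,
        Prod.mk_sub_mk]
      module
    · simp
  intro h hh h0
  have h1 := hw' h hh
  have h2 := hH.mem_iff.mp hzQ h hh
  rw [e, map_sub, map_smul, map_smul, h0, smul_zero, zero_sub, smul_eq_mul] at h1
  nlinarith

theorem IsCoordSection.exists_isRep (hQ : IsCoordSection J Q) : ∃ c, IsRep Q c := by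
  classical
  obtain ⟨H, hH⟩ := hQ.exists_isHRep
  have key : ∀ F, IsExposed ℝ Q F → F.Nonempty → ∃ x ∈ intrinsicInterior ℝ F,
      ∀ l, Crosses F l → x l = 0 := by
    intro F hF hne
    have hint : (intrinsicInterior ℝ F).Nonempty := by
      obtain ⟨p, hp, rfl⟩ := hH.exists_faceOf hF
      obtain ⟨x, hx, hpx⟩ := hH.exists_point hp ((hH.faceOf_nonempty_iff hp).mp hne)
      exact ⟨x, (hH.mem_intrinsicInterior_iff hp).mpr ⟨hH.faceOf_subset p hx, hpx.symm⟩⟩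
    obtain ⟨x, hx, hmin⟩ := (measure fun x : EuclideanSpace ℝ (Fin d) =>
      (Finset.univ.filter fun l => x l ≠ 0).card).wf.has_min _ hint
    refine ⟨x, hx, fun l hl => ?_⟩
    by_contra hxl
    refine hmin _ (hQ.proj_mem_interior hF hl hx) ?_
    change Finset.card _ < Finset.card _
    apply Finset.card_lt_card
    rw [Finset.ssubset_iff_of_subset]
    · exact ⟨l, by simp [hxl], by simp [stdVec_apply]⟩
    · intro j
      by_cases hj : j = l
      · subst hj; simp [stdVec_apply]
      · simp [stdVec_apply, hj]
  choose! c hc1 hc2 using key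
  exact ⟨c, hc1, hc2⟩

namespace IsRep

variable {F G : Set (EuclideanSpace ℝ (Fin d))}

theorem mem (hc : IsRep Q c) (hF : IsExposed ℝ Q F) (hne : F.Nonempty) : c F ∈ F :=
  intrinsicInterior_subset (hc.mem_interior F hF hne)

theorem crosses_of_apply_eq_zero (hc : IsRep Q c) (hH : IsHRep Q H) (hF : IsExposed ℝ Q F)
    {y : EuclideanSpace ℝ (Fin d)} (hy : y ∈ F) {l : Fin d} (hyl : y l ≠ 0) (h0 : c F l = 0) :
    Crosses F l :=
  hH.crosses_of_apply_eq_zero hF (hc.mem_interior F hF ⟨y, hy⟩) h0 hy hyl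

theorem pos_iff (hc : IsRep Q c) (hH : IsHRep Q H) (hF : IsExposed ℝ Q F) (hne : F.Nonempty)
    {l : Fin d} {r : ℝ} :
    0 < r * c F l ↔ (∀ y ∈ F, 0 ≤ r * y l) ∧ ∃ y ∈ F, 0 < r * y l := by
  constructor
  · intro h
    refine ⟨fun y hy => ?_, c F, hc.mem hF hne, h⟩
    by_contra hy0
    push Not at hy0
    have : Crosses F l := by
      have hr : r ≠ 0 := by rintro rfl; simp at h
      rcases hr.lt_or_gt with hr | hr
      · exact ⟨⟨y, hy, by nlinarith⟩, c F, hc.mem hF hne, by nlinarith⟩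
      · exact ⟨⟨c F, hc.mem hF hne, by nlinarith⟩, y, hy, by nlinarith⟩
    rw [hc.apply_eq_zero F hF hne l this] at h
    simp at h
  · rintro ⟨h1, y, hy, h2⟩
    exact hH.pos_of_nonneg hF (hc.mem_interior F hF hne) h1 hy h2

/-- The signs of the representative points of comparable faces do not contradict each other. -/
theorem nonneg_of_subset (hc : IsRep Q c) (hH : IsHRep Q H) (hF : IsExposed ℝ Q F)
    (hneF : F.Nonempty) (hG : IsExposed ℝ Q G) (hFG : F ⊆ G) {l : Fin d} {r : ℝ}
    (h : 0 < r * c F l) : 0 ≤ r * c G l := by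
  by_contra hlt
  have hneg : 0 < -r * c G l := by linarith
  have := ((hc.pos_iff hH hG (hneF.mono hFG)).mp hneg).1 _ (hFG (hc.mem hF hneF))
  linarith

/-- Along a chain of faces, the sign of a coordinate is nonzero on an interval: it is zero as long
as the coordinate is constantly zero, and zero again once the coordinate takes both signs. -/
theorem apply_ne_zero_of_between (hc : IsRep Q c) (hH : IsHRep Q H)
    {E : Set (EuclideanSpace ℝ (Fin d))} (hE : IsExposed ℝ Q E) (hneE : E.Nonempty)
    (hF : IsExposed ℝ Q F) (hG : IsExposed ℝ Q G) (hEF : E ⊆ F) (hFG : F ⊆ G) {l : Fin d}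
    (hEl : c E l ≠ 0) (hGl : c G l ≠ 0) : c F l ≠ 0 := fun h0 =>
  hGl (hc.apply_eq_zero G hG ((hneE.mono hEF).mono hFG) l
    ((hc.crosses_of_apply_eq_zero hH hF (hEF (hc.mem hE hneE)) hEl h0).mono hFG))

theorem eq_faceOf (hc : IsRep Q c) (hH : IsHRep Q H) (hF : IsExposed ℝ Q F) (hne : F.Nonempty) :
    (c F, (1 : ℝ)) ∈ polyCone slack H ∧ F = faceOf H (c F, 1) := by
  have hi := hc.mem_interior F hF hne
  obtain ⟨p, hp, rfl⟩ := hH.exists_faceOf hF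
  obtain ⟨h1, h2⟩ := (hH.mem_intrinsicInterior_iff hp).mp hi
  exact ⟨hH.mem_iff.mp h1, (hH.faceOf_eq_iff hp (hH.mem_iff.mp h1)).mpr h2.symm⟩

end IsRep

end Sections

/-! ### Flags and flips -/

section FlagBasics

variable {d : ℕ} {Q : Set (EuclideanSpace ℝ (Fin d))}
  {c : Set (EuclideanSpace ℝ (Fin d)) → EuclideanSpace ℝ (Fin d)}
  {H : Finset (EuclideanSpace ℝ (Fin d) × ℝ)}

theorem affDim_nonneg {F : Set (EuclideanSpace ℝ (Fin d))} (hF : F.Nonempty) : 0 ≤ affDim F := by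
  rw [affDim, if_neg hF.ne_empty]
  positivity

theorem nonempty_of_affDim_nonneg {F : Set (EuclideanSpace ℝ (Fin d))} (hF : 0 ≤ affDim F) :
    F.Nonempty := by
  rw [Set.nonempty_iff_ne_empty]
  rintro rfl
  simp [affDim] at hF

theorem eq_empty_of_affDim_neg {F : Set (EuclideanSpace ℝ (Fin d))} (hF : affDim F < 0) :
    F = ∅ := by
  by_contra h
  exact absurd (affDim_nonneg (Set.nonempty_iff_ne_empty.mpr h)) (by omega)

/-- Comparable faces of the same dimension coincide. -/
theorem IsHRep.eq_of_subset_of_affDim (hH : IsHRep Q H) {F G : Set (EuclideanSpace ℝ (Fin d))}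
    (hF : IsExposed ℝ Q F) (hG : IsExposed ℝ Q G) (hFG : F ⊆ G) (hd : affDim G ≤ affDim F) :
    F = G := by
  obtain ⟨p, hp, rfl⟩ := hH.exists_faceOf hF
  obtain ⟨q, hq, rfl⟩ := hH.exists_faceOf hG
  rw [hH.affDim_faceOf hp, hH.affDim_faceOf hq] at hd
  rw [hH.faceOf_eq_iff hp hq]
  exact faceSpan_eq_of_le_of_finrank ((hH.faceOf_subset_iff hp).mp hFG) (by omega)

namespace Flags

/-- The `i`-th face of a flag, as a total function of the integer `i`. -/
noncomputable def nth (F : Flags Q) (i : ℤ) : Set (EuclideanSpace ℝ (Fin d)) :=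
  open scoped Classical in
  if h : i ∈ Set.Icc (-1 : ℤ) (affDim Q) then F.face ⟨i, h⟩ else ∅

theorem nth_coe (F : Flags Q) (i : Set.Icc (-1 : ℤ) (affDim Q)) : F.nth i = F.face i := by
  simp only [nth, dif_pos i.2]

theorem nth_isExposed (F : Flags Q) (i : ℤ) : IsExposed ℝ Q (F.nth i) := by
  rw [nth]
  split_ifs
  · exact F.isFace _
  · exact isExposed_empty

theorem affDim_nth (F : Flags Q) {i : ℤ} (h1 : -1 ≤ i) (h2 : i ≤ affDim Q) :
    affDim (F.nth i) = i := by
  rw [nth, dif_pos ⟨h1, h2⟩]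
  exact F.dim_face _

theorem nth_of_neg (F : Flags Q) {i : ℤ} (h : i < 0) : F.nth i = ∅ := by
  by_cases h' : i ∈ Set.Icc (-1 : ℤ) (affDim Q)
  · exact eq_empty_of_affDim_neg (by rw [F.affDim_nth h'.1 h'.2]; exact h)
  · rw [nth, dif_neg h']

theorem nth_nonempty (F : Flags Q) {i : ℤ} (h1 : 0 ≤ i) (h2 : i ≤ affDim Q) :
    (F.nth i).Nonempty :=
  nonempty_of_affDim_nonneg (by rw [F.affDim_nth (by omega) h2]; exact h1)

theorem nth_mono (F : Flags Q) {i j : ℤ} (hij : i ≤ j) (hj : j ≤ affDim Q) :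
    F.nth i ⊆ F.nth j := by
  by_cases hi : i < 0
  · rw [F.nth_of_neg hi]; exact Set.empty_subset _
  · rw [nth, nth, dif_pos ⟨by omega, by omega⟩, dif_pos ⟨by omega, hj⟩]
    exact F.strictMono.monotone hij

theorem nth_top (hH : IsHRep Q H) (F : Flags Q) : F.nth (affDim Q) = Q :=
  hH.eq_of_subset_of_affDim (F.nth_isExposed _) (IsExposed.refl Q) (F.nth_isExposed _).subset
    (by rw [F.affDim_nth (by have := affDim_nonneg ⟨_, hH.zero_mem⟩; omega) le_rfl])

/-- Flags are determined by their proper nonempty faces. -/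
theorem ext_nth (hH : IsHRep Q H) {F G : Flags Q}
    (h : ∀ i, 0 ≤ i → i < affDim Q → F.nth i = G.nth i) : F = G := by
  have key : ∀ i, i ≤ affDim Q → F.nth i = G.nth i := by
    intro i hi
    by_cases h0 : i < 0
    · rw [F.nth_of_neg h0, G.nth_of_neg h0]
    rcases hi.eq_or_lt with rfl | hlt
    · rw [F.nth_top hH, G.nth_top hH]
    · exact h i (by omega) hlt
  ext1
  funext i
  rw [← nth_coe, ← nth_coe]
  exact key i i.2.2

/-- The flag with a given sequence of faces. -/
def ofFun (f : ℤ → Set (EuclideanSpace ℝ (Fin d)))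
    (hexp : ∀ i, -1 ≤ i → i ≤ affDim Q → IsExposed ℝ Q (f i))
    (hdim : ∀ i, -1 ≤ i → i ≤ affDim Q → affDim (f i) = i)
    (hmono : ∀ i, -1 ≤ i → i < affDim Q → f i ⊆ f (i + 1)) : Flags Q where
  face i := f i
  isFace i := hexp i i.2.1 i.2.2
  dim_face i := hdim i i.2.1 i.2.2
  strictMono := by
    intro i j hij
    have hij' : (i : ℤ) < j := hij
    have key : ∀ n : ℕ, (i : ℤ) + n ≤ affDim Q → f i ⊆ f (i + n) := by
      intro n
      induction n with
      | zero => intro _; simp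
      | succ n ih =>
        intro hn
        push_cast at hn ⊢
        have := i.2.1
        refine (ih (by omega)).trans ?_
        rw [← add_assoc]
        exact hmono _ (by omega) (by omega)
    have hsub := key ((j : ℤ) - i).toNat (by have := j.2.2; omega)
    rw [Int.toNat_of_nonneg (by omega), add_sub_cancel] at hsub
    refine lt_of_le_of_ne hsub fun heq => ?_
    have h1 := hdim i i.2.1 i.2.2
    have h2 := hdim j j.2.1 j.2.2
    have h3 : affDim (f i) = affDim (f j) := congrArg affDim heq
    omega

theorem nth_ofFun {f : ℤ → Set (EuclideanSpace ℝ (Fin d))}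
    {hexp : ∀ i, -1 ≤ i → i ≤ affDim Q → IsExposed ℝ Q (f i)}
    {hdim : ∀ i, -1 ≤ i → i ≤ affDim Q → affDim (f i) = i}
    {hmono : ∀ i, -1 ≤ i → i < affDim Q → f i ⊆ f (i + 1)} {i : ℤ} (h1 : -1 ≤ i)
    (h2 : i ≤ affDim Q) : (ofFun f hexp hdim hmono).nth i = f i := by
  rw [nth, dif_pos ⟨h1, h2⟩]
  rfl

theorem finite (hH : IsHRep Q H) : Finite (Flags Q) := by
  classical
  have hfaces : {F | IsExposed ℝ Q F}.Finite := by
    refine (Set.finite_range fun A : {A // A ∈ H.powerset} =>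
      {y | (y, (1 : ℝ)) ∈ polyCone slack H ∧ ∀ h ∈ A.1, slack h (y, 1) = 0}).subset ?_
    intro F hF
    obtain ⟨p, hp, rfl⟩ := hH.exists_faceOf hF
    refine ⟨⟨H.filter fun h => slack h p = 0, by simp⟩, ?_⟩
    ext y
    simp [mem_faceOf, mem_faceSpan]
  have : Finite {F | IsExposed ℝ Q F} := hfaces
  refine Finite.of_injective (fun F : Flags Q => fun i => (⟨F.face i, F.isFace i⟩ :
    {F | IsExposed ℝ Q F})) fun F G h => ?_
  ext1
  funext i
  exact congrArg Subtype.val (congrFun h i)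

/-- A homogeneous point in the relative interior of the `i`-th face of a flag; zero for the empty
face. -/
noncomputable def pt (c : Set (EuclideanSpace ℝ (Fin d)) → EuclideanSpace ℝ (Fin d)) (F : Flags Q)
    (i : ℤ) : EuclideanSpace ℝ (Fin d) × ℝ :=
  if 0 ≤ i then (c (F.nth i), 1) else 0

theorem pt_of_nonneg (F : Flags Q) {i : ℤ} (h : 0 ≤ i) : F.pt c i = (c (F.nth i), 1) := if_pos h

theorem pt_of_neg (F : Flags Q) {i : ℤ} (h : i < 0) : F.pt c i = 0 := if_neg (by omega)

theorem pt_spec (hc : IsRep Q c) (hH : IsHRep Q H) (F : Flags Q) {i : ℤ} (h1 : -1 ≤ i)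
    (h2 : i ≤ affDim Q) : F.pt c i ∈ polyCone slack H ∧ F.nth i = faceOf H (F.pt c i) ∧
      (Module.finrank ℝ (faceSpan slack H (F.pt c i)) : ℤ) = i + 1 := by
  have key : F.pt c i ∈ polyCone slack H ∧ F.nth i = faceOf H (F.pt c i) := by
    by_cases h : i < 0
    · rw [F.pt_of_neg h, F.nth_of_neg h, hH.faceOf_zero]
      exact ⟨zero_mem_polyCone, rfl⟩
    · rw [F.pt_of_nonneg (by omega)]
      exact hc.eq_faceOf hH (F.nth_isExposed i) (F.nth_nonempty (by omega) h2)
  refine ⟨key.1, key.2, ?_⟩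
  have h3 := hH.affDim_faceOf key.1
  rw [← key.2, F.affDim_nth h1 h2] at h3
  omega

theorem pt_mem_faceSpan (hc : IsRep Q c) (hH : IsHRep Q H) (F : Flags Q) {i j : ℤ} (h1 : -1 ≤ i)
    (hij : i ≤ j) (h2 : j ≤ affDim Q) : F.pt c i ∈ faceSpan slack H (F.pt c j) := by
  obtain ⟨hi, hi', -⟩ := F.pt_spec hc hH h1 (hij.trans h2)
  obtain ⟨-, hj', -⟩ := F.pt_spec hc hH (h1.trans hij) h2
  rw [← hH.faceOf_subset_iff hi, ← hi', ← hj']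
  exact F.nth_mono hij h2

/-- The representative points of the faces of a flag span its faces. -/
theorem faceSpan_pt_le (hc : IsRep Q c) (hH : IsHRep Q H) (F : Flags Q) (n : ℕ)
    (hn : (n : ℤ) - 1 ≤ affDim Q) :
    faceSpan slack H (F.pt c ((n : ℤ) - 1)) ≤
      Submodule.span ℝ {v | ∃ j : ℤ, 0 ≤ j ∧ j < n ∧ v = F.pt c j} := by
  induction n with
  | zero =>
    rw [F.pt_of_neg (by simp), hH.faceSpan_zero]
    exact bot_le
  | succ n ih =>
    push_cast at hn ⊢
    rw [add_sub_cancel_right] at hn ⊢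
    obtain ⟨h1, -, h3⟩ := F.pt_spec hc hH (i := (n : ℤ) - 1) (by omega) (by omega)
    obtain ⟨g1, -, g3⟩ := F.pt_spec hc hH (i := (n : ℤ)) (by omega) hn
    intro x hx
    have hmem := F.pt_mem_faceSpan hc hH (i := (n : ℤ) - 1) (j := n) (by omega) (by omega) hn
    obtain ⟨v, hv, β, rfl⟩ := exists_eq_add_smul (n := n) (fun h => by
      have := Submodule.finrank_mono (faceSpan_le_iff.mpr h); omega) hmem (by omega) (by omega) hx
    refine add_mem ?_ (Submodule.smul_mem _ _ (Submodule.subset_span ⟨n, by omega, by omega, rfl⟩))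
    refine Submodule.span_mono ?_ (ih (by omega) hv)
    rintro _ ⟨j, hj1, hj2, rfl⟩
    exact ⟨j, hj1, by omega, rfl⟩

/-- Two flags are adjacent at level `i` if they differ in the `i`-th face only. -/
def AdjAt (i : ℤ) (F G : Flags Q) : Prop :=
  F ≠ G ∧ ∀ j, j ≠ i → F.nth j = G.nth j

theorem AdjAt.symm {i : ℤ} {F G : Flags Q} (h : AdjAt i F G) : AdjAt i G F :=
  ⟨h.1.symm, fun j hj => (h.2 j hj).symm⟩

theorem AdjAt.nth_ne (hH : IsHRep Q H) {i : ℤ} {F G : Flags Q} (h : AdjAt i F G) :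
    F.nth i ≠ G.nth i := fun he => h.1 <| ext_nth hH fun j _ _ => by
  by_cases hj : j = i
  · rw [hj, he]
  · exact h.2 j hj

theorem AdjAt.pt_eq {i : ℤ} {F G : Flags Q} (h : AdjAt i F G) {j : ℤ} (hj : j ≠ i) :
    F.pt c j = G.pt c j := by
  rw [pt, pt, h.2 j hj]

theorem AdjAt.faceSpan_ne (hc : IsRep Q c) (hH : IsHRep Q H) {i : ℤ} {F G : Flags Q}
    (h1 : -1 ≤ i) (h2 : i ≤ affDim Q) (h : AdjAt i F G) :
    faceSpan slack H (F.pt c i) ≠ faceSpan slack H (G.pt c i) := fun he => h.nth_ne hH <| by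
  obtain ⟨p1, p2, -⟩ := F.pt_spec hc hH h1 h2
  obtain ⟨q1, q2, -⟩ := G.pt_spec hc hH h1 h2
  rw [p2, q2]
  exact (hH.faceOf_eq_iff p1 q1).mpr he

/-- A face of a flag, other than the whole polytope, can be exchanged. -/
theorem exists_adjAt (hc : IsRep Q c) (hH : IsHRep Q H) (F : Flags Q) {i : ℤ} (h0 : 0 ≤ i)
    (h1 : i < affDim Q) : ∃ G, AdjAt i F G := by
  obtain ⟨ha, ha', ra⟩ := F.pt_spec hc hH (i := i - 1) (by omega) (by omega)
  obtain ⟨hm, hm', rm⟩ := F.pt_spec hc hH (i := i) (by omega) (by omega)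
  obtain ⟨hb, hb', rb⟩ := F.pt_spec hc hH (i := i + 1) (by omega) (by omega)
  obtain ⟨q, hq, haq, hqb, rq, hqm⟩ := exists_diamond (n := i.toNat) ha hb hm
    (F.pt_mem_faceSpan hc hH (by omega) (by omega) (by omega))
    (F.pt_mem_faceSpan hc hH (by omega) (by omega) (by omega)) (by omega) (by omega) (by omega)
  have hf : ∀ j, j = i ∨ (j ≠ i) := fun j => eq_or_ne j i
  refine ⟨ofFun (Function.update F.nth i (faceOf H q)) ?_ ?_ ?_, ?_, ?_⟩
  · intro j _ _
    rcases hf j with rfl | hj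
    · rw [Function.update_self]; exact hH.isExposed_faceOf hq
    · rw [Function.update_of_ne hj]; exact F.nth_isExposed j
  · intro j hj1 hj2
    rcases hf j with rfl | hj
    · rw [Function.update_self, hH.affDim_faceOf hq]; omega
    · rw [Function.update_of_ne hj]; exact F.affDim_nth hj1 hj2
  · intro j hj1 hj2
    rcases hf j with rfl | hj
    · rw [Function.update_self, Function.update_of_ne (by omega), hb',
        hH.faceOf_subset_iff hq]
      exact hqb
    · rw [Function.update_of_ne hj]
      rcases hf (j + 1) with hj' | hj'
      · rw [hj', Function.update_self]
        obtain rfl : j = i - 1 := by omega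
        rw [ha', hH.faceOf_subset_iff ha]
        exact haq
      · rw [Function.update_of_ne hj']
        exact F.nth_mono (by omega) (by omega)
  · intro he
    have := congrArg (fun G : Flags Q => G.nth i) he
    rw [nth_ofFun (by omega) (by omega), Function.update_self, hm', hH.faceOf_eq_iff hm hq] at this
    exact hqm (this ▸ self_mem_faceSpan q)
  · intro j hj
    by_cases hj' : j ∈ Set.Icc (-1 : ℤ) (affDim Q)
    · rw [nth_ofFun hj'.1 hj'.2, Function.update_of_ne hj]
    · rw [nth, nth, dif_neg hj', dif_neg hj']

theorem AdjAt.unique (hc : IsRep Q c) (hH : IsHRep Q H) {F G G' : Flags Q} {i : ℤ} (h0 : 0 ≤ i)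
    (h1 : i < affDim Q) (h : AdjAt i F G) (h' : AdjAt i F G') : G = G' := by
  obtain ⟨ha, ha', ra⟩ := F.pt_spec hc hH (i := i - 1) (by omega) (by omega)
  obtain ⟨hb, hb', rb⟩ := F.pt_spec hc hH (i := i + 1) (by omega) (by omega)
  have hlow : ∀ E : Flags Q, F.pt c (i - 1) = E.pt c (i - 1) →
      F.pt c (i - 1) ∈ faceSpan slack H (E.pt c i) := fun E he => by
    rw [he]; exact E.pt_mem_faceSpan hc hH (by omega) (by omega) (by omega)
  have hupp : ∀ E : Flags Q, F.pt c (i + 1) = E.pt c (i + 1) →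
      E.pt c i ∈ faceSpan slack H (F.pt c (i + 1)) := fun E he => by
    rw [he]; exact E.pt_mem_faceSpan hc hH (by omega) (by omega) (by omega)
  have hspec : ∀ E : Flags Q, _ := fun E => E.pt_spec hc hH (i := i) (by omega) (by omega)
  have := diamond_unique (n := i.toNat) (hspec F).1 (hspec G).1 (hspec G').1 (hlow F rfl)
    (hlow G (h.pt_eq (by omega))) (hlow G' (h'.pt_eq (by omega))) (hupp F rfl)
    (hupp G (h.pt_eq (by omega))) (hupp G' (h'.pt_eq (by omega))) (by omega)
    (by have := (hspec F).2.2; omega) (by have := (hspec G).2.2; omega)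
    (by have := (hspec G').2.2; omega) (by omega)
    (h.faceSpan_ne hc hH (by omega) (by omega)) (h'.faceSpan_ne hc hH (by omega) (by omega))
  refine ext_nth hH fun j _ _ => ?_
  rcases eq_or_ne j i with rfl | hj
  · rw [(hspec G).2.1, (hspec G').2.1]
    exact (hH.faceOf_eq_iff (hspec G).1 (hspec G').1).mpr this
  · rw [← h.2 j hj, h'.2 j hj]

/-- Adjacent flags lie on opposite sides of every linear hyperplane that contains all the
representative points they share. -/
theorem AdjAt.opposite (hc : IsRep Q c) (hH : IsHRep Q H) {F G : Flags Q} {i : ℤ} (h0 : 0 ≤ i)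
    (h1 : i < affDim Q) (h : AdjAt i F G) (g : EuclideanSpace ℝ (Fin d) →ₗ[ℝ] ℝ)
    (hg : ∀ j, 0 ≤ j → j ≤ affDim Q → j ≠ i → g (c (F.nth j)) = 0) :
    ∃ α : ℝ, 0 < α ∧ g (c (G.nth i)) = -(α * g (c (F.nth i))) := by
  obtain ⟨ha, ha', ra⟩ := F.pt_spec hc hH (i := i - 1) (by omega) (by omega)
  obtain ⟨hb, hb', rb⟩ := F.pt_spec hc hH (i := i + 1) (by omega) (by omega)
  obtain ⟨hF, -, rF⟩ := F.pt_spec hc hH (i := i) (by omega) (by omega)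
  obtain ⟨hG, -, rG⟩ := G.pt_spec hc hH (i := i) (by omega) (by omega)
  have hlow : F.pt c (i - 1) ∈ faceSpan slack H (G.pt c i) := by
    rw [h.pt_eq (c := c) (j := i - 1) (by omega)]
    exact G.pt_mem_faceSpan hc hH (by omega) (by omega) (by omega)
  have hupp : G.pt c i ∈ faceSpan slack H (F.pt c (i + 1)) := by
    rw [h.pt_eq (c := c) (j := i + 1) (by omega)]
    exact G.pt_mem_faceSpan hc hH (by omega) (by omega) (by omega)
  obtain ⟨α, hα, hmem⟩ := diamond_opposite (n := i.toNat) hb hF hG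
    (F.pt_mem_faceSpan hc hH (by omega) (by omega) (by omega)) hlow
    (F.pt_mem_faceSpan hc hH (by omega) (by omega) (by omega)) hupp
    (by omega) (by omega) (by omega) (by omega)
    (h.faceSpan_ne hc hH (by omega) (by omega))
  have hker : faceSpan slack H (F.pt c (i - 1)) ⊔ Submodule.span ℝ {F.pt c (i + 1)} ≤
      LinearMap.ker (g ∘ₗ LinearMap.fst ℝ (EuclideanSpace ℝ (Fin d)) ℝ) := by
    refine sup_le ?_ ?_
    · have hle := F.faceSpan_pt_le hc hH i.toNat (by omega)
      rw [Int.toNat_of_nonneg h0] at hle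
      refine hle.trans ?_
      rw [Submodule.span_le]
      rintro _ ⟨j, hj0, hj1, rfl⟩
      rw [F.pt_of_nonneg hj0]
      exact hg j hj0 (by omega) (by omega)
    · rw [Submodule.span_singleton_le_iff_mem, F.pt_of_nonneg (by omega)]
      exact hg (i + 1) (by omega) (by omega) (by omega)
  have := hker hmem
  rw [F.pt_of_nonneg h0, G.pt_of_nonneg h0] at this
  refine ⟨α, hα, ?_⟩
  simp at this
  linarith

end Flags

end FlagBasics

/-! ### Signs of flags -/

section Signs

variable {d : ℕ} {Q : Set (EuclideanSpace ℝ (Fin d))} {J : Set (Fin d)}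
  {c : Set (EuclideanSpace ℝ (Fin d)) → EuclideanSpace ℝ (Fin d)}
  {H : Finset (EuclideanSpace ℝ (Fin d) × ℝ)}

namespace IsCoordSection

theorem crosses_self (hQ : IsCoordSection J Q) {l : Fin d} (hl : l ∈ J) : Crosses Q l := by
  obtain ⟨ε, hε, h⟩ := hQ.exists_ball
  have key : ∀ r : ℝ, |r| ≤ ε → r • stdVec l ∈ Q := fun r hr => by
    refine h _ (fun j hj => ?_) ?_
    · have : j ≠ l := fun e => hj (e ▸ hl)
      simp [stdVec_apply, this]
    · simpa [norm_smul, stdVec] using hr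
  exact ⟨⟨_, key ε (by rw [abs_of_pos hε]), by simpa [stdVec_apply] using hε⟩,
    _, key (-ε) (by rw [abs_neg, abs_of_pos hε]), by simpa [stdVec_apply] using hε⟩

theorem rep_self (hQ : IsCoordSection J Q) (hc : IsRep Q c) : c Q = 0 := by
  have hne : Q.Nonempty := ⟨0, hQ.zero_mem⟩
  ext l
  by_cases hl : l ∈ J
  · exact hc.apply_eq_zero Q (IsExposed.refl Q) hne l (hQ.crosses_self hl)
  · exact hQ.apply_eq_zero _ (hc.mem (IsExposed.refl Q) hne) l hl

end IsCoordSection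

namespace Flags

/-- The signs of the coordinates of the representative points of a flag combine to the sign vector
`σ`. -/
def HasSign (c : Set (EuclideanSpace ℝ (Fin d)) → EuclideanSpace ℝ (Fin d)) (F : Flags Q)
    (σ : Fin d → SignType) : Prop :=
  (∀ i, 0 ≤ i → i ≤ affDim Q → ∀ l, c (F.nth i) l ≠ 0 → SignType.sign (c (F.nth i) l) = σ l) ∧
    ∀ l, σ l ≠ 0 → ∃ i, 0 ≤ i ∧ i ≤ affDim Q ∧ c (F.nth i) l ≠ 0

theorem sign_eq_of_le (hc : IsRep Q c) (hH : IsHRep Q H) (F : Flags Q) {i j : ℤ} (hi : 0 ≤ i)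
    (hij : i ≤ j) (hj : j ≤ affDim Q) {l : Fin d} (hil : c (F.nth i) l ≠ 0)
    (hjl : c (F.nth j) l ≠ 0) :
    SignType.sign (c (F.nth i) l) = SignType.sign (c (F.nth j) l) := by
  have key := fun r h => hc.nonneg_of_subset hH (F.nth_isExposed i)
    (F.nth_nonempty hi (hij.trans hj)) (F.nth_isExposed j) (F.nth_mono hij hj) (l := l) (r := r) h
  rcases hil.lt_or_gt with h | h
  · have := key (-1) (by linarith)
    rw [sign_neg h, sign_neg (lt_of_le_of_ne (by linarith) hjl)]
  · have := key 1 (by linarith)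
    rw [sign_pos h, sign_pos (lt_of_le_of_ne (by linarith) hjl.symm)]

theorem sign_eq (hc : IsRep Q c) (hH : IsHRep Q H) (F : Flags Q) {i j : ℤ} (hi : 0 ≤ i)
    (hi' : i ≤ affDim Q) (hj : 0 ≤ j) (hj' : j ≤ affDim Q) {l : Fin d}
    (hil : c (F.nth i) l ≠ 0) (hjl : c (F.nth j) l ≠ 0) :
    SignType.sign (c (F.nth i) l) = SignType.sign (c (F.nth j) l) := by
  rcases le_total i j with h | h
  · exact F.sign_eq_of_le hc hH hi h hj' hil hjl
  · exact (F.sign_eq_of_le hc hH hj h hi' hjl hil).symm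

theorem exists_hasSign (hc : IsRep Q c) (hH : IsHRep Q H) (F : Flags Q) :
    ∃ σ, F.HasSign c σ := by
  classical
  refine ⟨fun l => if h : ∃ i, 0 ≤ i ∧ i ≤ affDim Q ∧ c (F.nth i) l ≠ 0 then
    SignType.sign (c (F.nth h.choose) l) else 0, fun i h0 h1 l hl => ?_, fun l hl => ?_⟩
  · have h : ∃ i, 0 ≤ i ∧ i ≤ affDim Q ∧ c (F.nth i) l ≠ 0 := ⟨i, h0, h1, hl⟩
    dsimp only
    rw [dif_pos h]
    obtain ⟨g0, g1, g2⟩ := h.choose_spec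
    exact F.sign_eq hc hH h0 h1 g0 g1 hl g2
  · by_contra h
    exact hl (dif_neg h)

theorem rep_mem (hc : IsRep Q c) (F : Flags Q) {i : ℤ} (h0 : 0 ≤ i) (h1 : i ≤ affDim Q) :
    c (F.nth i) ∈ F.nth i := hc.mem (F.nth_isExposed i) (F.nth_nonempty h0 h1)

/-- The representative points of a flag span the coordinate subspace of the polytope. -/
theorem map_stdVec_eq_zero (hQ : IsCoordSection J Q) (hc : IsRep Q c) (F : Flags Q)
    (g : EuclideanSpace ℝ (Fin d) →ₗ[ℝ] ℝ)
    (hg : ∀ i, 0 ≤ i → i < affDim Q → g (c (F.nth i)) = 0) {l : Fin d} (hl : l ∈ J) :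
    g (stdVec l) = 0 := by
  obtain ⟨H, hH⟩ := hQ.exists_isHRep
  have hdim : 0 ≤ affDim Q := affDim_nonneg ⟨_, hQ.zero_mem⟩
  obtain ⟨-, h2, -⟩ := F.pt_spec hc hH (i := affDim Q) (by omega) le_rfl
  rw [F.nth_top hH] at h2
  have hmem := hQ.stdVec_mem_faceSpan hH (h2 ▸ hQ.crosses_self hl)
  have hle := F.faceSpan_pt_le hc hH (affDim Q + 1).toNat (by omega)
  rw [Int.toNat_of_nonneg (by omega), add_sub_cancel_right] at hle
  have hker : Submodule.span ℝ {v | ∃ j : ℤ, 0 ≤ j ∧ j < affDim Q + 1 ∧ v = F.pt c j} ≤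
      LinearMap.ker (g ∘ₗ LinearMap.fst ℝ (EuclideanSpace ℝ (Fin d)) ℝ) := by
    rw [Submodule.span_le]
    rintro _ ⟨j, hj0, hj1, rfl⟩
    rw [F.pt_of_nonneg hj0]
    change g (c (F.nth j)) = 0
    rcases eq_or_ne j (affDim Q) with rfl | hne
    · rw [F.nth_top hH, hQ.rep_self hc, map_zero]
    · exact hg j hj0 (by omega)
  exact hker (hle hmem)

theorem exists_rep_ne_zero (hQ : IsCoordSection J Q) (hc : IsRep Q c) (F : Flags Q) {l : Fin d}
    (hl : l ∈ J) : ∃ i, 0 ≤ i ∧ i < affDim Q ∧ c (F.nth i) l ≠ 0 := by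
  by_contra! h
  have := F.map_stdVec_eq_zero hQ hc (EuclideanSpace.proj l : _ →L[ℝ] ℝ).toLinearMap
    (fun i h0 h1 => h i h0 h1) hl
  simp [stdVec_apply] at this

end Flags

end Signs

/-! ### Flags of a hyperplane section -/

section Hyperplane

variable {d : ℕ} {Q : Set (EuclideanSpace ℝ (Fin d))} {J : Set (Fin d)}
  {c : Set (EuclideanSpace ℝ (Fin d)) → EuclideanSpace ℝ (Fin d)}
  {H : Finset (EuclideanSpace ℝ (Fin d) × ℝ)} {l : Fin d}

/-- The coordinate hyperplane `x_l = 0`. -/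
def coordHyper (l : Fin d) : Set (EuclideanSpace ℝ (Fin d)) := {x | x l = 0}

theorem mem_coordHyper {x : EuclideanSpace ℝ (Fin d)} : x ∈ coordHyper l ↔ x l = 0 := Iff.rfl

/-- The inequalities of a hyperplane section. -/
noncomputable def hyperIneqs (H : Finset (EuclideanSpace ℝ (Fin d) × ℝ)) (l : Fin d) :
    Finset (EuclideanSpace ℝ (Fin d) × ℝ) :=
  open scoped Classical in insert (stdVec l, 0) (insert (-stdVec l, 0) H)

theorem mem_polyCone_hyperIneqs {p : EuclideanSpace ℝ (Fin d) × ℝ} :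
    p ∈ polyCone slack (hyperIneqs H l) ↔ p ∈ polyCone slack H ∧ p.1 l = 0 := by
  simp only [mem_polyCone, hyperIneqs, Finset.mem_insert, forall_eq_or_imp, slack_apply,
    inner_neg_right, inner_stdVec_right]
  constructor
  · rintro ⟨h1, h2, h3⟩
    exact ⟨h3, by linarith⟩
  · rintro ⟨h1, h2⟩
    exact ⟨by linarith, by linarith, h1⟩

theorem mem_faceSpan_hyperIneqs {p v : EuclideanSpace ℝ (Fin d) × ℝ} (hp : p.1 l = 0) :
    v ∈ faceSpan slack (hyperIneqs H l) p ↔ v ∈ faceSpan slack H p ∧ v.1 l = 0 := by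
  simp only [mem_faceSpan, hyperIneqs, Finset.mem_insert, forall_eq_or_imp, slack_apply,
    inner_neg_right, inner_stdVec_right, hp]
  constructor
  · rintro ⟨h1, h2, h3⟩
    exact ⟨h3, by have := h1 (by simp); linarith⟩
  · rintro ⟨h1, h2⟩
    exact ⟨fun _ => by linarith, fun _ => by linarith, h1⟩

theorem faceOf_hyperIneqs {p : EuclideanSpace ℝ (Fin d) × ℝ} (hp : p.1 l = 0) :
    faceOf (hyperIneqs H l) p = faceOf H p ∩ coordHyper l := by
  ext y
  simp only [mem_faceOf, mem_polyCone_hyperIneqs, mem_faceSpan_hyperIneqs hp, Set.mem_inter_iff,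
    mem_coordHyper]
  tauto

theorem IsHRep.inter_coordHyper (hH : IsHRep Q H) (l : Fin d) :
    IsHRep (Q ∩ coordHyper l) (hyperIneqs H l) := by
  have heq : Q ∩ coordHyper l = {x | ∀ h ∈ hyperIneqs H l, inner ℝ x h.1 ≤ h.2} := by
    ext x
    have := mem_polyCone_hyperIneqs (H := H) (l := l) (p := (x, 1))
    rw [Set.mem_inter_iff, hH.mem_iff, mem_coordHyper, ← this, mem_polyCone]
    simp [slack_apply]
  refine ⟨?_, ⟨hH.zero_mem, by simp [coordHyper]⟩, ?_, heq⟩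
  · refine hH.compact.inter_right ?_
    exact isClosed_eq (by fun_prop) continuous_const
  · simp [hyperIneqs, hH.triv_mem]

theorem IsHRep.isPolytope (hH : IsHRep Q H) : IsPolytope Q := ⟨hH.compact, H, hH.eq⟩

theorem IsCoordSection.inter_coordHyper (hQ : IsCoordSection J Q) (l : Fin d) :
    IsCoordSection (J \ {l}) (Q ∩ coordHyper l) := by
  obtain ⟨H, hH⟩ := hQ.exists_isHRep
  refine ⟨(hH.inter_coordHyper l).isPolytope, ?_, ?_, ?_⟩
  · rintro x ⟨hx, hxl⟩ j
    refine ⟨hQ.proj_mem x hx j, ?_⟩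
    rw [mem_coordHyper] at hxl ⊢
    by_cases h : l = j
    · subst h; simp [hxl]
    · simp [hxl, stdVec_apply, h]
  · rintro x ⟨hx, hxl⟩ j hj
    by_cases h : j = l
    · subst h; exact hxl
    · exact hQ.apply_eq_zero x hx j fun h' => hj ⟨h', h⟩
  · obtain ⟨ε, hε, h⟩ := hQ.exists_ball
    exact ⟨ε, hε, fun x hx hn => ⟨h x (fun j hj => hx j fun h' => hj h'.1) hn,
      hx l fun h' => h'.2 rfl⟩⟩

theorem finrank_inf_ker_add_one {V : Type*} [AddCommGroup V] [Module ℝ V] [FiniteDimensional ℝ V]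
    {S T : Submodule ℝ V} (g : V →ₗ[ℝ] ℝ) (hT : ∀ v, v ∈ T ↔ v ∈ S ∧ g v = 0) {e : V}
    (he : e ∈ S) (hge : g e ≠ 0) : Module.finrank ℝ T + 1 = Module.finrank ℝ S := by
  have hsup : T ⊔ Submodule.span ℝ {e} = S := by
    apply le_antisymm
    · refine sup_le (fun v hv => ((hT v).mp hv).1) ?_
      rwa [Submodule.span_singleton_le_iff_mem]
    · intro v hv
      have e1 : v = (v - (g v / g e) • e) + (g v / g e) • e := by abel
      rw [e1]
      refine Submodule.add_mem_sup ((hT _).mpr ⟨sub_mem hv (Submodule.smul_mem _ _ he), ?_⟩)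
        (Submodule.smul_mem _ _ (Submodule.mem_span_singleton_self e))
      simp [hge]
  have hinf : T ⊓ Submodule.span ℝ {e} = ⊥ := by
    rw [eq_bot_iff]
    rintro v ⟨hv, hv'⟩
    obtain ⟨r, rfl⟩ := Submodule.mem_span_singleton.mp hv'
    have := ((hT _).mp hv).2
    rw [map_smul, smul_eq_mul] at this
    rw [(mul_eq_zero.mp this).resolve_right hge, zero_smul]
    exact zero_mem _
  have h := Submodule.finrank_sup_add_finrank_inf_eq T (Submodule.span ℝ {e})
  have hne : e ≠ 0 := by rintro rfl; simp at hge
  rw [hsup, hinf, finrank_bot, finrank_span_singleton hne] at h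
  omega

section Rep

variable {F G A : Set (EuclideanSpace ℝ (Fin d))}

theorem IsRep.inter_eq_faceOf (hc : IsRep Q c) (hH : IsHRep Q H) (hF : IsExposed ℝ Q F)
    (hne : F.Nonempty) (h0 : c F l = 0) :
    (c F, (1 : ℝ)) ∈ polyCone slack (hyperIneqs H l) ∧
      F ∩ coordHyper l = faceOf (hyperIneqs H l) (c F, 1) := by
  obtain ⟨h1, h2⟩ := hc.eq_faceOf hH hF hne
  exact ⟨mem_polyCone_hyperIneqs.mpr ⟨h1, h0⟩, by rw [faceOf_hyperIneqs h0, ← h2]⟩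

theorem IsRep.inter_isExposed (hc : IsRep Q c) (hH : IsHRep Q H) (hF : IsExposed ℝ Q F)
    (hne : F.Nonempty) (h0 : c F l = 0) :
    IsExposed ℝ (Q ∩ coordHyper l) (F ∩ coordHyper l) := by
  obtain ⟨h1, h2⟩ := hc.inter_eq_faceOf hH hF hne h0
  rw [h2]
  exact (hH.inter_coordHyper l).isExposed_faceOf h1

theorem IsRep.mem_interior_inter (hc : IsRep Q c) (hH : IsHRep Q H) (hF : IsExposed ℝ Q F)
    (hne : F.Nonempty) (h0 : c F l = 0) : c F ∈ intrinsicInterior ℝ (F ∩ coordHyper l) := by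
  obtain ⟨h1, h2⟩ := hc.inter_eq_faceOf hH hF hne h0
  rw [h2, (hH.inter_coordHyper l).mem_intrinsicInterior_iff h1]
  exact ⟨(hH.inter_coordHyper l).mem_iff.mpr h1, rfl⟩

theorem IsRep.subset_coordHyper (hc : IsRep Q c) (hH : IsHRep Q H) (hF : IsExposed ℝ Q F)
    (h0 : c F l = 0) (hcr : ¬ Crosses F l) : F ⊆ coordHyper l := fun y hy => by
  by_contra hyl
  exact hcr (hc.crosses_of_apply_eq_zero hH hF hy hyl h0)

/-- Cutting a face by a hyperplane through its relative interior lowers its dimension by one. -/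
theorem IsRep.affDim_inter (hQ : IsCoordSection J Q) (hc : IsRep Q c) (hH : IsHRep Q H)
    (hF : IsExposed ℝ Q F) (hcr : Crosses F l) :
    affDim (F ∩ coordHyper l) = affDim F - 1 := by
  have hne : F.Nonempty := hcr.1.imp fun _ h => h.1
  have h0 := hc.apply_eq_zero F hF hne l hcr
  obtain ⟨h1, h2⟩ := hc.inter_eq_faceOf hH hF hne h0
  obtain ⟨h3, h4⟩ := hc.eq_faceOf hH hF hne
  have he := hQ.stdVec_mem_faceSpan hH (h4 ▸ hcr)
  have := finrank_inf_ker_add_one ((EuclideanSpace.proj l : _ →L[ℝ] ℝ).toLinearMap ∘ₗ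
    LinearMap.fst ℝ (EuclideanSpace ℝ (Fin d)) ℝ)
    (fun v => mem_faceSpan_hyperIneqs (H := H) (l := l) (p := (c F, 1)) h0) he
    (by simp [stdVec_apply])
  have e1 := hH.affDim_faceOf h3
  have e2 := (hH.inter_coordHyper l).affDim_faceOf h1
  rw [← h4] at e1
  rw [← h2] at e2
  omega

theorem IsCoordSection.affDim_inter (hQ : IsCoordSection J Q) (hl : l ∈ J) :
    affDim (Q ∩ coordHyper l) = affDim Q - 1 := by
  obtain ⟨H, hH⟩ := hQ.exists_isHRep
  obtain ⟨c, hc⟩ := hQ.exists_isRep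
  exact IsRep.affDim_inter hQ hc hH (IsExposed.refl Q) (hQ.crosses_self hl)

/-- `F` is the face of `Q` whose relative interior contains that of the face `A` of the section
`Q ∩ {x_l = 0}`. -/
def IsLift (Q : Set (EuclideanSpace ℝ (Fin d)))
    (c : Set (EuclideanSpace ℝ (Fin d)) → EuclideanSpace ℝ (Fin d)) (l : Fin d)
    (A F : Set (EuclideanSpace ℝ (Fin d))) : Prop :=
  IsExposed ℝ Q F ∧ F.Nonempty ∧ c F l = 0 ∧ F ∩ coordHyper l = A

theorem IsLift.subset_of_subset (hc : IsRep Q c) (hH : IsHRep Q H) {B : Set _}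
    (hF : IsLift Q c l A F) (hG : IsLift Q c l B G) (hAB : A ⊆ B) : F ⊆ G := by
  obtain ⟨hF1, hF2, hF3, rfl⟩ := hF
  obtain ⟨hG1, hG2, hG3, rfl⟩ := hG
  have hmem : c F ∈ G := (hAB ⟨hc.mem hF1 hF2, hF3⟩).1
  obtain ⟨h1, h2⟩ := hc.eq_faceOf hH hF1 hF2
  obtain ⟨h3, h4⟩ := hc.eq_faceOf hH hG1 hG2
  rw [h2, h4, hH.faceOf_subset_iff h1]
  rw [h4] at hmem
  exact hmem.2

theorem IsLift.unique (hc : IsRep Q c) (hH : IsHRep Q H) (hF : IsLift Q c l A F)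
    (hG : IsLift Q c l A G) : F = G :=
  (hF.subset_of_subset hc hH hG subset_rfl).antisymm (hG.subset_of_subset hc hH hF subset_rfl)

theorem exists_isLift (hc : IsRep Q c) (hH : IsHRep Q H)
    (hA : IsExposed ℝ (Q ∩ coordHyper l) A) (hne : A.Nonempty) : ∃ F, IsLift Q c l A F := by
  have hH' := hH.inter_coordHyper l
  obtain ⟨p, hp, rfl⟩ := hH'.exists_faceOf hA
  obtain ⟨x, hx, hpx⟩ := hH'.exists_point hp ((hH'.faceOf_nonempty_iff hp).mp hne)
  have hxQ := hH'.faceOf_subset p hx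
  have hxK := hH'.mem_iff.mp hxQ
  rw [(hH'.faceOf_eq_iff hp hxK).mpr hpx]
  have hxl : x l = 0 := hxQ.2
  have hK := hH.mem_iff.mp hxQ.1
  have hF : IsExposed ℝ Q (faceOf H (x, 1)) := hH.isExposed_faceOf hK
  have hxF := hH.self_mem_faceOf hxQ.1
  refine ⟨faceOf H (x, 1), hF, ⟨x, hxF⟩, ?_, (faceOf_hyperIneqs (p := (x, 1)) hxl).symm⟩
  by_contra h0
  have hpos : 0 < c (faceOf H (x, 1)) l * c (faceOf H (x, 1)) l := mul_self_pos.mpr h0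
  obtain ⟨h1, y, hy, h2⟩ := (hc.pos_iff hH hF ⟨x, hxF⟩).mp hpos
  have := hH.pos_of_nonneg hF ((hH.mem_intrinsicInterior_iff hK).mpr ⟨hxQ.1, rfl⟩) h1 hy h2
  rw [hxl, mul_zero] at this
  exact this.false

/-- The representative points of the faces of the section `Q ∩ {x_l = 0}` inherited from `Q`. -/
noncomputable def sectionRep (Q : Set (EuclideanSpace ℝ (Fin d)))
    (c : Set (EuclideanSpace ℝ (Fin d)) → EuclideanSpace ℝ (Fin d)) (l : Fin d)
    (A : Set (EuclideanSpace ℝ (Fin d))) : EuclideanSpace ℝ (Fin d) :=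
  open scoped Classical in if h : ∃ F, IsLift Q c l A F then c h.choose else 0

theorem IsLift.sectionRep_eq (hc : IsRep Q c) (hH : IsHRep Q H) (hF : IsLift Q c l A F) :
    sectionRep Q c l A = c F := by
  have h : ∃ F, IsLift Q c l A F := ⟨F, hF⟩
  rw [sectionRep, dif_pos h, h.choose_spec.unique hc hH hF]

theorem IsRep.sectionRep (hc : IsRep Q c) (hH : IsHRep Q H) (l : Fin d) :
    IsRep (Q ∩ coordHyper l) (sectionRep Q c l) := by
  refine ⟨fun A hA hne => ?_, fun A hA hne j hj => ?_⟩
  · obtain ⟨F, hF⟩ := exists_isLift hc hH hA hne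
    rw [hF.sectionRep_eq hc hH]
    obtain ⟨h1, h2, h3, rfl⟩ := hF
    exact hc.mem_interior_inter hH h1 h2 h3
  · obtain ⟨F, hF⟩ := exists_isLift hc hH hA hne
    rw [hF.sectionRep_eq hc hH]
    obtain ⟨h1, h2, h3, rfl⟩ := hF
    exact hc.apply_eq_zero F h1 h2 j (hj.mono Set.inter_subset_left)

end Rep

end Hyperplane

/-! ### Extending flags from a hyperplane section -/

section Extension

variable {d : ℕ} {Q : Set (EuclideanSpace ℝ (Fin d))} {J : Set (Fin d)}
  {c : Set (EuclideanSpace ℝ (Fin d)) → EuclideanSpace ℝ (Fin d)}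
  {H : Finset (EuclideanSpace ℝ (Fin d) × ℝ)} {l : Fin d}

namespace Flags

/-- The face at level `m` is the only one of the flag at which coordinate `l` has a nonzero sign. -/
def OnlyAt (c : Set (EuclideanSpace ℝ (Fin d)) → EuclideanSpace ℝ (Fin d)) (l : Fin d)
    (F : Flags Q) (m : ℤ) : Prop :=
  0 ≤ m ∧ m ≤ affDim Q ∧ ∀ i, 0 ≤ i → i ≤ affDim Q → (c (F.nth i) l ≠ 0 ↔ i = m)

namespace OnlyAt

variable {F : Flags Q} {m : ℤ}

theorem rep_ne_zero (h : F.OnlyAt c l m) : c (F.nth m) l ≠ 0 := (h.2.2 m h.1 h.2.1).mpr rfl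

theorem rep_eq_zero (h : F.OnlyAt c l m) {i : ℤ} (h0 : 0 ≤ i) (h1 : i ≤ affDim Q) (hi : i ≠ m) :
    c (F.nth i) l = 0 := by
  by_contra hne
  exact hi ((h.2.2 i h0 h1).mp hne)

theorem lt (hQ : IsCoordSection J Q) (hc : IsRep Q c) (h : F.OnlyAt c l m) : m < affDim Q := by
  obtain ⟨H, hH⟩ := hQ.exists_isHRep
  refine lt_of_le_of_ne h.2.1 fun he => h.rep_ne_zero ?_
  rw [he, F.nth_top hH, hQ.rep_self hc]
  rfl

theorem subset_coordHyper (hc : IsRep Q c) (hH : IsHRep Q H) (h : F.OnlyAt c l m) {i : ℤ}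
    (hi : i < m) : F.nth i ⊆ coordHyper l := by
  by_cases h0 : i < 0
  · rw [F.nth_of_neg h0]; exact Set.empty_subset _
  have h1 := h.2.1
  refine hc.subset_coordHyper hH (F.nth_isExposed i)
    (h.rep_eq_zero (by omega) (by omega) hi.ne) fun hcr => h.rep_ne_zero ?_
  exact hc.apply_eq_zero _ (F.nth_isExposed m) (F.nth_nonempty h.1 h1) l
    (hcr.mono (F.nth_mono hi.le h1))

theorem crosses (hc : IsRep Q c) (hH : IsHRep Q H) (h : F.OnlyAt c l m) {i : ℤ}
    (hi : m < i) (h1 : i ≤ affDim Q) : Crosses (F.nth i) l :=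
  hc.crosses_of_apply_eq_zero hH (F.nth_isExposed i)
    (F.nth_mono hi.le h1 (F.rep_mem hc h.1 h.2.1)) h.rep_ne_zero
    (h.rep_eq_zero (by have := h.1; omega) h1 hi.ne')

/-- Different coordinates cannot both have a nonzero sign at one and the same face of a flag only.
-/
theorem coord_unique (hQ : IsCoordSection J Q) (hc : IsRep Q c) {j : Fin d}
    (hlJ : l ∈ J) (hl : F.OnlyAt c l m) (hj : F.OnlyAt c j m) : j = l := by
  by_contra hjl
  have := F.map_stdVec_eq_zero hQ hc
    ((c (F.nth m) j) • (EuclideanSpace.proj l : EuclideanSpace ℝ (Fin d) →L[ℝ] ℝ) -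
      (c (F.nth m) l) • (EuclideanSpace.proj j : EuclideanSpace ℝ (Fin d) →L[ℝ] ℝ)).toLinearMap
    (fun i h0 h1 => by
      by_cases he : i = m
      · subst he; simp; ring
      · simp [hl.rep_eq_zero h0 h1.le he, hj.rep_eq_zero h0 h1.le he]) hlJ
  simp [stdVec_apply, hjl] at this
  exact hj.rep_ne_zero this

end OnlyAt

/-- The flag `F` of `Q` arises from the flag `G` of the section `Q ∩ {x_l = 0}` by extending the
faces of `G` to faces of `Q` and inserting one new face at level `m`. -/
structure IsExtension (c : Set (EuclideanSpace ℝ (Fin d)) → EuclideanSpace ℝ (Fin d)) (l : Fin d)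
    (G : Flags (Q ∩ coordHyper l)) (F : Flags Q) (m : ℤ) : Prop where
  onlyAt : F.OnlyAt c l m
  nth_lower : ∀ i < m, G.nth i = F.nth i
  nth_upper : ∀ i, m ≤ i → i < affDim Q → G.nth i = F.nth (i + 1) ∩ coordHyper l

namespace IsExtension

variable {G : Flags (Q ∩ coordHyper l)} {F : Flags Q} {m : ℤ}

theorem isLift_lower (hc : IsRep Q c) (hH : IsHRep Q H) (h : IsExtension c l G F m) {i : ℤ}
    (h0 : 0 ≤ i) (hi : i < m) : IsLift Q c l (G.nth i) (F.nth i) := by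
  have h1 := h.onlyAt.2.1
  refine ⟨F.nth_isExposed i, F.nth_nonempty h0 (by omega),
    h.onlyAt.rep_eq_zero h0 (by omega) hi.ne, ?_⟩
  rw [h.nth_lower i hi, Set.inter_eq_left]
  exact h.onlyAt.subset_coordHyper hc hH hi

theorem isLift_upper (h : IsExtension c l G F m) {i : ℤ} (hi : m ≤ i) (h1 : i < affDim Q) :
    IsLift Q c l (G.nth i) (F.nth (i + 1)) := by
  have h0 := h.onlyAt.1
  exact ⟨F.nth_isExposed _, F.nth_nonempty (by omega) (by omega),
    h.onlyAt.rep_eq_zero (by omega) (by omega) (by omega), (h.nth_upper i hi h1).symm⟩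

theorem rep_lower (hc : IsRep Q c) (hH : IsHRep Q H) (h : IsExtension c l G F m) {i : ℤ}
    (h0 : 0 ≤ i) (hi : i < m) : sectionRep Q c l (G.nth i) = c (F.nth i) :=
  (h.isLift_lower hc hH h0 hi).sectionRep_eq hc hH

theorem rep_upper (hc : IsRep Q c) (hH : IsHRep Q H) (h : IsExtension c l G F m) {i : ℤ}
    (hi : m ≤ i) (h1 : i < affDim Q) : sectionRep Q c l (G.nth i) = c (F.nth (i + 1)) :=
  (h.isLift_upper hi h1).sectionRep_eq hc hH

/-- The section of a flag is determined by the flag. -/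
theorem section_unique (hQ : IsCoordSection J Q) (hl : l ∈ J)
    {G' : Flags (Q ∩ coordHyper l)} (h : IsExtension c l G F m) {m' : ℤ}
    (h' : IsExtension c l G' F m') : G = G' := by
  obtain ⟨H, hH⟩ := hQ.exists_isHRep
  obtain rfl : m = m' := by
    have := h.onlyAt
    exact (h'.onlyAt.2.2 m this.1 this.2.1).mp this.rep_ne_zero
  have hdim := hQ.affDim_inter hl
  refine ext_nth (hH.inter_coordHyper l) fun i h0 h1 => ?_
  by_cases hi : i < m
  · rw [h.nth_lower i hi, h'.nth_lower i hi]
  · rw [h.nth_upper i (by omega) (by omega), h'.nth_upper i (by omega) (by omega)]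

/-- A flag of `Q` that extends a given flag of the section is determined by the side of the
hyperplane on which the inserted face lies. -/
theorem unique (hc : IsRep Q c) (hH : IsHRep Q H) (hm : m < affDim Q) (h : IsExtension c l G F m)
    {F' : Flags Q} {m' : ℤ} (hm' : m' < affDim Q) (h' : IsExtension c l G F' m')
    (hs : SignType.sign (c (F.nth m) l) = SignType.sign (c (F'.nth m') l)) : F = F' := by
  -- If the levels of insertion differ, a face of `G` has two lifts of different dimension.
  have key : ∀ {F F' : Flags Q} {m m' : ℤ}, m < affDim Q → m' < affDim Q →
      IsExtension c l G F m → IsExtension c l G F' m' → ¬ m < m' := by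
    intro F F' m m' hm hm' h h' hlt
    have heq := (h.isLift_upper le_rfl hm).unique hc hH (h'.isLift_lower hc hH h.onlyAt.1 hlt)
    have hd := congrArg affDim heq
    have := h.onlyAt.1
    rw [F.affDim_nth (by omega) (by omega), F'.affDim_nth (by omega) (by omega)] at hd
    omega
  obtain rfl : m = m' :=
    le_antisymm (not_lt.mp (key hm' hm h' h)) (not_lt.mp (key hm hm' h h'))
  have h0 := h.onlyAt.1
  by_contra hne
  have hadj : AdjAt m F F' := by
    refine ⟨hne, fun j hj => ?_⟩
    by_cases hj0 : j < 0
    · rw [F.nth_of_neg hj0, F'.nth_of_neg hj0]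
    by_cases hj1 : affDim Q < j
    · rw [nth, nth, dif_neg (fun h => by have := h.2; omega),
        dif_neg (fun h => by have := h.2; omega)]
    rcases lt_or_gt_of_ne hj with hlt | hlt
    · rw [← h.nth_lower j hlt, h'.nth_lower j hlt]
    · have h1 := h.isLift_upper (i := j - 1) (by omega) (by omega)
      have h2 := h'.isLift_upper (i := j - 1) (by omega) (by omega)
      have := h1.unique hc hH h2
      rwa [sub_add_cancel] at this
  obtain ⟨α, hα, hop⟩ := hadj.opposite hc hH h0 hm
    (EuclideanSpace.proj l : _ →L[ℝ] ℝ).toLinearMap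
    (fun j hj0 hj1 hj => h.onlyAt.rep_eq_zero hj0 hj1 hj)
  have hop' : c (F'.nth m) l = -(α * c (F.nth m) l) := hop
  have hz := h.onlyAt.rep_ne_zero
  rcases hz.lt_or_gt with hz | hz
  · rw [sign_neg hz, hop', sign_pos (by nlinarith)] at hs
    exact absurd hs (by decide)
  · rw [sign_pos hz, hop', sign_neg (by nlinarith)] at hs
    exact absurd hs (by decide)

/-- The sign of an extension differs from that of the section in the coordinate `l` only. -/
theorem hasSign_iff (hQ : IsCoordSection J Q) (hc : IsRep Q c) (hl : l ∈ J)
    (h : IsExtension c l G F m) {σ : Fin d → SignType}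
    (hσ : SignType.sign (c (F.nth m) l) = σ l) :
    F.HasSign c σ ↔ G.HasSign (sectionRep Q c l) (Function.update σ l 0) := by
  classical
  obtain ⟨H, hH⟩ := hQ.exists_isHRep
  have hm := h.onlyAt.lt hQ hc
  have h0 := h.onlyAt.1
  have hdim := hQ.affDim_inter hl
  have hlow := fun i h0 hi => h.rep_lower hc hH (i := i) h0 hi
  have hupp := fun i h0 hi => h.rep_upper hc hH (i := i) h0 hi
  constructor
  · rintro ⟨h1, h2⟩
    refine ⟨fun i hi0 hi1 j hj => ?_, fun j hj => ?_⟩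
    · obtain ⟨i', hi0', hi1', hne, he⟩ : ∃ i', 0 ≤ i' ∧ i' ≤ affDim Q ∧ i' ≠ m ∧
          sectionRep Q c l (G.nth i) = c (F.nth i') := by
        by_cases hi : i < m
        · exact ⟨i, hi0, by omega, by omega, hlow i hi0 hi⟩
        · exact ⟨i + 1, by omega, by omega, by omega, hupp i (by omega) (by omega)⟩
      rw [he] at hj ⊢
      have hjl : j ≠ l := by
        rintro rfl; exact hj (h.onlyAt.rep_eq_zero hi0' hi1' hne)
      rw [Function.update_of_ne hjl]
      exact h1 i' hi0' hi1' j hj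
    · have hjl : j ≠ l := by
        rintro rfl; simp at hj
      rw [Function.update_of_ne hjl] at hj
      by_contra! hno
      have hzero : ∀ i, 0 ≤ i → i ≤ affDim Q → i ≠ m → c (F.nth i) j = 0 := by
        intro i hi0 hi1 hi
        rcases lt_or_gt_of_ne hi with hlt | hlt
        · rw [← hlow i hi0 hlt]; exact hno i hi0 (by omega)
        · have := hupp (i - 1) (by omega) (by omega)
          rw [sub_add_cancel] at this
          rw [← this]; exact hno (i - 1) (by omega) (by omega)
      obtain ⟨i, hi0, hi1, hi⟩ := h2 j hj
      have him : i = m := by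
        by_contra hne; exact hi (hzero i hi0 hi1 hne)
      subst him
      refine hjl (h.onlyAt.coord_unique hQ hc hl ⟨hi0, hi1, fun i' hi0' hi1' => ?_⟩)
      constructor
      · intro hne
        by_contra he
        exact hne (hzero i' hi0' hi1' he)
      · rintro rfl
        exact hi
  · rintro ⟨h1, h2⟩
    have hother : ∀ i, 0 ≤ i → i ≤ affDim Q → i ≠ m → ∀ j, c (F.nth i) j ≠ 0 →
        SignType.sign (c (F.nth i) j) = σ j := by
      intro i hi0 hi1 hi j hj
      have hjl : j ≠ l := by
        rintro rfl; exact hj (h.onlyAt.rep_eq_zero hi0 hi1 hi)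
      rcases lt_or_gt_of_ne hi with hlt | hlt
      · rw [← hlow i hi0 hlt] at hj ⊢
        rw [h1 i hi0 (by omega) j hj, Function.update_of_ne hjl]
      · have he := hupp (i - 1) (by omega) (by omega)
        rw [sub_add_cancel] at he
        rw [← he] at hj ⊢
        rw [h1 (i - 1) (by omega) (by omega) j hj, Function.update_of_ne hjl]
    refine ⟨fun i hi0 hi1 j hj => ?_, fun j hj => ?_⟩
    · by_cases hi : i = m
      · by_cases hjl : j = l
        · rw [hi, hjl, hσ]
        have hjJ : j ∈ J := by
          by_contra hjJ
          exact hj (hQ.apply_eq_zero _ ((F.nth_isExposed i).subset (F.rep_mem hc hi0 hi1)) j hjJ)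
        obtain ⟨i', hi0', hi1', hi'⟩ := G.exists_rep_ne_zero (hQ.inter_coordHyper l)
          (hc.sectionRep hH l) (show j ∈ J \ {l} from ⟨hjJ, hjl⟩)
        obtain ⟨i'', hi0'', hi1'', hne, he⟩ : ∃ i'', 0 ≤ i'' ∧ i'' ≤ affDim Q ∧ i'' ≠ m ∧
            c (F.nth i'') j ≠ 0 := by
          by_cases hlt : i' < m
          · exact ⟨i', hi0', by omega, by omega, by rwa [← hlow i' hi0' hlt]⟩
          · exact ⟨i' + 1, by omega, by omega, by omega,
              by rwa [← hupp i' (by omega) (by omega)]⟩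
        rw [F.sign_eq hc hH hi0 hi1 hi0'' hi1'' hj he]
        exact hother i'' hi0'' hi1'' hne j he
      · exact hother i hi0 hi1 hi j hj
    · by_cases hjl : j = l
      · exact ⟨m, h0, by omega, hjl ▸ h.onlyAt.rep_ne_zero⟩
      · obtain ⟨i, hi0, hi1, hi⟩ := h2 j (by rwa [Function.update_of_ne hjl])
        by_cases hlt : i < m
        · exact ⟨i, hi0, by omega, by rwa [← hlow i hi0 hlt]⟩
        · exact ⟨i + 1, by omega, by omega, by rwa [← hupp i (by omega) (by omega)]⟩

end IsExtension

/-- A flag with only one face at which coordinate `l` has a nonzero sign is the extension of a flag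
of the section. -/
theorem OnlyAt.exists_section (hQ : IsCoordSection J Q) (hc : IsRep Q c) (hl : l ∈ J)
    {F : Flags Q} {m : ℤ} (h : F.OnlyAt c l m) : ∃ G, IsExtension c l G F m := by
  obtain ⟨H, hH⟩ := hQ.exists_isHRep
  have hm := h.lt hQ hc
  have h0 := h.1
  have hdim := hQ.affDim_inter hl
  have hz : ∀ i, m ≤ i → i < affDim Q → c (F.nth (i + 1)) l = 0 := fun i h1 h2 =>
    h.rep_eq_zero (by omega) (by omega) (by omega)
  refine ⟨ofFun (fun i => if i < m then F.nth i else F.nth (i + 1) ∩ coordHyper l) ?_ ?_ ?_,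
    h, ?_, ?_⟩
  · intro i h1 h2
    split_ifs with hi
    · exact (F.nth_isExposed i).mono Set.inter_subset_left
        (Set.subset_inter (F.nth_isExposed i).subset (h.subset_coordHyper hc hH hi))
    · exact hc.inter_isExposed hH (F.nth_isExposed _) (F.nth_nonempty (by omega) (by omega))
        (hz i (by omega) (by omega))
  · intro i h1 h2
    split_ifs with hi
    · exact F.affDim_nth h1 (by omega)
    · rw [IsRep.affDim_inter hQ hc hH (F.nth_isExposed _) (h.crosses hc hH (by omega) (by omega)),
        F.affDim_nth (by omega) (by omega), add_sub_cancel_right]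
  · intro i h1 h2
    split_ifs with hi hi' hi'
    · exact F.nth_mono (by omega) (by omega)
    · exact Set.subset_inter (F.nth_mono (by omega) (by omega)) (h.subset_coordHyper hc hH hi)
    · omega
    · exact Set.inter_subset_inter_left _ (F.nth_mono (by omega) (by omega))
  · intro i hi
    by_cases h1 : -1 ≤ i
    · rw [nth_ofFun h1 (by omega), if_pos hi]
    · rw [nth_of_neg _ (by omega), nth_of_neg _ (by omega)]
  · intro i h1 h2
    rw [nth_ofFun (by omega) (by omega), if_neg (by omega)]

/-- Every flag of the section extends to a flag of `Q` whose inserted face lies on a prescribed side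
of the hyperplane. -/
theorem exists_extension (hQ : IsCoordSection J Q) (hc : IsRep Q c) (hl : l ∈ J)
    (G : Flags (Q ∩ coordHyper l)) {r : ℝ} (hr : r ≠ 0) :
    ∃ F m, IsExtension c l G F m ∧ SignType.sign (c (F.nth m) l) = SignType.sign r := by
  classical
  obtain ⟨H, hH⟩ := hQ.exists_isHRep
  have hdim := hQ.affDim_inter hl
  have hQ' := hQ.inter_coordHyper l
  have hH' := hH.inter_coordHyper l
  have hk : 0 ≤ affDim (Q ∩ coordHyper l) := affDim_nonneg ⟨_, hQ'.zero_mem⟩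
  set k := affDim (Q ∩ coordHyper l) with hkdef
  have hlift : ∀ i, 0 ≤ i ∧ i ≤ k → ∃ L, IsLift Q c l (G.nth i) L := fun i hi =>
    exists_isLift hc hH (G.nth_isExposed i) (G.nth_nonempty hi.1 hi.2)
  choose! L hL using hlift
  have hLexp := fun i hi => (hL i hi).1
  have hLne := fun i hi => (hL i hi).2.1
  have hL0 := fun i hi => (hL i hi).2.2.1
  have hLmono : ∀ i j, 0 ≤ i → i ≤ j → j ≤ k → L i ⊆ L j := fun i j h0 hij hj =>
    (hL i ⟨h0, by omega⟩).subset_of_subset hc hH (hL j ⟨by omega, hj⟩) (G.nth_mono hij hj)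
  -- The level of insertion: the first lift that leaves the hyperplane.
  have htop : Crosses (L (k.toNat : ℕ)) l := by
    rw [Int.toNat_of_nonneg hk]
    have : IsLift Q c l (G.nth k) Q := ⟨IsExposed.refl Q, ⟨0, hQ.zero_mem⟩,
      by rw [hQ.rep_self hc]; rfl, (G.nth_top hH').symm⟩
    rw [(hL k ⟨hk, le_rfl⟩).unique hc hH this]
    exact hQ.crosses_self hl
  have hex : ∃ n : ℕ, Crosses (L n) l := ⟨k.toNat, htop⟩
  obtain ⟨m, hm, hmin⟩ : ∃ m : ℕ, Crosses (L m) l ∧ ∀ n : ℕ, n < m → ¬ Crosses (L n) l :=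
    ⟨Nat.find hex, Nat.find_spec hex, fun n hn => Nat.find_min hex hn⟩
  have hmk : (m : ℤ) ≤ k := by
    by_contra hlt
    exact hmin k.toNat (by omega) htop
  have hlowH : ∀ i : ℤ, 0 ≤ i → i < m → L i ⊆ coordHyper l := by
    intro i h0 h1
    refine hc.subset_coordHyper hH (hLexp i ⟨h0, by omega⟩) (hL0 i ⟨h0, by omega⟩) ?_
    have := hmin i.toNat (by omega)
    rwa [Int.toNat_of_nonneg h0] at this
  have hlow : ∀ i : ℤ, 0 ≤ i → i < m → L i = G.nth i := by
    intro i h0 h1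
    have := (hL i ⟨h0, by omega⟩).2.2.2
    rwa [Set.inter_eq_left.mpr (hlowH i h0 h1)] at this
  have hcross : ∀ i : ℤ, m ≤ i → i ≤ k → Crosses (L i) l := fun i h1 h2 =>
    hm.mono (hLmono m i (by omega) h1 h2)
  have hLdim : ∀ i : ℤ, m ≤ i → i ≤ k → affDim (L i) = i + 1 := by
    intro i h1 h2
    have := IsRep.affDim_inter hQ hc hH (hLexp i ⟨by omega, h2⟩) (hcross i h1 h2)
    rw [(hL i ⟨by omega, h2⟩).2.2.2, G.affDim_nth (by omega) h2] at this
    omega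
  -- The homogeneous points of the faces below and above the inserted face.
  obtain ⟨hu, hLm⟩ := hc.eq_faceOf hH (hLexp m ⟨by omega, hmk⟩) (hLne m ⟨by omega, hmk⟩)
  have hul := hL0 m ⟨by omega, hmk⟩
  set u : EuclideanSpace ℝ (Fin d) × ℝ := (c (L m), 1) with hudef
  have he : (stdVec l, (0 : ℝ)) ∈ faceSpan slack H u :=
    hQ.stdVec_mem_faceSpan hH (hLm ▸ hm)
  have hru : (Module.finrank ℝ (faceSpan slack H u) : ℤ) = m + 2 := by
    have := hH.affDim_faceOf hu
    rw [← hLm, hLdim m le_rfl hmk] at this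
    omega
  obtain ⟨a, ha, hal, haG, hra⟩ : ∃ a ∈ polyCone slack H, a.1 l = 0 ∧
      faceOf H a = G.nth ((m : ℤ) - 1) ∧ (Module.finrank ℝ (faceSpan slack H a) : ℤ) = m := by
    by_cases h0 : m = 0
    · refine ⟨0, zero_mem_polyCone, rfl, ?_, ?_⟩
      · rw [hH.faceOf_zero, G.nth_of_neg (by omega)]
      · rw [hH.faceSpan_zero, finrank_bot, h0]
    · have hi : 0 ≤ (m : ℤ) - 1 ∧ (m : ℤ) - 1 ≤ k := ⟨by omega, by omega⟩
      obtain ⟨h1, h2⟩ := hc.eq_faceOf hH (hLexp _ hi) (hLne _ hi)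
      have h3 := hlow _ hi.1 (by omega)
      refine ⟨_, h1, hL0 _ hi, by rw [← h2, h3], ?_⟩
      have := (congrArg affDim (h2.symm.trans h3)).symm.trans (hH.affDim_faceOf h1)
      rw [G.affDim_nth (by omega) hi.2] at this
      omega
  have haH : faceOf H a ⊆ coordHyper l := by
    rw [haG]
    exact (G.nth_isExposed _).subset.trans Set.inter_subset_right
  have hau : a ∈ faceSpan slack H u := by
    rw [← hH.faceOf_subset_iff ha, ← hLm, haG]
    refine (G.nth_mono (by omega) hmk).trans ?_
    rw [← (hL m ⟨by omega, hmk⟩).2.2.2]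
    exact Set.inter_subset_left
  obtain ⟨t, N, hq, haq, huq⟩ := exists_wedge ha hu (fun h => by
      have := Submodule.finrank_mono (faceSpan_le_iff.mpr h); omega)
    (w := r • (stdVec l, (0 : ℝ))) (fun i hi h0 => by
      rw [map_smul, he i hi h0, smul_zero])
  set q := r • (stdVec l, (0 : ℝ)) - t • u + N • a with hqdef
  have hql : q.1 l = r := by
    simp [hqdef, hudef, hul, hal, stdVec_apply]
  have hq0 : q ≠ 0 := by
    intro h; rw [h] at hql; exact hr hql.symm
  have hqu : q ∈ faceSpan slack H u :=
    add_mem (sub_mem (Submodule.smul_mem _ _ he) (Submodule.smul_mem _ _ (self_mem_faceSpan u)))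
      (Submodule.smul_mem _ _ hau)
  obtain ⟨y, hyQ, hqy, hq2⟩ := hH.exists_eq_smul hq hq0
  have hyA : y ∈ faceOf H q := by
    have : faceSpan slack H q = faceSpan slack H (y, 1) := by
      rw [hqy]; exact faceSpan_smul hq2.ne'
    exact ⟨hH.mem_iff.mp hyQ, this ▸ self_mem_faceSpan _⟩
  have hyr : 0 < r * y l := by
    have h1 : q.1 l = q.2 * y l := by
      conv_lhs => rw [hqy]
      simp
    rw [hql] at h1
    have h2 : 0 < r * r := mul_self_pos.mpr hr
    have h3 : r * r = q.2 * (r * y l) := by linear_combination r * h1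
    rw [h3] at h2
    exact pos_of_mul_pos_right h2 hq2.le
  have hrq : (Module.finrank ℝ (faceSpan slack H q) : ℤ) = m + 1 := by
    have lt1 : faceSpan slack H a < faceSpan slack H q :=
      lt_of_le_of_ne (faceSpan_le_iff.mpr haq) fun h => by
        have h1 : faceOf H a = faceOf H q := (hH.faceOf_eq_iff ha hq).mpr h
        have h2 : y l = 0 := haH (h1 ▸ hyA)
        rw [h2, mul_zero] at hyr
        exact hyr.false
    have lt2 : faceSpan slack H q < faceSpan slack H u :=
      lt_of_le_of_ne (faceSpan_le_iff.mpr hqu) fun h => huq (h ▸ self_mem_faceSpan u)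
    have := Submodule.finrank_lt_finrank_of_lt lt1
    have := Submodule.finrank_lt_finrank_of_lt lt2
    omega
  have hA : IsExposed ℝ Q (faceOf H q) := hH.isExposed_faceOf hq
  have hAne : (faceOf H q).Nonempty := ⟨y, hyA⟩
  have hAdim : affDim (faceOf H q) = m := by rw [hH.affDim_faceOf hq]; omega
  have haA : faceOf H a ⊆ faceOf H q := (hH.faceOf_subset_iff ha).mpr haq
  -- The new face cannot cross the hyperplane: it would be a lift of the face below it.
  have hnc : ¬ Crosses (faceOf H q) l := by
    intro hcr
    have h0 := hc.apply_eq_zero _ hA hAne l hcr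
    have h1 := IsRep.affDim_inter hQ hc hH hA hcr
    have h2 : faceOf H a = faceOf H q ∩ coordHyper l := by
      refine hH'.eq_of_subset_of_affDim ?_ (hc.inter_isExposed hH hA hAne h0)
        (Set.subset_inter haA haH) ?_
      · rw [haG]; exact G.nth_isExposed _
      · rw [h1, hAdim, haG, G.affDim_nth (by omega) (by omega)]
    have h3 : (0 : ℤ) ≤ affDim (faceOf H q ∩ coordHyper l) :=
      affDim_nonneg ⟨_, hc.mem hA hAne, h0⟩
    have hi : 0 ≤ (m : ℤ) - 1 ∧ (m : ℤ) - 1 ≤ k := ⟨by omega, by omega⟩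
    have h4 : IsLift Q c l (G.nth ((m : ℤ) - 1)) (faceOf H q) :=
      ⟨hA, hAne, h0, by rw [← h2, haG]⟩
    have h5 := (hL _ hi).unique hc hH h4
    rw [hlow _ hi.1 (by omega)] at h5
    have h6 := congrArg affDim h5
    rw [G.affDim_nth (by omega) hi.2, hAdim] at h6
    omega
  have hcA : 0 < r * c (faceOf H q) l := by
    refine (hc.pos_iff hH hA hAne).mpr ⟨fun z hz => ?_, y, hyA, hyr⟩
    by_contra hlt
    push Not at hlt
    rcases hr.lt_or_gt with hr | hr
    · exact hnc ⟨⟨z, hz, by nlinarith⟩, y, hyA, by nlinarith⟩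
    · exact hnc ⟨⟨y, hyA, by nlinarith⟩, z, hz, by nlinarith⟩
  have hcA0 : c (faceOf H q) l ≠ 0 := by
    intro h; rw [h, mul_zero] at hcA; exact hcA.false
  set f : ℤ → Set (EuclideanSpace ℝ (Fin d)) := fun i =>
    if i < m then G.nth i else if i = m then faceOf H q else L (i - 1) with hf
  have fl : ∀ i : ℤ, i < m → f i = G.nth i := fun i hi => if_pos hi
  have fm : f m = faceOf H q := by simp [hf]
  have fu : ∀ i : ℤ, m < i → f i = L (i - 1) := fun i hi => by
    rw [hf]; dsimp only; rw [if_neg (by omega), if_neg (by omega)]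
  have hcases : ∀ i : ℤ, i < m ∨ i = m ∨ m < i := fun i => lt_trichotomy i m
  obtain ⟨F, hF⟩ : ∃ F : Flags Q, ∀ i, -1 ≤ i → i ≤ affDim Q → F.nth i = f i := by
    refine ⟨ofFun f ?_ ?_ ?_, fun i h1 h2 => nth_ofFun h1 h2⟩
    · intro i h1 h2
      rcases hcases i with hi | rfl | hi
      · rw [fl i hi]
        by_cases h0 : i < 0
        · rw [G.nth_of_neg h0]; exact isExposed_empty
        · rw [← hlow i (by omega) hi]; exact hLexp i ⟨by omega, by omega⟩
      · rw [fm]; exact hA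
      · rw [fu i hi]; exact hLexp _ ⟨by omega, by omega⟩
    · intro i h1 h2
      rcases hcases i with hi | rfl | hi
      · rw [fl i hi]; exact G.affDim_nth h1 (by omega)
      · rw [fm]; exact hAdim
      · rw [fu i hi, hLdim _ (by omega) (by omega), sub_add_cancel]
    · intro i h1 h2
      rcases hcases i with hi | rfl | hi
      · rw [fl i hi]
        rcases hcases (i + 1) with hi' | hi' | hi'
        · rw [fl _ hi']; exact G.nth_mono (by omega) (by omega)
        · rw [hi', fm]
          obtain rfl : i = (m : ℤ) - 1 := by omega
          rw [← haG]; exact haA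
        · omega
      · rw [fm, fu _ (by omega), add_sub_cancel_right, hLm]
        exact (hH.faceOf_subset_iff hq).mpr hqu
      · rw [fu _ hi, fu _ (by omega)]
        exact hLmono _ _ (by omega) (by omega) (by omega)
  refine ⟨F, m, ⟨⟨by omega, by omega, fun i h0 h1 => ?_⟩, fun i hi => ?_, fun i h1 h2 => ?_⟩, ?_⟩
  · rw [hF i (by omega) h1]
    rcases hcases i with hi | rfl | hi
    · rw [fl i hi, ← hlow i h0 hi]
      simp [hL0 i ⟨h0, by omega⟩, hi.ne]
    · rw [fm]; simp [hcA0]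
    · rw [fu i hi]
      simp [hL0 (i - 1) ⟨by omega, by omega⟩, hi.ne']
  · by_cases h0 : i < 0
    · rw [nth_of_neg _ h0, nth_of_neg _ h0]
    · rw [hF i (by omega) (by omega), fl i hi]
  · rw [hF _ (by omega) (by omega), fu _ (by omega), add_sub_cancel_right]
    exact (hL i ⟨by omega, by omega⟩).2.2.2.symm
  · rw [hF _ (by omega) (by omega), fm]
    rcases hr.lt_or_gt with hr | hr
    · rw [sign_neg hr, sign_neg (by nlinarith)]
    · rw [sign_pos hr, sign_pos (by nlinarith)]

end Flags

end Extension

/-! ### Determinants of interval matrices -/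

section IntervalMatrix

/-- The vector `v` is constant, with value `1` or `-1`, on an interval and zero elsewhere. -/
def IsIntervalVec {n : ℕ} (v : Fin n → ℝ) : Prop :=
  ∃ (s : ℝ) (a b : ℕ), |s| = 1 ∧ ∀ i : Fin n, v i = if a ≤ i ∧ (i : ℕ) < b then s else 0

theorem isIntervalVec_of_forall {n : ℕ} {v : Fin n → ℝ} {s : ℝ} (hs : |s| = 1)
    (hv : ∀ i, v i ≠ 0 → v i = s)
    (hconv : ∀ i j k, i ≤ j → j ≤ k → v i ≠ 0 → v k ≠ 0 → v j ≠ 0) : IsIntervalVec v := by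
  classical
  set S := Finset.univ.filter fun i => v i ≠ 0 with hS
  rcases S.eq_empty_or_nonempty with he | hne
  · refine ⟨s, 0, 0, hs, fun i => ?_⟩
    have : i ∉ S := by simp [he]
    simpa [hS] using this
  · refine ⟨s, S.min' hne, S.max' hne + 1, hs, fun i => ?_⟩
    have h1 : v (S.min' hne) ≠ 0 := (Finset.mem_filter.mp (S.min'_mem hne)).2
    have h2 : v (S.max' hne) ≠ 0 := (Finset.mem_filter.mp (S.max'_mem hne)).2
    split_ifs with h
    · exact hv i (hconv _ i _ (Fin.le_def.mpr h.1) (Fin.le_def.mpr (by omega)) h1 h2)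
    · by_contra h0
      have hi : i ∈ S := by simp [hS, h0]
      exact h ⟨Fin.le_def.mp (S.min'_le i hi), Nat.lt_succ_of_le (Fin.le_def.mp (S.le_max' i hi))⟩

/-- Interval matrices are totally unimodular; here for the full determinant. -/
theorem abs_det_le_one_of_isIntervalVec {n : ℕ} (M : Matrix (Fin n) (Fin n) ℝ)
    (hM : ∀ j, IsIntervalVec fun i => M i j) : |M.det| ≤ 1 := by
  classical
  induction n with
  | zero => simp
  | succ n ih =>
    choose s a b hs hab' using hM
    have hab : ∀ j i, M i j = if a j ≤ i ∧ (i : ℕ) < b j then s j else 0 := hab'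
    by_cases hrow : ∀ j, M 0 j = 0
    · rw [Matrix.det_eq_zero_of_row_eq_zero 0 hrow]; simp
    push Not at hrow
    -- The shortest column starting in the first row is subtracted from the other such columns.
    obtain ⟨p, hp, hmin⟩ := (Finset.univ.filter fun j => M 0 j ≠ 0).exists_min_image b
      (by obtain ⟨j, hj⟩ := hrow; exact ⟨j, by simp [hj]⟩)
    simp only [Finset.mem_filter, Finset.mem_univ, true_and] at hp hmin
    have h0 : ∀ j, M 0 j ≠ 0 → a j = 0 ∧ 0 < b j ∧ M 0 j = s j := by
      intro j hj
      rw [hab j 0] at hj ⊢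
      split_ifs at hj ⊢ with h
      · exact ⟨by simpa using h.1, by simpa using h.2, rfl⟩
      · exact absurd rfl hj
    obtain ⟨ha, hb, hsp⟩ := h0 p hp
    set r : Fin (n + 1) → ℝ := fun j => if j = p then 0 else -(M 0 j / M 0 p) with hr
    set A : Matrix (Fin (n + 1)) (Fin (n + 1)) ℝ := Matrix.of fun i j => M i j + r j * M i p with hA
    have hdet : A.det = M.det := by
      rw [← Matrix.det_transpose A, ← Matrix.det_transpose M]
      exact Matrix.det_eq_of_forall_row_eq_smul_add_const r p (by simp [hr]) fun i j => rfl
    have hA0 : ∀ j, j ≠ p → A 0 j = 0 := by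
      intro j hj
      simp only [hA, hr, Matrix.of_apply, if_neg hj]
      field_simp
      ring
    have hAp : A 0 p = s p := by simp [hA, hr, hsp]
    have hsub : ∀ j, IsIntervalVec fun i => (A.submatrix Fin.succ p.succAbove) i j := by
      intro j
      set j' := p.succAbove j with hj'
      have hjp : j' ≠ p := Fin.succAbove_ne p j
      by_cases hj0 : M 0 j' = 0
      · refine ⟨s j', a j' - 1, b j' - 1, hs j', fun i => ?_⟩
        have e : A i.succ j' = M i.succ j' := by simp [hA, hr, hjp, hj0]
        change A i.succ j' = _
        rw [e, hab j' i.succ, Fin.val_succ]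
        have h1 := hab j' 0
        rw [hj0] at h1
        have hsne : s j' ≠ 0 := by intro h; have := hs j'; rw [h] at this; simp at this
        have h2 : ¬ (a j' = 0 ∧ 0 < b j') := by
          rintro ⟨g1, g2⟩
          rw [if_pos ⟨by simp [g1], by simpa using g2⟩] at h1
          exact hsne h1.symm
        congr 1
        apply propext
        omega
      · obtain ⟨ga, gb, gs⟩ := h0 j' hj0
        have hle := hmin j' hj0
        refine ⟨s j', b p - 1, b j' - 1, hs j', fun i => ?_⟩
        have hspne : s p ≠ 0 := by intro h; have := hs p; rw [h] at this; simp at this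
        have e : A i.succ j' = M i.succ j' - s j' / s p * M i.succ p := by
          simp only [hA, hr, Matrix.of_apply, if_neg hjp, gs, hsp]
          ring
        change A i.succ j' = _
        rw [e, hab j' i.succ, hab p i.succ, ga, ha, Fin.val_succ]
        by_cases c1 : (i : ℕ) + 1 < b p
        · rw [if_pos ⟨by omega, by omega⟩, if_pos ⟨by omega, c1⟩, if_neg (by omega),
            div_mul_cancel₀ _ hspne, sub_self]
        · rw [if_neg (c := 0 ≤ (i : ℕ) + 1 ∧ (i : ℕ) + 1 < b p) (by omega), mul_zero, sub_zero]
          congr 1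
          apply propext
          omega
    rw [← hdet, Matrix.det_succ_row_zero, Finset.sum_eq_single p]
    · rw [hAp, abs_mul, abs_mul, hs p, abs_pow, abs_neg, abs_one, one_pow, one_mul, one_mul]
      exact ih _ hsub
    · intro j _ hj
      rw [hA0 j hj]; simp
    · simp

end IntervalMatrix

/-! ### The signed count of flags -/

section Count

open scoped Classical

variable {d : ℕ} {Q : Set (EuclideanSpace ℝ (Fin d))} {J : Set (Fin d)}
  {c : Set (EuclideanSpace ℝ (Fin d)) → EuclideanSpace ℝ (Fin d)}
  {H : Finset (EuclideanSpace ℝ (Fin d) × ℝ)}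

theorem range_comp_succAbove {α : Type*} {k : ℕ} {e : Fin (k + 1) → α} (he : Function.Injective e)
    (j : Fin (k + 1)) : Set.range (e ∘ j.succAbove) = Set.range e \ {e j} := by
  rw [Set.range_comp, Fin.range_succAbove, Set.image_compl_eq_range_sdiff_image he,
    Set.image_singleton]

theorem IsCoordSection.inter_range {k : ℕ} {e : Fin (k + 1) → Fin d} (he : Function.Injective e)
    (hQ : IsCoordSection (Set.range e) Q) (j : Fin (k + 1)) :
    IsCoordSection (Set.range (e ∘ j.succAbove)) (Q ∩ coordHyper (e j)) := by
  rw [range_comp_succAbove he]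
  exact hQ.inter_coordHyper _

theorem IsCoordSection.affDim_eq {k : ℕ} {e : Fin k → Fin d} (he : Function.Injective e)
    (hQ : IsCoordSection (Set.range e) Q) : affDim Q = k := by
  induction k generalizing Q with
  | zero =>
    have : Q = {0} := by
      refine Set.eq_singleton_iff_unique_mem.mpr ⟨hQ.zero_mem, fun x hx => ?_⟩
      ext l
      exact hQ.apply_eq_zero x hx l (by simp)
    rw [this, affDim, if_neg (Set.singleton_ne_empty _), vectorSpan_singleton, finrank_bot]
  | succ k ih =>
    have h1 := ih (he.comp Fin.succAbove_right_injective) (hQ.inter_range he 0)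
    have h2 := hQ.affDim_inter (l := e 0) ⟨0, rfl⟩
    push_cast
    omega

namespace Flags

/-- There is a coordinate whose sign is nonzero on all proper nonempty faces of a flag: the normal
of the largest proper face and the smallest face have a common nonzero coordinate. -/
theorem exists_common_coord (hQ : IsCoordSection J Q) (hc : IsRep Q c) (F : Flags Q)
    (hdim : 0 < affDim Q) :
    ∃ l ∈ J, ∀ i, 0 ≤ i → i < affDim Q → c (F.nth i) l ≠ 0 := by
  obtain ⟨H, hH⟩ := hQ.exists_isHRep
  obtain ⟨ht, htF, rt⟩ := F.pt_spec hc hH (i := affDim Q - 1) (by omega) (by omega)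
  obtain ⟨hk, -, rk⟩ := F.pt_spec hc hH (i := affDim Q) (by omega) le_rfl
  obtain ⟨h, hh, h1, h2⟩ := exists_pos_of_notMem_faceSpan hk (p := F.pt c (affDim Q - 1))
    (fun hmem => by have := Submodule.finrank_mono (faceSpan_le_iff.mpr hmem); omega)
  rw [F.pt_of_nonneg hdim.le, F.nth_top hH, hQ.rep_self hc] at h2
  have h3 : 0 < h.2 := by simpa [slack_apply] using h2
  have hact : ∀ i, i < affDim Q → ∀ y ∈ F.nth i, slack h (y, 1) = 0 := by
    intro i hi y hy
    have := F.nth_mono (show i ≤ affDim Q - 1 by omega) (by omega) hy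
    rw [htF] at this
    exact this.2 h hh h1
  have hx := F.rep_mem hc le_rfl hdim.le
  set x := c (F.nth 0) with hxdef
  have hsum : (∑ l, x l * h.1 l) ≠ 0 := by
    have := hact 0 hdim x hx
    rw [slack_apply, PiLp.inner_apply] at this
    simp only [RCLike.inner_apply, conj_trivial, mul_one] at this
    simp only [mul_comm (x _)]
    linarith
  obtain ⟨l, -, hl⟩ := Finset.exists_ne_zero_of_sum_ne_zero hsum
  have hxl : x l ≠ 0 := left_ne_zero_of_mul hl
  have hlJ : l ∈ J := by
    by_contra hlJ
    exact hxl (hQ.apply_eq_zero x ((F.nth_isExposed 0).subset hx) l hlJ)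
  refine ⟨l, hlJ, fun i h0 hi hz => right_ne_zero_of_mul hl ?_⟩
  have hcr := hc.crosses_of_apply_eq_zero hH (F.nth_isExposed i) (F.nth_mono h0 hi.le hx) hxl hz
  exact hQ.normal_eq_zero hH (F.nth_isExposed i).subset hcr hh (hact i hi)

/-- The matrix of the coordinates, listed by `e`, of the representative points of a flag. -/
noncomputable def ptMat (c : Set (EuclideanSpace ℝ (Fin d)) → EuclideanSpace ℝ (Fin d)) {k : ℕ}
    (e : Fin k → Fin d) (F : Flags Q) : Matrix (Fin k) (Fin k) ℝ :=
  Matrix.of fun i j => c (F.nth i) (e j)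

/-- The matrix of the signs of the coordinates of the representative points of a flag. -/
noncomputable def signMat (c : Set (EuclideanSpace ℝ (Fin d)) → EuclideanSpace ℝ (Fin d)) {k : ℕ}
    (e : Fin k → Fin d) (F : Flags Q) : Matrix (Fin k) (Fin k) ℝ :=
  Matrix.of fun i j => ((SignType.sign (c (F.nth i) (e j)) : SignType) : ℝ)

/-- The weight of a flag: the determinant of its sign matrix, with the orientation of the flag as
sign. -/
noncomputable def weight (c : Set (EuclideanSpace ℝ (Fin d)) → EuclideanSpace ℝ (Fin d)) {k : ℕ}
    (e : Fin k → Fin d) (F : Flags Q) : ℝ :=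
  (SignType.sign (F.ptMat c e).det : ℝ) * (F.signMat c e).det

theorem signType_coe_ne_zero {s : SignType} : (s : ℝ) ≠ 0 ↔ s ≠ 0 := by
  cases s <;> simp

theorem abs_signType_coe_le (s : SignType) : |(s : ℝ)| ≤ 1 := by
  cases s <;> simp

theorem abs_signType_coe {s : SignType} (h : s ≠ 0) : |(s : ℝ)| = 1 := by
  cases s <;> simp at h ⊢

variable {k : ℕ} {e : Fin k → Fin d} {σ : Fin d → SignType}

theorem HasSign.abs_weight_le_one (hQ : IsCoordSection (Set.range e) Q) (hc : IsRep Q c)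
    (he : Function.Injective e) (hσ : ∀ l, σ l ≠ 0 ↔ l ∈ Set.range e) {F : Flags Q}
    (hF : F.HasSign c σ) : |F.weight c e| ≤ 1 := by
  obtain ⟨H, hH⟩ := hQ.exists_isHRep
  have hdim := hQ.affDim_eq he
  have h1 : |(F.signMat c e).det| ≤ 1 := by
    refine abs_det_le_one_of_isIntervalVec _ fun j => ?_
    refine isIntervalVec_of_forall (s := (σ (e j) : ℝ)) ?_ ?_ ?_
    · exact abs_signType_coe ((hσ _).mpr ⟨j, rfl⟩)
    · intro i hi
      simp only [signMat, Matrix.of_apply, signType_coe_ne_zero, sign_ne_zero] at hi ⊢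
      rw [hF.1 i (by omega) (by have := i.2; omega) _ hi]
    · intro i i' i'' h h' hi hi''
      simp only [signMat, Matrix.of_apply, signType_coe_ne_zero, sign_ne_zero] at hi hi'' ⊢
      have hlt := i''.2
      have h1 := Fin.le_def.mp h
      have h2 := Fin.le_def.mp h'
      exact hc.apply_ne_zero_of_between hH (F.nth_isExposed i)
        (F.nth_nonempty (by omega) (by omega)) (F.nth_isExposed i') (F.nth_isExposed i'')
        (F.nth_mono (by omega) (by omega)) (F.nth_mono (by omega) (by omega)) hi hi''
  rw [weight, abs_mul]
  exact mul_le_one₀ (abs_signType_coe_le _) (abs_nonneg _) h1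

/-- Adjacent flags have opposite orientations. -/
theorem AdjAt.sign_det (hQ : IsCoordSection (Set.range e) Q) (hc : IsRep Q c)
    (he : Function.Injective e) {F G : Flags Q} {i : Fin k} (h : AdjAt i F G) :
    SignType.sign (G.ptMat c e).det = -SignType.sign (F.ptMat c e).det := by
  obtain ⟨H, hH⟩ := hQ.exists_isHRep
  have hdim := hQ.affDim_eq he
  let g : EuclideanSpace ℝ (Fin d) →ₗ[ℝ] ℝ :=
    (Matrix.detRowAlternating.toMultilinearMap.toLinearMap (F.ptMat c e) i) ∘ₗ
      (LinearMap.pi fun j => (EuclideanSpace.proj (e j) :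
        EuclideanSpace ℝ (Fin d) →L[ℝ] ℝ).toLinearMap)
  have hg : ∀ x, g x = ((F.ptMat c e).updateRow i fun j => x (e j)).det := fun x => rfl
  obtain ⟨α, hα, hop⟩ := h.opposite hc hH (by omega) (by have := i.2; omega) g
    (fun j h0 h1 hj => by
      rw [hg]
      rcases h1.eq_or_lt with h1 | h1
      · rw [h1, F.nth_top hH, hQ.rep_self hc]
        exact Matrix.det_eq_zero_of_row_eq_zero i fun j' => by simp
      · obtain ⟨n, rfl⟩ := Int.eq_ofNat_of_zero_le h0
        have hn : n < k := by omega
        have hne : (⟨n, hn⟩ : Fin k) ≠ i := fun h => hj (by rw [← h])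
        refine Matrix.det_zero_of_row_eq hne ?_
        rw [Matrix.updateRow_self]
        funext j'
        rw [Matrix.updateRow_ne hne]
        rfl)
  have h1 : g (c (F.nth i)) = (F.ptMat c e).det := by
    rw [hg]
    congr 1
    exact Matrix.updateRow_eq_self _ _
  have h2 : g (c (G.nth i)) = (G.ptMat c e).det := by
    rw [hg]
    congr 1
    ext i' j'
    by_cases hi : i' = i
    · subst hi; rw [Matrix.updateRow_self]; rfl
    · rw [Matrix.updateRow_ne hi]
      have hne : (i' : ℤ) ≠ i := fun h => hi (Fin.ext (by exact_mod_cast h))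
      simp only [ptMat, Matrix.of_apply, h.2 _ hne]
  rw [h1, h2] at hop
  rw [hop, Left.sign_neg, sign_mul, sign_pos hα, one_mul]

/-- The contribution of level `i` to the weight of a flag. -/
noncomputable def partialWeight
    (c : Set (EuclideanSpace ℝ (Fin d)) → EuclideanSpace ℝ (Fin d)) (e : Fin k → Fin d)
    (σ : Fin d → SignType) (i : Fin k) (F : Flags Q) : ℝ :=
  (SignType.sign (F.ptMat c e).det : ℝ) *
    ((F.signMat c e).updateRow i fun j => (σ (e j) : ℝ)).det

theorem AdjAt.partialWeight (hQ : IsCoordSection (Set.range e) Q) (hc : IsRep Q c)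
    (he : Function.Injective e) {F G : Flags Q} {i : Fin k} (h : AdjAt i F G) :
    F.partialWeight c e σ i + G.partialWeight c e σ i = 0 := by
  have hm : (F.signMat c e).updateRow i (fun j => (σ (e j) : ℝ)) =
      (G.signMat c e).updateRow i (fun j => (σ (e j) : ℝ)) := by
    ext i' j'
    by_cases hi : i' = i
    · subst hi; rw [Matrix.updateRow_self, Matrix.updateRow_self]
    · rw [Matrix.updateRow_ne hi, Matrix.updateRow_ne hi]
      have hne : (i' : ℤ) ≠ i := fun h => hi (Fin.ext (by exact_mod_cast h))
      simp only [signMat, Matrix.of_apply, h.2 _ hne]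
  rw [Flags.partialWeight, Flags.partialWeight, hm, h.sign_det hQ hc he, SignType.coe_neg]
  ring

/-- Cramer's rule, for the column of a coordinate whose sign is nonzero on all proper faces of the
flag: this column is constantly the entry of `σ`. -/
theorem HasSign.weight_eq_sum {k : ℕ} {e : Fin (k + 1) → Fin d}
    (hQ : IsCoordSection (Set.range e) Q) (hc : IsRep Q c)
    (he : Function.Injective e) {F : Flags Q} (hF : F.HasSign c σ) :
    F.weight c e = ∑ i, F.partialWeight c e σ i := by
  have hdim := hQ.affDim_eq he
  push_cast at hdim
  obtain ⟨l, ⟨j, rfl⟩, hj⟩ := F.exists_common_coord hQ hc (by omega)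
  have hent : ∀ i : Fin (k + 1), F.signMat c e i j = (σ (e j) : ℝ) := fun i => by
    have := i.2
    simp only [signMat, Matrix.of_apply]
    rw [hF.1 i (by omega) (by omega) _ (hj i (by omega) (by omega))]
  have hne : (σ (e j) : ℝ) ≠ 0 := by
    rw [← hent 0]
    simpa only [signMat, Matrix.of_apply, signType_coe_ne_zero, sign_ne_zero] using
      hj _ (by simp) (by simp; omega)
  have hcr := congrFun (Matrix.mulVec_cramer (F.signMat c e).transpose fun j => (σ (e j) : ℝ)) j
  simp only [Matrix.mulVec, dotProduct, Matrix.transpose_apply, Matrix.cramer_transpose_apply,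
    hent, Matrix.det_transpose, Pi.smul_apply, smul_eq_mul, ← Finset.mul_sum] at hcr
  rw [mul_comm] at hcr
  replace hcr := mul_right_cancel₀ hne hcr
  simp only [weight, Flags.partialWeight, ← Finset.mul_sum, hcr]

end Flags

end Count

/-! ### Evaluating the signed count -/

section CountStep

open scoped Classical

variable {d : ℕ} {Q : Set (EuclideanSpace ℝ (Fin d))} {J : Set (Fin d)}
  {c : Set (EuclideanSpace ℝ (Fin d)) → EuclideanSpace ℝ (Fin d)}
  {H : Finset (EuclideanSpace ℝ (Fin d) × ℝ)} {σ : Fin d → SignType}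

namespace Flags

theorem HasSign.apply_eq_zero (hQ : IsCoordSection J Q) (hc : IsRep Q c) {F : Flags Q}
    (hF : F.HasSign c σ) {l : Fin d} (hl : l ∉ J) : σ l = 0 := by
  by_contra h
  obtain ⟨i, h0, h1, hi⟩ := hF.2 l h
  exact hi (hQ.apply_eq_zero _ ((F.nth_isExposed i).subset (F.rep_mem hc h0 h1)) l hl)

/-- A flip that moves the only face with nonzero `l`-th sign across the hyperplane `x_l = 0` changes
the sign of the flag. -/
theorem AdjAt.not_hasSign (hQ : IsCoordSection J Q) (hc : IsRep Q c) {F G : Flags Q} {i : ℤ}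
    {l : Fin d} (h : AdjAt i F G) (hF : F.HasSign c σ) (hl : F.OnlyAt c l i) :
    ¬ G.HasSign c σ := fun hG => by
  obtain ⟨H, hH⟩ := hQ.exists_isHRep
  obtain ⟨α, hα, hop⟩ := h.opposite hc hH hl.1 (hl.lt hQ hc)
    (EuclideanSpace.proj l : EuclideanSpace ℝ (Fin d) →L[ℝ] ℝ).toLinearMap
    (fun j h0 h1 hj => hl.rep_eq_zero h0 h1 hj)
  have hop' : c (G.nth i) l = -(α * c (F.nth i) l) := hop
  have hne := hl.rep_ne_zero
  have hne' : c (G.nth i) l ≠ 0 := by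
    rw [hop', neg_ne_zero]; exact mul_ne_zero hα.ne' hne
  have h1 := hF.1 i hl.1 hl.2.1 l hne
  have h2 := hG.1 i hl.1 hl.2.1 l hne'
  rw [hop', Left.sign_neg, sign_mul, sign_pos hα, one_mul, h1] at h2
  have h3 : σ l ≠ 0 := h1 ▸ sign_ne_zero.mpr hne
  cases hs : σ l <;> simp [hs] at h2 h3

/-- If a flip changes the sign of a flag, then in some coordinate the replaced face is the only one
with a nonzero sign. -/
theorem AdjAt.exists_onlyAt (hQ : IsCoordSection J Q) (hc : IsRep Q c) {F G : Flags Q} {i : ℤ}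
    (h0 : 0 ≤ i) (h1 : i ≤ affDim Q)
    (h : AdjAt i F G) (hF : F.HasSign c σ) (hG : ¬ G.HasSign c σ) :
    ∃ l ∈ J, F.OnlyAt c l i := by
  obtain ⟨H, hH⟩ := hQ.exists_isHRep
  obtain ⟨τ, hτ⟩ := G.exists_hasSign hc hH
  obtain ⟨l, hl⟩ : ∃ l, τ l ≠ σ l := by
    by_contra! hall
    exact hG (funext hall ▸ hτ)
  have hzero : ∀ j, 0 ≤ j → j ≤ affDim Q → j ≠ i → c (F.nth j) l = 0 := by
    intro j hj0 hj1 hj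
    by_contra hne
    apply hl
    have hne' := hne
    rw [h.2 j hj] at hne'
    rw [← hτ.1 j hj0 hj1 l hne', ← hF.1 j hj0 hj1 l hne, h.2 j hj]
  have hlJ : l ∈ J := by
    by_contra hlJ
    exact hl (by rw [hτ.apply_eq_zero hQ hc hlJ, hF.apply_eq_zero hQ hc hlJ])
  obtain ⟨j, hj0, hj1, hj⟩ := F.exists_rep_ne_zero hQ hc hlJ
  refine ⟨l, hlJ, h0, h1, fun i' hi0 hi1 => ⟨fun hne => ?_, ?_⟩⟩
  · by_contra he
    exact hne (hzero i' hi0 hi1 he)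
  · rintro rfl
    by_cases he : j = i'
    · rwa [← he]
    · exact absurd (hzero j hj0 hj1.le he) hj

variable {k : ℕ} {e : Fin (k + 1) → Fin d}

/-- At a fixed level, the contributions of flags whose flip has the same sign cancel; what remains
comes from the flags whose flip crosses a coordinate hyperplane. -/
theorem sum_partialWeight_eq [Fintype (Flags Q)] (hQ : IsCoordSection (Set.range e) Q)
    (hc : IsRep Q c) (he : Function.Injective e) (i : Fin (k + 1)) :
    ∑ F : Flags Q with F.HasSign c σ, F.partialWeight c e σ i =
      ∑ F : Flags Q with F.HasSign c σ, ∑ j, if F.OnlyAt c (e j) i then F.partialWeight c e σ i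
        else 0 := by
  obtain ⟨H, hH⟩ := hQ.exists_isHRep
  have hdim := hQ.affDim_eq he
  have hi := i.2
  choose flip hflip using fun F : Flags Q => F.exists_adjAt hc hH (i := i) (by omega) (by omega)
  have hinv : ∀ F, flip (flip F) = F := fun F =>
    ((hflip (flip F)).unique hc hH (by omega) (by omega) (hflip F).symm)
  rw [← sub_eq_zero, ← Finset.sum_sub_distrib]
  have hS : ∀ F : Flags Q, F.HasSign c σ → ¬ (flip F).HasSign c σ →
      F.partialWeight c e σ i -
        (∑ j, if F.OnlyAt c (e j) i then F.partialWeight c e σ i else 0) = 0 := by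
    intro F hF hG
    obtain ⟨_, ⟨j, rfl⟩, hj⟩ := (hflip F).exists_onlyAt hQ hc (by omega) (by omega) hF hG
    rw [Finset.sum_eq_single j, if_pos hj, sub_self]
    · intro j' _ hne
      rw [if_neg fun hj' => hne (he (hj.coord_unique hQ hc ⟨j, rfl⟩ hj'))]
    · simp
  have hS' : ∀ F : Flags Q, F.HasSign c σ → (flip F).HasSign c σ →
      (∑ j, if F.OnlyAt c (e j) i then F.partialWeight c e σ i else 0) = 0 := by
    intro F hF hG
    refine Finset.sum_eq_zero fun j _ => if_neg fun hj => ?_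
    exact (hflip F).not_hasSign hQ hc hF hj hG
  rw [← Finset.sum_filter_add_sum_filter_not _ fun F => (flip F).HasSign c σ, Finset.filter_filter,
    Finset.filter_filter]
  have hsnd : ∑ F : Flags Q with F.HasSign c σ ∧ ¬ (flip F).HasSign c σ,
      (F.partialWeight c e σ i -
        (∑ j, if F.OnlyAt c (e j) i then F.partialWeight c e σ i else 0)) = 0 := by
    refine Finset.sum_eq_zero fun F hF => ?_
    simp only [Finset.mem_filter, Finset.mem_univ, true_and] at hF
    exact hS F hF.1 hF.2
  rw [hsnd, add_zero]
  refine Finset.sum_involution (fun F _ => flip F) ?_ ?_ ?_ ?_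
  · intro F hF
    simp only [Finset.mem_filter, Finset.mem_univ, true_and] at hF
    rw [hS' F hF.1 hF.2, hS' (flip F) hF.2 ((hinv F).symm ▸ hF.1), sub_zero, sub_zero]
    exact (hflip F).partialWeight hQ hc he
  · intro F _ _
    exact (hflip F).1.symm
  · intro F hF
    simp only [Finset.mem_filter, Finset.mem_univ, true_and] at hF ⊢
    exact ⟨hF.2, (hinv F).symm ▸ hF.1⟩
  · intro F _
    exact hinv F

/-- The weight of a flag of a hyperplane section is a partial weight of its extension: expand both
determinants along the column of the new coordinate. -/
theorem IsExtension.weight_eq (hQ : IsCoordSection (Set.range e) Q)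
    (hc : IsRep Q c) (he : Function.Injective e) {i j : Fin (k + 1)}
    {G : Flags (Q ∩ coordHyper (e j))} {F : Flags Q} (h : IsExtension c (e j) G F i)
    (hσ : SignType.sign (c (F.nth i) (e j)) = σ (e j)) :
    G.weight (sectionRep Q c (e j)) (e ∘ j.succAbove) = F.partialWeight c e σ i := by
  obtain ⟨H, hH⟩ := hQ.exists_isHRep
  have hdim := hQ.affDim_eq he
  have hrow : ∀ i' : Fin k,
      sectionRep Q c (e j) (G.nth i') = c (F.nth (i.succAbove i' : Fin (k + 1))) := by
    intro i'
    have hi' := i'.2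
    by_cases hlt : i'.castSucc < i
    · rw [Fin.succAbove_of_castSucc_lt _ _ hlt, Fin.val_castSucc]
      exact h.rep_lower hc hH (by omega) (by have := Fin.lt_def.mp hlt; simp at this; omega)
    · rw [Fin.succAbove_of_le_castSucc _ _ (not_lt.mp hlt), Fin.val_succ]
      push_cast
      exact h.rep_upper hc hH (by have := Fin.le_def.mp (not_lt.mp hlt); simp at this; omega)
        (by omega)
  have hzero : ∀ i' : Fin (k + 1), i' ≠ i → c (F.nth i') (e j) = 0 := fun i' hne =>
    h.onlyAt.rep_eq_zero (by omega) (by have := i'.2; omega)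
      (fun h => hne (Fin.ext (by exact_mod_cast h)))
  have hpt : (F.ptMat c e).det = (-1) ^ ((i : ℕ) + j) * c (F.nth i) (e j) *
      (G.ptMat (sectionRep Q c (e j)) (e ∘ j.succAbove)).det := by
    rw [Matrix.det_succ_column _ j, Finset.sum_eq_single i]
    · congr 2
      ext i' j'
      simp only [ptMat, Matrix.submatrix_apply, Matrix.of_apply, hrow, Function.comp]
    · intro i' _ hne
      simp [ptMat, hzero i' hne]
    · simp
  have hsg : ((F.signMat c e).updateRow i fun j => (σ (e j) : ℝ)).det =
      (-1) ^ ((i : ℕ) + j) * (σ (e j) : ℝ) *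
      (G.signMat (sectionRep Q c (e j)) (e ∘ j.succAbove)).det := by
    rw [Matrix.det_succ_column _ j, Finset.sum_eq_single i]
    · rw [Matrix.updateRow_self]
      congr 2
      ext i' j'
      rw [Matrix.submatrix_apply, Matrix.updateRow_ne (Fin.succAbove_ne _ _)]
      simp only [signMat, Matrix.of_apply, hrow, Function.comp]
    · intro i' _ hne
      rw [Matrix.updateRow_ne hne]
      simp [signMat, hzero i' hne]
    · simp
  have hs : σ (e j) ≠ 0 := hσ ▸ sign_ne_zero.mpr h.onlyAt.rep_ne_zero
  have h1 : ((σ (e j) : SignType) : ℝ) * (σ (e j) : ℝ) = 1 := by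
    cases hs' : σ (e j) <;> simp [hs'] at hs ⊢
  have h2 : ((SignType.sign ((-1 : ℝ) ^ ((i : ℕ) + j)) : SignType) : ℝ) *
      (-1) ^ ((i : ℕ) + j) = 1 := by
    rcases neg_one_pow_eq_or ℝ ((i : ℕ) + j) with h | h <;> rw [h] <;> simp
  rw [weight, partialWeight, hpt, hsg, sign_mul, sign_mul, hσ, SignType.coe_mul, SignType.coe_mul]
  generalize ((SignType.sign ((-1 : ℝ) ^ ((i : ℕ) + j)) : SignType) : ℝ) = x at h2 ⊢
  generalize ((-1 : ℝ) ^ ((i : ℕ) + j)) = y at h2 ⊢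
  generalize ((σ (e j) : SignType) : ℝ) = z at h1 ⊢
  linear_combination (-(SignType.sign (G.ptMat (sectionRep Q c (e j)) (e ∘ j.succAbove)).det : ℝ) *
    (G.signMat (sectionRep Q c (e j)) (e ∘ j.succAbove)).det) * (h1 + (z * z) * h2)

/-- The terms of the flags whose flip crosses the hyperplane of coordinate `e j` add up to the
signed count for the section by that hyperplane: those flags are the extensions of flags of the
section. -/
theorem sum_onlyAt_eq [Fintype (Flags Q)] (hQ : IsCoordSection (Set.range e) Q)
    (hc : IsRep Q c) (he : Function.Injective e) (hσ : ∀ l, σ l ≠ 0 ↔ l ∈ Set.range e)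
    (j : Fin (k + 1)) [Fintype (Flags (Q ∩ coordHyper (e j)))] :
    ∑ F : Flags Q with F.HasSign c σ, ∑ i : Fin (k + 1),
      (if F.OnlyAt c (e j) i then F.partialWeight c e σ i else 0) =
    ∑ G : Flags (Q ∩ coordHyper (e j)) with
      G.HasSign (sectionRep Q c (e j)) (Function.update σ (e j) 0),
      G.weight (sectionRep Q c (e j)) (e ∘ j.succAbove) := by
  obtain ⟨H, hH⟩ := hQ.exists_isHRep
  have hdim := hQ.affDim_eq he
  have hj : e j ∈ Set.range e := ⟨j, rfl⟩
  have hσj : σ (e j) ≠ 0 := (hσ _).mpr hj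
  have hr : ((σ (e j) : SignType) : ℝ) ≠ 0 := signType_coe_ne_zero.mpr hσj
  have hss : SignType.sign ((σ (e j) : SignType) : ℝ) = σ (e j) := by
    cases σ (e j) <;> simp
  choose Φ μ hΦ hsg using fun G : Flags (Q ∩ coordHyper (e j)) =>
    exists_extension hQ hc hj G hr
  rw [hss] at hsg
  have hμ : ∀ G, ∃ i : Fin (k + 1), (i : ℤ) = μ G := fun G => by
    have h0 := (hΦ G).onlyAt.1
    have h1 := (hΦ G).onlyAt.lt hQ hc
    exact ⟨⟨(μ G).toNat, by omega⟩, by simp [h0]⟩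
  choose ν hν using hμ
  simp only [← hν] at hΦ hsg
  rw [← Finset.sum_product', ← Finset.sum_filter]
  symm
  refine Finset.sum_bij (fun G _ => (Φ G, ν G)) ?_ ?_ ?_ ?_
  · intro G hG
    simp only [Finset.mem_filter, Finset.mem_univ, true_and, Finset.mem_product, and_true] at hG ⊢
    exact ⟨((hΦ G).hasSign_iff hQ hc hj (hsg G)).mpr hG, (hΦ G).onlyAt⟩
  · intro G _ G' _ heq
    obtain ⟨h1, h2⟩ := Prod.mk.inj heq
    have h := hΦ G'
    rw [← h1] at h
    exact (hΦ G).section_unique hQ hj h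
  · rintro ⟨F, i⟩ hF
    simp only [Finset.mem_filter, Finset.mem_univ, true_and, Finset.mem_product, and_true] at hF
    obtain ⟨hF1, hF2⟩ := hF
    obtain ⟨G, hG⟩ := hF2.exists_section hQ hc hj
    have hsF := hF1.1 i hF2.1 hF2.2.1 _ hF2.rep_ne_zero
    refine ⟨G, ?_, ?_⟩
    · simp only [Finset.mem_filter, Finset.mem_univ, true_and]
      exact (hG.hasSign_iff hQ hc hj hsF).mp hF1
    · have h1 : Φ G = F := (hΦ G).unique hc hH ((hΦ G).onlyAt.lt hQ hc) (hF2.lt hQ hc) hG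
        (by rw [hsg, hsF])
      have h2 : ((ν G : ℕ) : ℤ) = (i : ℕ) :=
        (hF2.2.2 _ (hΦ G).onlyAt.1 (hΦ G).onlyAt.2.1).mp (h1 ▸ (hΦ G).onlyAt.rep_ne_zero)
      exact Prod.ext h1 (Fin.ext (by exact_mod_cast h2))
  · intro G _
    exact (hΦ G).weight_eq hQ hc he (hsg G)

/-- The signed count of the flags of a given sign. -/
theorem sum_weight {k : ℕ} {e : Fin k → Fin d} [Fintype (Flags Q)]
    (hQ : IsCoordSection (Set.range e) Q) (hc : IsRep Q c) (he : Function.Injective e)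
    (hσ : ∀ l, σ l ≠ 0 ↔ l ∈ Set.range e) :
    ∑ F : Flags Q with F.HasSign c σ, F.weight c e = (k ! : ℕ) := by
  induction k generalizing Q c σ with
  | zero =>
    obtain ⟨H, hH⟩ := hQ.exists_isHRep
    have hdim := hQ.affDim_eq he
    rw [Nat.cast_zero] at hdim
    have hsub : ∀ F G : Flags Q, F = G := fun F G => ext_nth hH fun i h0 h1 => by omega
    have hex : Nonempty (Flags Q) := by
      refine ⟨ofFun (fun i => if i < 0 then ∅ else Q) ?_ ?_ ?_⟩
      · intro i _ _
        split_ifs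
        · exact isExposed_empty
        · exact IsExposed.refl Q
      · intro i h1 h2
        split_ifs
        · simp only [affDim, if_true]; omega
        · omega
      · intro i h1 h2
        rw [if_pos (by omega)]
        exact Set.empty_subset _
    obtain ⟨F⟩ := hex
    have hF : F.HasSign c σ := by
      refine ⟨fun i h0 h1 l hl => ?_, fun l hl => ?_⟩
      · obtain rfl : i = affDim Q := by omega
        rw [F.nth_top hH, hQ.rep_self hc] at hl
        exact absurd rfl hl
      · obtain ⟨x, -⟩ := (hσ l).mp hl
        exact x.elim0
    rw [Finset.sum_eq_single F]
    · simp [weight]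
    · intro G _ hG
      exact absurd (hsub G F) hG
    · simp [hF]
  | succ k ih =>
    have hH' := fun j => (hQ.inter_range he j).exists_isHRep
    have hfin : ∀ j, Finite (Flags (Q ∩ coordHyper (e j))) := fun j => by
      obtain ⟨H', h⟩ := hH' j
      exact Flags.finite h
    obtain ⟨H, hH⟩ := hQ.exists_isHRep
    have : ∀ j, Fintype (Flags (Q ∩ coordHyper (e j))) := fun j =>
      have := hfin j; Fintype.ofFinite _
    have h1 : ∑ F : Flags Q with F.HasSign c σ, F.weight c e =
        ∑ F : Flags Q with F.HasSign c σ, ∑ i, F.partialWeight c e σ i :=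
      Finset.sum_congr rfl fun F hF =>
        HasSign.weight_eq_sum hQ hc he (Finset.mem_filter.mp hF).2
    rw [h1, Finset.sum_comm, Finset.sum_congr rfl fun i _ => sum_partialWeight_eq hQ hc he i]
    have h2 : ∀ j, ∑ F : Flags Q with F.HasSign c σ, ∑ i : Fin (k + 1),
        (if F.OnlyAt c (e j) i then F.partialWeight c e σ i else 0) = (k ! : ℕ) := by
      intro j
      rw [sum_onlyAt_eq hQ hc he hσ j]
      refine ih (hQ.inter_range he j) (hc.sectionRep hH _)
        (he.comp Fin.succAbove_right_injective) fun l => ?_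
      rw [range_comp_succAbove he, Set.mem_sdiff, Set.mem_singleton_iff, ← hσ]
      by_cases hl : l = e j
      · simp [hl]
      · simp [hl]
    calc _ = ∑ j, ∑ F : Flags Q with F.HasSign c σ, ∑ i : Fin (k + 1),
          (if F.OnlyAt c (e j) i then F.partialWeight c e σ i else 0) := by
          rw [Finset.sum_comm, Finset.sum_comm (s := (Finset.univ : Finset (Fin (k + 1))))]
          exact Finset.sum_congr rfl fun F _ => Finset.sum_comm
      _ = _ := by
          rw [Finset.sum_congr rfl fun j _ => h2 j]
          simp [Nat.factorial_succ]

/-- There are at least `k!` flags of a given full sign, because their weights add up to `k!` and are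
at most `1`. -/
theorem factorial_le_encard {k : ℕ} {e : Fin k → Fin d}
    (hQ : IsCoordSection (Set.range e) Q) (hc : IsRep Q c) (he : Function.Injective e)
    (hσ : ∀ l, σ l ≠ 0 ↔ l ∈ Set.range e) :
    ((k ! : ℕ) : ℕ∞) ≤ {F : Flags Q | F.HasSign c σ}.encard := by
  obtain ⟨H, hH⟩ := hQ.exists_isHRep
  have := Flags.finite hH
  have : Fintype (Flags Q) := Fintype.ofFinite _
  have h1 : ((k ! : ℕ) : ℝ) ≤ (Finset.univ.filter fun F : Flags Q => F.HasSign c σ).card := by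
    rw [← sum_weight hQ hc he hσ]
    refine (Finset.sum_le_card_nsmul _ _ 1 fun F hF => ?_).trans (by simp)
    exact (le_abs_self _).trans
      (HasSign.abs_weight_le_one hQ hc he hσ (Finset.mem_filter.mp hF).2)
  have h2 : {F : Flags Q | F.HasSign c σ} =
      ((Finset.univ.filter fun F : Flags Q => F.HasSign c σ : Finset (Flags Q)) :
        Set (Flags Q)) := by
    ext F; simp
  rw [h2, Set.encard_coe_eq_coe_finsetCard]
  exact_mod_cast h1

end Flags

end CountStep

/-! ### The standard fan -/

section Fan

variable {d : ℕ} {σ τ : Fin d → SignType}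

theorem eq_sum_smul_stdVec (x : EuclideanSpace ℝ (Fin d)) : x = ∑ l, x l • stdVec l := by
  ext j
  simp [stdVec_apply]

theorem mem_coordSubspace {J : Set (Fin d)} {x : EuclideanSpace ℝ (Fin d)} :
    x ∈ coordSubspace J ↔ ∀ l ∉ J, x l = 0 := by
  constructor
  · intro hx l hl
    induction hx using Submodule.span_induction with
    | mem x hx =>
      obtain ⟨j, hj, rfl⟩ := hx
      have hlj : l ≠ j := fun h => hl (h.symm ▸ hj)
      rw [stdVec_apply, if_neg hlj]
    | zero => rfl
    | add x y _ _ hx hy => simp [hx, hy]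
    | smul a x _ hx => simp [hx]
  · intro h
    rw [eq_sum_smul_stdVec x]
    refine Submodule.sum_mem _ fun l _ => ?_
    by_cases hl : l ∈ J
    · exact Submodule.smul_mem _ _ (Submodule.subset_span ⟨l, hl, rfl⟩)
    · rw [h l hl, zero_smul]
      exact Submodule.zero_mem _

theorem finrank_coordSubspace (J : Set (Fin d)) :
    Module.finrank ℝ (coordSubspace J) = J.ncard := by
  classical
  have hb : LinearIndependent ℝ (stdVec : Fin d → EuclideanSpace ℝ (Fin d)) := by
    have h := (EuclideanSpace.basisFun (Fin d) ℝ).toBasis.linearIndependent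
    have e : ((EuclideanSpace.basisFun (Fin d) ℝ).toBasis : Fin d → _) = stdVec := by
      funext i
      simp [stdVec]
    rwa [e] at h
  have : Fintype J := Fintype.ofFinite J
  have h := finrank_span_eq_card (hb.comp ((↑) : J → Fin d) Subtype.val_injective)
  rw [Set.range_comp, Subtype.range_coe] at h
  rw [coordSubspace, h, ← Nat.card_eq_fintype_card, Nat.card_coe_set_eq]

/-- The cone of the standard fan with sign vector `σ`: the set of all points each of whose
coordinates is a nonnegative multiple of the corresponding entry of `σ`. -/
def orthantCone (σ : Fin d → SignType) : PointedCone ℝ (EuclideanSpace ℝ (Fin d)) where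
  carrier := {x | ∀ l, ∃ r : ℝ≥0, x l = r * σ l}
  add_mem' := by
    intro x y hx hy l
    obtain ⟨r, hr⟩ := hx l
    obtain ⟨s, hs⟩ := hy l
    exact ⟨r + s, by rw [PiLp.add_apply, hr, hs, NNReal.coe_add, add_mul]⟩
  zero_mem' := fun l => ⟨0, by simp⟩
  smul_mem' := by
    intro a x hx l
    obtain ⟨r, hr⟩ := hx l
    refine ⟨⟨a, a.2⟩ * r, ?_⟩
    change (a : ℝ) * x l = (a : ℝ) * r * σ l
    rw [hr, mul_assoc]

theorem mem_orthantCone {x : EuclideanSpace ℝ (Fin d)} :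
    x ∈ orthantCone σ ↔ ∀ l, x l ≠ 0 → SignType.sign (x l) = σ l := by
  refine forall_congr' fun l => ⟨?_, fun h => ?_⟩
  · rintro ⟨r, hr⟩ hx
    have hr0 : (0 : ℝ) < r := lt_of_le_of_ne r.2 fun h => hx (by rw [hr, ← h, zero_mul])
    rw [hr, sign_mul, sign_pos hr0, one_mul]
    cases σ l <;> simp
  · by_cases hx : x l = 0
    · exact ⟨0, by simp [hx]⟩
    · refine ⟨⟨|x l|, abs_nonneg _⟩, ?_⟩
      rw [← h hx]
      exact (abs_mul_sign (x l)).symm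

theorem smul_stdVec_mem_orthantCone (σ : Fin d → SignType) (l : Fin d) :
    (σ l : ℝ) • stdVec l ∈ orthantCone σ := by
  intro j
  by_cases hj : j = l
  · exact ⟨1, by simp [stdVec_apply, hj]⟩
  · exact ⟨0, by simp [stdVec_apply, hj]⟩

theorem orthantCone_le (h : orthantCone τ ≤ orthantCone σ) {l : Fin d} (hl : τ l ≠ 0) :
    τ l = σ l := by
  have h1 := mem_orthantCone.mp (h (smul_stdVec_mem_orthantCone τ l)) l
  have e : ((τ l : ℝ) • stdVec l : EuclideanSpace ℝ (Fin d)) l = τ l := by simp [stdVec_apply]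
  rw [e] at h1
  rw [← h1 (Flags.signType_coe_ne_zero.mpr hl)]
  cases τ l <;> simp

theorem orthantCone_injective :
    Function.Injective (orthantCone : (Fin d → SignType) → PointedCone ℝ _) := by
  intro σ τ h
  funext l
  by_cases hσ : σ l = 0
  · by_cases hτ : τ l = 0
    · rw [hσ, hτ]
    · exact (orthantCone_le h.ge hτ).symm
  · exact orthantCone_le h.le hσ

theorem orthantCone_eq_hull {A : Set (EuclideanSpace ℝ (Fin d))}
    (h1 : ∀ v ∈ A, ∃ l, σ l ≠ 0 ∧ v = (σ l : ℝ) • stdVec l)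
    (h2 : ∀ l, σ l ≠ 0 → (σ l : ℝ) • stdVec l ∈ A) : orthantCone σ = PointedCone.hull ℝ A := by
  apply le_antisymm
  · intro x hx
    rw [eq_sum_smul_stdVec x]
    refine Submodule.sum_mem _ fun l _ => ?_
    obtain ⟨r, hr⟩ := hx l
    rw [hr, mul_smul]
    by_cases hl : σ l = 0
    · simp [hl]
    · exact Submodule.smul_mem _ r (Submodule.subset_span (h2 l hl))
  · refine Submodule.span_le.mpr fun v hv => ?_
    obtain ⟨l, -, rfl⟩ := h1 v hv
    exact smul_stdVec_mem_orthantCone σ l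

theorem mem_stdFan {D : PointedCone ℝ (EuclideanSpace ℝ (Fin d))} :
    D ∈ stdFan d ↔ ∃ σ, D = orthantCone σ := by
  classical
  constructor
  · rintro ⟨A, h1, h2, rfl⟩
    refine ⟨fun l => if stdVec l ∈ A then 1 else if -stdVec l ∈ A then -1 else 0,
      (orthantCone_eq_hull (fun v hv => ?_) fun l hl => ?_).symm⟩
    · obtain ⟨i, rfl | rfl⟩ := h1 v hv
      · exact ⟨i, by simp [hv], by simp [hv]⟩
      · have hi : stdVec i ∉ A := fun h => h2 i ⟨h, hv⟩
        exact ⟨i, by simp [hv, hi], by simp [hv, hi]⟩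
    · by_cases h3 : stdVec l ∈ A
      · simp [h3]
      · by_cases h4 : -stdVec l ∈ A
        · simp [h3, h4]
        · simp [h3, h4] at hl
  · rintro ⟨σ, rfl⟩
    refine ⟨{v | ∃ l, σ l ≠ 0 ∧ v = (σ l : ℝ) • stdVec l}, ?_, ?_,
      orthantCone_eq_hull (fun v hv => hv) fun l hl => ⟨l, hl, rfl⟩⟩
    · rintro v ⟨l, hl, rfl⟩
      refine ⟨l, ?_⟩
      rcases h : σ l with _ | _ | _
      · exact absurd h hl
      · exact Or.inr (by simp)
      · exact Or.inl (by simp)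
    · rintro i ⟨⟨l, hl, h1⟩, m, hm, h2⟩
      have e1 := congrArg (fun v : EuclideanSpace ℝ (Fin d) => v i) h1
      have e2 := congrArg (fun v : EuclideanSpace ℝ (Fin d) => v i) h2
      simp only [stdVec_apply, PiLp.neg_apply, PiLp.smul_apply, smul_eq_mul, if_true] at e1 e2
      by_cases hil : i = l
      · by_cases him : i = m
        · subst hil him
          rw [if_pos rfl] at e1 e2
          linarith
        · rw [if_neg him] at e2
          linarith
      · rw [if_neg hil] at e1
        linarith

theorem span_orthantCone (σ : Fin d → SignType) :
    Submodule.span ℝ (orthantCone σ : Set (EuclideanSpace ℝ (Fin d))) =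
      coordSubspace {l | σ l ≠ 0} := by
  refine le_antisymm (Submodule.span_le.mpr fun x hx => ?_) (Submodule.span_le.mpr ?_)
  · refine mem_coordSubspace.mpr fun l hl => ?_
    obtain ⟨r, hr⟩ := hx l
    rw [hr, not_not.mp hl]
    simp
  · rintro _ ⟨l, hl, rfl⟩
    have h := Submodule.smul_mem _ (σ l : ℝ)⁻¹
      (Submodule.subset_span (R := ℝ) (smul_stdVec_mem_orthantCone σ l))
    rwa [smul_smul, inv_mul_cancel₀ (Flags.signType_coe_ne_zero.mpr hl), one_smul] at h

theorem linSpan_orthantCone (σ : Fin d → SignType) :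
    linSpan (orthantCone σ) = coordSubspace {l | σ l ≠ 0} := by
  rw [linSpan, span_orthantCone]

theorem affDim_orthantCone (σ : Fin d → SignType) :
    affDim (orthantCone σ : Set (EuclideanSpace ℝ (Fin d))) = {l | σ l ≠ 0}.ncard := by
  have h0 : (0 : EuclideanSpace ℝ (Fin d)) ∈ (orthantCone σ : Set _) := Submodule.zero_mem _
  have h1 : vectorSpan ℝ (orthantCone σ : Set (EuclideanSpace ℝ (Fin d))) =
      coordSubspace {l | σ l ≠ 0} := by
    rw [vectorSpan_eq_span_vsub_set_right ℝ h0]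
    simp only [vsub_eq_sub, sub_zero, Set.image_id']
    exact span_orthantCone σ
  rw [affDim, if_neg (Set.Nonempty.ne_empty ⟨0, h0⟩), h1, finrank_coordSubspace]

/-- The facets of the cone with sign vector `σ` arise by replacing a nonzero entry of `σ` by zero.
-/
theorem exists_eq_update_of_isFacetOf (h : IsFacetOf (orthantCone τ) (orthantCone σ)) :
    ∃ l, σ l ≠ 0 ∧ τ = Function.update σ l 0 := by
  obtain ⟨h1, h2⟩ := h
  have hle : orthantCone τ ≤ orthantCone σ := h1.subset
  have hsub : {l | τ l ≠ 0} ⊆ {l | σ l ≠ 0} := fun l hl =>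
    show σ l ≠ 0 from orthantCone_le hle hl ▸ hl
  rw [affDim_orthantCone, affDim_orthantCone] at h2
  have h3 : ({l | σ l ≠ 0} \ {l | τ l ≠ 0}).ncard = 1 := by
    rw [Set.ncard_sdiff hsub]
    omega
  obtain ⟨l, hl⟩ := Set.ncard_eq_one.mp h3
  have hmem : ∀ j, (σ j ≠ 0 ∧ τ j = 0) ↔ j = l := fun j => by
    have := Set.ext_iff.mp hl j
    simpa using this
  refine ⟨l, ((hmem l).mpr rfl).1, funext fun j => ?_⟩
  by_cases hj : j = l
  · subst hj
    simpa using ((hmem j).mpr rfl).2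
  · rw [Function.update_of_ne hj]
    by_cases hτ : τ j = 0
    · by_contra hσ
      exact hj ((hmem j).mp ⟨fun h => hσ (by rw [hτ, h]), hτ⟩)
    · exact orthantCone_le hle hτ

end Fan

/-! ### Sections of a locally anti-blocking polytope -/

section LocallyAntiBlocking

variable {d : ℕ} {P Q : Set (EuclideanSpace ℝ (Fin d))} {J : Set (Fin d)} {σ : Fin d → SignType}
  {c : Set (EuclideanSpace ℝ (Fin d)) → EuclideanSpace ℝ (Fin d)}
  {H : Finset (EuclideanSpace ℝ (Fin d) × ℝ)}

theorem IsPolytope.inter_coordSubspace (hP : IsPolytope P) (J : Set (Fin d)) :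
    IsPolytope (P ∩ (coordSubspace J : Set (EuclideanSpace ℝ (Fin d)))) := by
  classical
  obtain ⟨hcomp, H, hH⟩ := hP
  refine ⟨hcomp.inter_right (Submodule.closed_of_finiteDimensional _),
    H ∪ ((Finset.univ.filter (· ∉ J)).image (fun l => (stdVec l, 0)) ∪
      (Finset.univ.filter (· ∉ J)).image fun l => (-stdVec l, 0)), ?_⟩
  ext x
  rw [Set.mem_inter_iff, SetLike.mem_coe, mem_coordSubspace, hH]
  simp only [Set.mem_ofPred_eq, Finset.mem_union, or_imp, forall_and, Finset.forall_mem_image,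
    Finset.mem_filter, Finset.mem_univ, true_and, inner_neg_right, inner_stdVec_right,
    neg_nonpos, and_congr_right_iff]
  exact fun _ => ⟨fun h => ⟨fun l hl => (h l hl).le, fun l hl => (h l hl).ge⟩,
    fun h l hl => le_antisymm (h.1 hl) (h.2 hl)⟩

theorem IsLocallyAntiBlocking.proj_mem (hP : IsLocallyAntiBlocking P)
    {x : EuclideanSpace ℝ (Fin d)} (hx : x ∈ P) (l : Fin d) : x - x l • stdVec l ∈ P := by
  have h : (coordSubspace {j | j ≠ l}).starProjection x = x - x l • stdVec l := by
    apply Submodule.eq_starProjection_of_mem_of_inner_eq_zero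
    · refine mem_coordSubspace.mpr fun j hj => ?_
      obtain rfl : j = l := not_not.mp hj
      simp [stdVec_apply]
    · intro w hw
      rw [sub_sub_cancel, real_inner_smul_left, inner_stdVec,
        mem_coordSubspace.mp hw l (by simp), mul_zero]
  have h2 := hP {j | j ≠ l} ▸ Set.mem_image_of_mem _ hx
  exact (h ▸ h2).1

theorem IsLocallyAntiBlocking.isCoordSection (hP : IsPolytope P) (hlab : IsLocallyAntiBlocking P)
    (h0 : (0 : EuclideanSpace ℝ (Fin d)) ∈ interior P) (J : Set (Fin d)) :
    IsCoordSection J (P ∩ (coordSubspace J : Set (EuclideanSpace ℝ (Fin d)))) where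
  isPolytope := hP.inter_coordSubspace J
  proj_mem x hx l := by
    refine ⟨hlab.proj_mem hx.1 l, mem_coordSubspace.mpr fun j hj => ?_⟩
    have h := mem_coordSubspace.mp hx.2
    by_cases hjl : j = l
    · subst hjl
      simp [stdVec_apply]
    · simp [stdVec_apply, hjl, h j hj]
  apply_eq_zero x hx := mem_coordSubspace.mp hx.2
  exists_ball := by
    obtain ⟨ε, hε, h⟩ := Metric.isOpen_iff.mp isOpen_interior 0 h0
    refine ⟨ε / 2, by positivity, fun x hx hn => ⟨interior_subset (h ?_), ?_⟩⟩
    · rw [mem_ball_zero_iff]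
      linarith
    · exact mem_coordSubspace.mpr hx

/-- A cone of the standard fan meets the relative interior of a face exactly if it contains the
representative point of the face. -/
theorem IsRep.orthantCone_meets_iff (hc : IsRep Q c) (hH : IsHRep Q H)
    {F : Set (EuclideanSpace ℝ (Fin d))} (hF : IsExposed ℝ Q F) (hne : F.Nonempty) :
    (intrinsicInterior ℝ F ∩ (orthantCone σ : Set (EuclideanSpace ℝ (Fin d)))).Nonempty ↔
      c F ∈ orthantCone σ := by
  refine ⟨?_, fun h => ⟨c F, hc.mem_interior F hF hne, h⟩⟩
  rintro ⟨x, hx, hxσ⟩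
  refine mem_orthantCone.mpr fun l hl => ?_
  -- A coordinate that is nonzero at the representative point has constant strict sign on the
  -- relative interior.
  have key : ∀ r : ℝ, 0 < r * c F l → 0 < r * x l := fun r hr => by
    obtain ⟨h1, y, hy, h2⟩ := (hc.pos_iff hH hF hne).mp hr
    exact hH.pos_of_nonneg hF hx h1 hy h2
  have hs := mem_orthantCone.mp hxσ l
  rcases hl.lt_or_gt with h | h
  · have := key (-1) (by linarith)
    have hxl : x l < 0 := by linarith
    rw [← hs hxl.ne, sign_neg h, sign_neg hxl]
  · have hxl : 0 < x l := by simpa using key 1 (by linarith)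
    rw [← hs hxl.ne', sign_pos h, sign_pos hxl]

namespace Flags

/-- The cones in the definition of the sign are those that contain the representative points. -/
theorem sign_eq_sInf (hc : IsRep Q c) (hH : IsHRep Q H) (F : Flags Q) :
    F.sign = sInf {C | C ∈ stdFan d ∧ ∀ i, 0 ≤ i → i ≤ affDim Q → c (F.nth i) ∈ C} := by
  rw [Flags.sign]
  congr 1
  ext C
  refine and_congr_right fun hC => ?_
  obtain ⟨τ, rfl⟩ := mem_stdFan.mp hC
  have key : ∀ i, 0 ≤ i → i ≤ affDim Q →
      ((intrinsicInterior ℝ (F.nth i) ∩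
        (orthantCone τ : Set (EuclideanSpace ℝ (Fin d)))).Nonempty ↔
        c (F.nth i) ∈ orthantCone τ) := fun i h0 h1 =>
    hc.orthantCone_meets_iff hH (F.nth_isExposed i) (F.nth_nonempty h0 h1)
  constructor
  · intro h i h0 h1
    have := h ⟨i, by omega, h1⟩ h0
    rw [← F.nth_coe] at this
    exact (key i h0 h1).mp this
  · intro h i h0
    rw [← F.nth_coe]
    exact (key i h0 i.2.2).mpr (h i h0 i.2.2)

theorem HasSign.sign_eq_orthantCone (hc : IsRep Q c) (hH : IsHRep Q H) {F : Flags Q}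
    (hF : F.HasSign c σ) : F.sign = orthantCone σ := by
  rw [sign_eq_sInf hc hH]
  apply le_antisymm
  · exact sInf_le ⟨mem_stdFan.mpr ⟨σ, rfl⟩, fun i h0 h1 => mem_orthantCone.mpr (hF.1 i h0 h1)⟩
  · rintro x hx
    refine Submodule.mem_sInf.mpr ?_
    rintro C ⟨hC, h⟩
    obtain ⟨τ, rfl⟩ := mem_stdFan.mp hC
    refine mem_orthantCone.mpr fun l hl => ?_
    have h1 := mem_orthantCone.mp hx l hl
    have hσ : σ l ≠ 0 := by
      rw [← h1]
      exact sign_ne_zero.mpr hl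
    obtain ⟨i, h0, h2, h3⟩ := hF.2 l hσ
    rw [h1, ← hF.1 i h0 h2 l h3, mem_orthantCone.mp (h i h0 h2) l h3]

theorem sign_eq_orthantCone_iff (hc : IsRep Q c) (hH : IsHRep Q H) (F : Flags Q) :
    F.sign = orthantCone σ ↔ F.HasSign c σ := by
  refine ⟨fun h => ?_, fun h => h.sign_eq_orthantCone hc hH⟩
  obtain ⟨τ, hτ⟩ := F.exists_hasSign hc hH
  rwa [orthantCone_injective (h.symm.trans (hτ.sign_eq_orthantCone hc hH))]

theorem factorial_le_encard_sign (hQ : IsCoordSection {l | σ l ≠ 0} Q) :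
    (({l | σ l ≠ 0}.ncard ! : ℕ) : ℕ∞) ≤ {F : Flags Q | F.sign = orthantCone σ}.encard := by
  classical
  obtain ⟨H, hH⟩ := hQ.exists_isHRep
  obtain ⟨c, hc⟩ := hQ.exists_isRep
  simp only [sign_eq_orthantCone_iff hc hH]
  obtain ⟨n, hn⟩ : ∃ n, {l | σ l ≠ 0}.ncard = n := ⟨_, rfl⟩
  have e : Fin n ≃ {l | σ l ≠ 0} :=
    (Finite.equivFinOfCardEq (by rw [Nat.card_coe_set_eq, hn])).symm
  have hr : Set.range (fun i => (e i : Fin d)) = {l | σ l ≠ 0} := by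
    change Set.range (Subtype.val ∘ e) = _
    rw [Set.range_comp, e.range_eq_univ, Set.image_univ, Subtype.range_coe]
  rw [hn]
  refine factorial_le_encard (e := fun i => (e i : Fin d)) (by rwa [hr]) hc
    (Subtype.val_injective.comp e.injective) fun l => ?_
  rw [hr]
  rfl

/-- Extending flags of the section by a coordinate hyperplane to flags of `Q` with prescribed sign
of the additional coordinate is injective. -/
theorem exists_injective_sign (hQ : IsCoordSection {l | σ l ≠ 0} Q) {l : Fin d} (hl : σ l ≠ 0)
    {Q' : Set (EuclideanSpace ℝ (Fin d))} (hQ' : Q' = Q ∩ coordHyper l) :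
    ∃ χ : {F : Flags Q' | F.sign = orthantCone (Function.update σ l 0)} →
      {F : Flags Q | F.sign = orthantCone σ}, Function.Injective χ := by
  subst hQ'
  obtain ⟨H, hH⟩ := hQ.exists_isHRep
  obtain ⟨H', hH'⟩ := (hQ.inter_coordHyper l).exists_isHRep
  obtain ⟨c, hc⟩ := hQ.exists_isRep
  choose f m hf hs using fun G : Flags (Q ∩ coordHyper l) =>
    exists_extension hQ hc hl G (r := (σ l : ℝ)) (Flags.signType_coe_ne_zero.mpr hl)
  have hs' : ∀ G, SignType.sign (c ((f G).nth (m G)) l) = σ l := fun G => by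
    rw [hs]
    cases σ l <;> simp
  refine ⟨fun G => ⟨f G, (sign_eq_orthantCone_iff hc hH _).mpr
    ((IsExtension.hasSign_iff hQ hc hl (hf G) (hs' G)).mpr
      ((sign_eq_orthantCone_iff (hc.sectionRep hH l) hH' _).mp G.2))⟩, fun G G' h => ?_⟩
  have h1 : f G = f G' := congrArg Subtype.val h
  exact Subtype.ext (IsExtension.section_unique hQ hl (hf G) (h1 ▸ hf G'))

end Flags

end LocallyAntiBlocking

theorem mainTheorem2 (d : ℕ) (P : Set (EuclideanSpace ℝ (Fin d)))
    (hP : IsPolytope P) (hlab : IsLocallyAntiBlocking P)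
    (hproper : (0 : EuclideanSpace ℝ (Fin d)) ∈ interior P) :
    (∀ D ∈ stdFan d, affDim (D : Set (EuclideanSpace ℝ (Fin d))) = (d : ℤ) →
      ((d ! : ℕ) : ℕ∞) ≤ {F : Flags P | F.sign = D}.encard) ∧
    (∀ D ∈ stdFan d, ∀ n : ℕ, affDim (D : Set (EuclideanSpace ℝ (Fin d))) = (n : ℤ) →
      ((n ! : ℕ) : ℕ∞) ≤ (signedFlags D P).encard) ∧
    (∀ D ∈ stdFan d, ∀ C ∈ stdFan d, IsFacetOf C D →
      ∃ χ : signedFlags C P → signedFlags D P, Function.Injective χ) := by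
  have hsec : ∀ σ : Fin d → SignType,
      IsCoordSection {l | σ l ≠ 0} (P ∩ linSpan (orthantCone σ)) := fun σ => by
    rw [linSpan_orthantCone]
    exact hlab.isCoordSection hP hproper _
  have hcount : ∀ D ∈ stdFan d, ∀ n : ℕ, affDim (D : Set (EuclideanSpace ℝ (Fin d))) = (n : ℤ) →
      ((n ! : ℕ) : ℕ∞) ≤ (signedFlags D P).encard := by
    intro D hD n hn
    obtain ⟨σ, rfl⟩ := mem_stdFan.mp hD
    rw [affDim_orthantCone, Nat.cast_inj] at hn
    subst hn
    exact Flags.factorial_le_encard_sign (hsec σ)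
  refine ⟨fun D hD hn => ?_, hcount, fun D hD C hC hCD => ?_⟩
  · -- A full-dimensional cone spans the whole space, so its section is `P` itself.
    have h := hcount D hD d hn
    obtain ⟨σ, rfl⟩ := mem_stdFan.mp hD
    have hall : {l | σ l ≠ 0} = Set.univ := by
      rw [affDim_orthantCone, Nat.cast_inj] at hn
      exact Set.eq_of_subset_of_ncard_le (Set.subset_univ _) (by simp [hn])
    have hspan : P ∩ linSpan (orthantCone σ) = P := by
      refine Set.inter_eq_left.mpr fun x _ => ?_
      rw [linSpan_orthantCone, hall]
      exact mem_coordSubspace.mpr fun l hl => absurd (Set.mem_univ l) hl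
    rw [signedFlags] at h
    rwa [hspan] at h
  · obtain ⟨σ, rfl⟩ := mem_stdFan.mp hD
    obtain ⟨τ, rfl⟩ := mem_stdFan.mp hC
    obtain ⟨l, hl, rfl⟩ := exists_eq_update_of_isFacetOf hCD
    refine Flags.exists_injective_sign (hsec σ) hl ?_
    ext x
    simp only [linSpan_orthantCone, Set.mem_inter_iff, SetLike.mem_coe, mem_coordSubspace,
      Set.mem_ofPred_eq, not_not, mem_coordHyper, and_assoc]
    refine and_congr_right fun _ => ⟨fun h => ⟨fun j hj => h j ?_, h l (by simp)⟩, ?_⟩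
    · by_cases hjl : j = l
      · simp [hjl]
      · simp [Function.update_of_ne hjl, hj]
    · rintro ⟨h1, h2⟩ j hj
      by_cases hjl : j = l
      · exact hjl ▸ h2
      · exact h1 j (by rwa [Function.update_of_ne hjl] at hj)
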